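/- **Setting.** Let $V:\mathbb R^3\to\mathbb R$ be such that $V$ and (in the sense of distributions) $\mathbf x\cdot\nabla V$ belong to $L^2_{loc}(\mathbb R^3)$, $V(\mathbf x)\to 0$ as $|\mathbf x|\to\infty$, and, for some $\mu,R>0$, $|\partial^\beta V(\mathbf x)|\le|\mathbf x|^{-|\beta|-\mu}$ for $|\mathbf x|>R$ and $|\beta|=1,2$. Let $H_{el}=-\Delta+V$ in $L^2(\mathbb R^3)$, assume that $E_0=\inf\sigma(H_{el})<0$, and let $\varphi_{el}$ be a normalized ground state, $H_{el}\varphi_{el}=E_0\varphi_{el}$. Let $\mathbf p=-i\nabla$, let $\mathbf p(s)=e^{iH_{el}s}\mathbf p\,e^{-iH_{el}s}$ and $\mathbf x(s)=e^{iH_{el}s}\mathbf x\,e^{-iH_{el}s}$, and let $\mathbf 1_{ac}(H_{el})$ be the projection onto the absolutely continuous subspace of $H_{el}$. Let $\mathcal F$ be the symmetric Fock space over $L^2(\mathbb R^3\times\{1,2\})$ with vacuum $\Omega$, creation and annihilation operators $a^*(h),a(h)$, and field energy $H_f=d\Gamma(|\mathbf k|)$. Let $\kappa\in\mathcal S(\mathbb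 R^3)$, let $\boldsymbol\varepsilon(\mathbf k,\lambda)\in\mathbb R^3$, $\lambda=1,2$, be orthonormal polarization vectors perpendicular to $\mathbf k$ (measurable in $\mathbf k$), and put $\mathbf G_0(\mathbf k,\lambda)=\kappa(\mathbf k)(2|\mathbf k|)^{-1/2}\boldsymbol\varepsilon(\mathbf k,\lambda)$, $\mathbf A(0)=a(\mathbf G_0)+a^*(\mathbf G_0)$, $\mathbf A(0,s)=e^{iH_fs}\mathbf A(0)e^{-iH_fs}$, $\mathbf E(0,s)=-i[H_f,\mathbf A(0,s)]$. For $f_1,\dots,f_n\in L^2(\mathbb R^3\times\{1,2\})$ and occupation numbers $m_1,\dots,m_n\in\mathbb N$ write $\underline f=(f_1,m_1,\dots,f_n,m_n)$, $a^*(\underline f)=\prod_{k=1}^n (m_k!)^{-1/2}a^*(f_k)^{m_k}$ and $$P^{(3)}(\underline f)=\Big\|\big(\mathbf 1_{ac}(H_{el})\otimes\mathbf 1\big)\int_{-\infty}^{\infty}2\mathbf p(s)\varphi_{el}\otimes[\mathbf A(0,s),a^*(\underline f)]\Omega\,ds\Big\|^2 ,$$ where the scalar product of the two vectors of operators is understood;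 $P^{(3)}(f_l)$ denotes this quantity for the single photon $f_l$ with occupation number $1$. **Proposition.** Suppose that $\langle f_i,f_j\rangle=\delta_{ij}$ and that $\sum_{\lambda}\boldsymbol\varepsilon(\cdot,\lambda)f_l(\cdot,\lambda)\in C_0^2(\mathbb R^3\setminus\{0\},\mathbb C^3)$ for every $l$. Then all expressions above and below are well defined (the vectors lie in the domains of the operators applied to them, and the integrals over $s$ converge absolutely), and $$P^{(3)}(\underline f)=\sum_{l=1}^n m_l\,P^{(3)}(f_l),$$ where, for every $l$, $$P^{(3)}(f_l)=\Big\|\mathbf 1_{ac}(H_{el})\int_{-\infty}^{\infty}2\mathbf p(s)\varphi_{el}\cdot\langle\Omega,\mathbf A(0,s)a^*(f_l)\Omega\rangle\,ds\Big\|^2=\Big\|\mathbf 1_{ac}(H_{el})\int_{-\infty}^{\infty}\mathbf x(s)\varphi_{el}\cdot\langle\Omega,\mathbf E(0,s)a^*(f_l)\Omega\rangle\,ds\Big\|^2 .$$ -/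

import Mathlib

open MeasureTheory Filter Topology
open scoped ENNReal TensorProduct SchwartzMap Laplacian LineDeriv Distributions

noncomputable section

namespace Photoeffect

/-! ### Partially defined linear operators on a complex Hilbert space -/

section Operators

variable {E : Type*} [NormedAddCommGroup E] [InnerProductSpace ℂ E]

/-- The value `T ψ` of an unbounded operator; it is only meaningful for `ψ ∈ D(T)`. -/
def opVal (T : E →ₗ.[ℂ] E) (ψ : E) : E :=
  open Classical in if h : ψ ∈ T.domain then T ⟨ψ, h⟩ else 0

/-- The product `S T` with its natural domain `{ψ ∈ D(T) | T ψ ∈ D(S)}`. -/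
def opMul (S T : E →ₗ.[ℂ] E) : E →ₗ.[ℂ] E where
  domain :=
    { carrier := {ψ | ∃ h : ψ ∈ T.domain, T ⟨ψ, h⟩ ∈ S.domain}
      add_mem' := by
        rintro a b ⟨ha, ha'⟩ ⟨hb, hb'⟩
        refine ⟨T.domain.add_mem ha hb, ?_⟩
        have : T ⟨a + b, T.domain.add_mem ha hb⟩ = T ⟨a, ha⟩ + T ⟨b, hb⟩ :=
          T.map_add ⟨a, ha⟩ ⟨b, hb⟩
        rw [this]
        exact S.domain.add_mem ha' hb'
      zero_mem' := by
        refine ⟨T.domain.zero_mem, ?_⟩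
        have : T ⟨0, T.domain.zero_mem⟩ = 0 := T.map_zero
        rw [this]
        exact S.domain.zero_mem
      smul_mem' := by
        rintro c a ⟨ha, ha'⟩
        refine ⟨T.domain.smul_mem c ha, ?_⟩
        have : T ⟨c • a, T.domain.smul_mem c ha⟩ = c • T ⟨a, ha⟩ := T.map_smul c ⟨a, ha⟩
        rw [this]
        exact S.domain.smul_mem c ha' }
  toFun :=
    { toFun := fun ψ => S ⟨T ⟨ψ, ψ.2.choose⟩, ψ.2.choose_spec⟩
      map_add' := by
        intro a b
        rw [← S.map_add]
        congr 1
        apply Subtype.ext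
        exact T.map_add ⟨a, a.2.choose⟩ ⟨b, b.2.choose⟩
      map_smul' := by
        intro c a
        rw [RingHom.id_apply, ← S.map_smul]
        congr 1
        apply Subtype.ext
        exact T.map_smul c ⟨a, a.2.choose⟩ }

/-- The identity operator. -/
def opOne : E →ₗ.[ℂ] E := (LinearMap.id : E →ₗ[ℂ] E).toPMap ⊤

/-- A bounded operator, viewed as an operator with domain the whole space. -/
def opBdd (B : E →L[ℂ] E) : E →ₗ.[ℂ] E := (B : E →ₗ[ℂ] E).toPMap ⊤

/-- Powers `T ^ m`. -/
def opPow (T : E →ₗ.[ℂ] E) : ℕ → (E →ₗ.[ℂ] E)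
  | 0 => opOne
  | m + 1 => opMul T (opPow T m)

/-- The product `T₁ T₂ ⋯ T_n` of a list of operators, in this order. -/
def opProd : List (E →ₗ.[ℂ] E) → (E →ₗ.[ℂ] E)
  | [] => opOne
  | T :: L => opMul T (opProd L)

/-- The commutator `[S, T] = S T - T S` on the natural domain `D(S T) ∩ D(T S)`. -/
def opComm (S T : E →ₗ.[ℂ] E) : E →ₗ.[ℂ] E := opMul S T - opMul T S

/-- The spectrum of an unbounded operator: the complement of the set of those `z` for which
`T - z : D(T) → E` is a bijection with bounded inverse. -/
def opSpectrum (T : E →ₗ.[ℂ] E) : Set ℂ :=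
  {z | ¬ ∃ R : E →L[ℂ] E, (∀ ψ : T.domain, R (T ψ - z • (ψ : E)) = ψ) ∧
    ∀ χ : E, ∃ h : R χ ∈ T.domain, T ⟨R χ, h⟩ - z • R χ = χ}

/-- `U t = e^{-i t H}`: `U` is a strongly continuous one-parameter unitary group and `H` is its
generator, i.e. `ψ ∈ D(H)` with `H ψ = χ` if and only if `t ↦ U t ψ` has derivative `-i χ` at
`t = 0`. -/
structure IsUnitaryGroup (H : E →ₗ.[ℂ] E) (U : ℝ → E →L[ℂ] E) : Prop where
  zero : U 0 = ContinuousLinearMap.id ℂ E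
  add : ∀ s t, U (s + t) = (U s).comp (U t)
  norm_map : ∀ t ψ, ‖U t ψ‖ = ‖ψ‖
  continuous : ∀ ψ, Continuous fun t => U t ψ
  generator : ∀ ψ χ : E, (ψ, χ) ∈ H.graph ↔ HasDerivAt (fun t => U t ψ) (-Complex.I • χ) 0

/-- The unitary group `t ↦ e^{-i t H}` of a self-adjoint operator `H` (it exists and is unique by
Stone's theorem; the value for operators that generate no unitary group is immaterial). -/
def unitaryGroup (H : E →ₗ.[ℂ] E) : ℝ → E →L[ℂ] E :=
  open Classical in
  if h : ∃ U, IsUnitaryGroup H U then h.choose else fun _ => ContinuousLinearMap.id ℂ E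

/-- `μ` is the spectral measure of the self-adjoint operator `H` in the vector `ψ`: the (unique)
finite measure on `ℝ` with `⟨ψ, e^{-i t H} ψ⟩ = ∫ e^{-i t x} dμ(x)` for all `t`. -/
def IsSpectralMeasure (H : E →ₗ.[ℂ] E) (ψ : E) (μ : Measure ℝ) : Prop :=
  IsFiniteMeasure μ ∧
    ∀ t : ℝ, inner ℂ ψ (unitaryGroup H t ψ) = ∫ x : ℝ, Complex.exp (-(Complex.I * t * x)) ∂μ

/-- The absolutely continuous subspace of `H`: the vectors whose spectral measure is absolutely
continuous with respect to Lebesgue measure. (For self-adjoint `H` these vectors already form a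
closed subspace, so that taking the closed span adds nothing.) -/
def acSubspace (H : E →ₗ.[ℂ] E) : Submodule ℂ E :=
  (Submodule.span ℂ {ψ | ∃ μ : Measure ℝ, IsSpectralMeasure H ψ μ ∧ μ ≪ volume}).topologicalClosure

variable [CompleteSpace E]

/-- The spectral projection `1_ac(H)`. -/
def acProj (H : E →ₗ.[ℂ] E) : E →L[ℂ] E :=
  haveI : CompleteSpace (acSubspace H) :=
    (Submodule.isClosed_topologicalClosure _).completeSpace_coe
  (acSubspace H).starProjection

/-- The Heisenberg evolution `B(s) = e^{i H s} B e^{-i H s}`. -/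
def heisenberg (H B : E →ₗ.[ℂ] E) (s : ℝ) : E →ₗ.[ℂ] E :=
  opMul (opBdd (unitaryGroup H (-s))) (opMul B (opBdd (unitaryGroup H s)))

end Operators

/-! ### The electron -/

/-- The space `ℝ³`. -/
abbrev R3 : Type := EuclideanSpace ℝ (Fin 3)

/-- The standard basis vector `e_j` of `ℝ³`. -/
def stdVec (j : Fin 3) : R3 := EuclideanSpace.single j 1

/-- The electron Hilbert space `L²(ℝ³)`. -/
abbrev ElectronSpace : Type := Lp ℂ 2 (volume : Measure R3)

section Multiplication

variable {X : Type*} [MeasurableSpace X] (μ : Measure X)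

/-- The graph of multiplication by `v` in `L²(μ)`. -/
def mulGraph (v : X → ℂ) : Submodule ℂ (Lp ℂ 2 μ × Lp ℂ 2 μ) where
  carrier := {p | p.2 =ᵐ[μ] fun x => v x * p.1 x}
  add_mem' := by
    intro a b ha hb
    simp only [Set.mem_ofPred_eq] at ha hb ⊢
    filter_upwards [ha, hb, Lp.coeFn_add a.1 b.1, Lp.coeFn_add a.2 b.2] with x h1 h2 h3 h4
    simp only [Prod.fst_add, Prod.snd_add, Pi.add_apply] at *
    rw [h4, h3, h1, h2]; ring
  zero_mem' := by
    simp only [Set.mem_ofPred_eq, Prod.fst_zero, Prod.snd_zero]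
    filter_upwards [Lp.coeFn_zero ℂ 2 μ] with x h
    rw [h]; simp
  smul_mem' := by
    intro c a ha
    simp only [Set.mem_ofPred_eq] at ha ⊢
    filter_upwards [ha, Lp.coeFn_smul c a.1, Lp.coeFn_smul c a.2] with x h1 h3 h4
    simp only [Prod.smul_fst, Prod.smul_snd, Pi.smul_apply, smul_eq_mul] at *
    rw [h4, h3, h1]; ring

/-- The operator of multiplication by `v` on its maximal domain `{ψ ∈ L² | v ψ ∈ L²}`. -/
def mulOp (v : X → ℂ) : Lp ℂ 2 μ →ₗ.[ℂ] Lp ℂ 2 μ := (mulGraph μ v).toLinearPMap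

theorem mem_graph_mulOp (v : X → ℂ) (ψ χ : Lp ℂ 2 μ) :
    (ψ, χ) ∈ (mulOp μ v).graph ↔ χ =ᵐ[μ] fun x => v x * ψ x := by
  rw [mulOp, Submodule.toLinearPMap_graph_eq]
  · rfl
  · rintro ⟨a, b⟩ hab (rfl : a = 0)
    have h : b =ᵐ[μ] fun x => v x * (0 : Lp ℂ 2 μ) x := hab
    refine Lp.ext ?_
    filter_upwards [h, Lp.coeFn_zero ℂ 2 μ] with x h1 h2
    rw [h1, h2]; simp

end Multiplication

/-- The position operator `x_j`. -/
def position (j : Fin 3) : ElectronSpace →ₗ.[ℂ] ElectronSpace :=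
  mulOp volume fun x => ((x j : ℝ) : ℂ)

/-- The operator in `L²(ℝ³)` that is given by a linear operator `D` on tempered distributions, on
the domain `{ψ ∈ L² | D ψ ∈ L²}`. -/
def distribOp (D : 𝓢'(R3, ℂ) →ₗ[ℂ] 𝓢'(R3, ℂ)) : ElectronSpace →ₗ.[ℂ] ElectronSpace :=
  (LinearMap.eqLocus
    (D ∘ₗ (Lp.toTemperedDistributionCLM ℂ (volume : Measure R3) 2 :
      ElectronSpace →ₗ[ℂ] 𝓢'(R3, ℂ)) ∘ₗ LinearMap.fst ℂ ElectronSpace ElectronSpace)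
    ((Lp.toTemperedDistributionCLM ℂ (volume : Measure R3) 2 :
      ElectronSpace →ₗ[ℂ] 𝓢'(R3, ℂ)) ∘ₗ LinearMap.snd ℂ ElectronSpace ElectronSpace)).toLinearPMap

theorem mem_graph_distribOp (D : 𝓢'(R3, ℂ) →ₗ[ℂ] 𝓢'(R3, ℂ)) (ψ χ : ElectronSpace) :
    (ψ, χ) ∈ (distribOp D).graph ↔
      D (Lp.toTemperedDistribution ψ) = Lp.toTemperedDistribution χ := by
  rw [distribOp, Submodule.toLinearPMap_graph_eq]
  · rfl
  · rintro ⟨a, b⟩ hab (rfl : a = 0)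
    have h : D (Lp.toTemperedDistributionCLM ℂ (volume : Measure R3) 2 0) =
      Lp.toTemperedDistributionCLM ℂ (volume : Measure R3) 2 b := hab
    rw [map_zero, map_zero] at h
    have hb : b ∈ (Lp.toTemperedDistributionCLM ℂ (volume : Measure R3) 2).ker := by
      rw [LinearMap.mem_ker]; exact h.symm
    rw [Lp.ker_toTemperedDistributionCLM_eq_bot] at hb
    exact hb

/-- The momentum operator `p_j = -i ∂_j` (distributional derivative) with domain
`{ψ ∈ L² | ∂_j ψ ∈ L²}`. -/
def momentum (j : Fin 3) : ElectronSpace →ₗ.[ℂ] ElectronSpace :=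
  distribOp (-Complex.I • (LineDeriv.lineDerivOpCLM ℂ 𝓢'(R3, ℂ) (stdVec j) : 𝓢'(R3, ℂ) →ₗ[ℂ] 𝓢'(R3, ℂ)))

/-- The operator `-Δ` (distributional Laplacian) with domain `{ψ ∈ L² | Δ ψ ∈ L²} = H²(ℝ³)`. -/
def negLaplacian : ElectronSpace →ₗ.[ℂ] ElectronSpace :=
  distribOp (-(LineDeriv.laplacianCLM ℂ R3 𝓢'(R3, ℂ) : 𝓢'(R3, ℂ) →ₗ[ℂ] 𝓢'(R3, ℂ)))

theorem mem_graph_momentum (j : Fin 3) (ψ χ : ElectronSpace) :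
    (ψ, χ) ∈ (momentum j).graph ↔
      -Complex.I • ∂_{stdVec j} (Lp.toTemperedDistribution ψ) = Lp.toTemperedDistribution χ :=
  mem_graph_distribOp _ ψ χ

theorem mem_graph_negLaplacian (ψ χ : ElectronSpace) :
    (ψ, χ) ∈ negLaplacian.graph ↔
      -Δ (Lp.toTemperedDistribution ψ) = Lp.toTemperedDistribution χ := by
  rw [negLaplacian, mem_graph_distribOp, ← TemperedDistribution.laplacianCLM_apply]
  rfl

/-- The electron Hamiltonian `H_el = -Δ + V` on `D(-Δ) ∩ D(V)`. -/
def Hel (V : R3 → ℝ) : ElectronSpace →ₗ.[ℂ] ElectronSpace :=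
  negLaplacian + mulOp volume fun x => ((V x : ℝ) : ℂ)

/-- `E₀ = inf σ(H_el)`. -/
def groundEnergy (V : R3 → ℝ) : ℝ := sInf {x : ℝ | (x : ℂ) ∈ opSpectrum (Hel V)}

/-- `φ` is a normalized ground state of `H_el`. -/
def IsGroundState (V : R3 → ℝ) (φ : ElectronSpace) : Prop :=
  ‖φ‖ = 1 ∧ (φ, ((groundEnergy V : ℝ) : ℂ) • φ) ∈ (Hel V).graph

/-- `f ∈ L²_loc(ℝ³)`. -/
def MemL2loc (f : R3 → ℝ) : Prop := ∀ K : Set R3, IsCompact K → MemLp f 2 (volume.restrict K)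

/-- The iterated distributional derivative `∂_{v 0} ⋯ ∂_{v (n-1)} f` is, on the open set `Ω`, given
by the locally integrable function `g`. -/
def HasWeakDeriv (Ω : TopologicalSpace.Opens R3) {n : ℕ} (v : Fin n → R3) (f g : R3 → ℝ) : Prop :=
  LocallyIntegrableOn g Ω ∧
    ∀ η : 𝓓(Ω, ℝ), ∫ x, f x * (∂^{v} η) x = (-1) ^ n * ∫ x, g x * η x

/-- The exterior domain `{x | R < |x|}`. -/
def exterior (R : ℝ) : TopologicalSpace.Opens R3 :=
  ⟨{x | R < ‖x‖}, isOpen_lt continuous_const continuous_norm⟩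

/-- The standing hypotheses on the external potential: `V` and (in the sense of distributions)
`x · ∇V` belong to `L²_loc`, `V` vanishes at infinity, for some `μ > 0`, `R > 0` the derivatives
`∂^β V` of order `|β| = 1, 2` are bounded by `|x|^{-|β|-μ}` on `{|x| > R}`, and
`inf σ(H_el) < 0`. -/
structure AdmissiblePotential (V : R3 → ℝ) : Prop where
  memL2loc : MemL2loc V
  virial : ∃ W : R3 → ℝ, MemL2loc W ∧ ∀ η : 𝓓((⊤ : TopologicalSpace.Opens R3), ℝ),
    ∫ x, W x * η x = -∫ x, V x * (3 * η x + ∑ j, x j * (∂_{stdVec j} η) x)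
  tendsto_zero : Tendsto V (cocompact R3 ⊓ ae volume) (𝓝 0)
  decay : ∃ μ R : ℝ, 0 < μ ∧ 0 < R ∧ ∀ n : ℕ, n = 1 ∨ n = 2 → ∀ β : Fin n → Fin 3,
    ∃ g : R3 → ℝ, HasWeakDeriv (exterior R) (fun i => stdVec (β i)) V g ∧
      ∀ᵐ x, R < ‖x‖ → |g x| ≤ ‖x‖ ^ (-(n : ℝ) - μ)
  groundEnergy_neg : groundEnergy V < 0

/-! ### Photons: the symmetric Fock space -/

/-- A photon mode `(k, λ)`: wave vector and polarization index. -/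
abbrev Mode : Type := R3 × Fin 2

/-- Lebesgue measure times counting measure. -/
def modeMeasure : Measure Mode := (volume : Measure R3).prod Measure.count

instance : SigmaFinite modeMeasure := by unfold modeMeasure; infer_instance

/-- The one-photon space `L²(ℝ³ × {1,2})`. -/
abbrev PhotonSpace : Type := Lp ℂ 2 modeMeasure

/-- The product measure on `(ℝ³ × {1,2})ⁿ`. -/
def modeMeasures (n : ℕ) : Measure (Fin n → Mode) := Measure.pi fun _ => modeMeasure

/-- `L²((ℝ³ × {1,2})ⁿ)`, the `n`-fold tensor power of the one-photon space. -/
abbrev TensorPower (n : ℕ) : Type := Lp ℂ 2 (modeMeasures n)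

theorem measurePreserving_permute {n : ℕ} (σ : Equiv.Perm (Fin n)) :
    MeasurePreserving (fun k : Fin n → Mode => fun i => k (σ i)) (modeMeasures n)
      (modeMeasures n) := by
  have h := measurePreserving_piCongrLeft (fun _ : Fin n => modeMeasure) σ.symm
  unfold modeMeasures
  convert h using 1
  ext k i : 2
  have := Equiv.piCongrLeft_apply_apply (fun _ : Fin n => Mode) σ.symm k (σ i)
  rw [Equiv.symm_apply_apply] at this
  rw [MeasurableEquiv.coe_piCongrLeft]
  exact this.symm

/-- The action of a permutation of the photon variables. -/
def permute {n : ℕ} (σ : Equiv.Perm (Fin n)) : TensorPower n →ₗᵢ[ℂ] TensorPower n :=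
  Lp.compMeasurePreservingₗᵢ ℂ _ (measurePreserving_permute σ)

/-- The subspace of symmetric functions in `L²((ℝ³ × {1,2})ⁿ)`. -/
def symmetricSubspace (n : ℕ) : Submodule ℂ (TensorPower n) :=
  ⨅ σ : Equiv.Perm (Fin n), LinearMap.eqLocus (permute σ).toLinearMap LinearMap.id

theorem isClosed_symmetricSubspace (n : ℕ) :
    IsClosed (symmetricSubspace n : Set (TensorPower n)) := by
  rw [symmetricSubspace, Submodule.coe_iInf]
  exact isClosed_iInter fun σ => isClosed_eq (permute σ).continuous continuous_id

instance (n : ℕ) : CompleteSpace (symmetricSubspace n) :=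
  (isClosed_symmetricSubspace n).completeSpace_coe

/-- The orthogonal projection `S_n` onto the symmetric functions. -/
def symmetrizer (n : ℕ) : TensorPower n →L[ℂ] symmetricSubspace n :=
  (symmetricSubspace n).orthogonalProjectionOnto

/-- The symmetric Fock space over `L²(ℝ³ × {1,2})`. -/
abbrev Fock : Type := lp (fun n : ℕ => symmetricSubspace n) 2

theorem measure_univ_modeMeasures_zero : modeMeasures 0 Set.univ ≠ ∞ := by
  simp [modeMeasures]

/-- The constant function `1` of no variables. -/
def oneZero : TensorPower 0 :=
  indicatorConstLp 2 MeasurableSet.univ measure_univ_modeMeasures_zero (1 : ℂ)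

theorem oneZero_mem : oneZero ∈ symmetricSubspace 0 := by
  rw [symmetricSubspace, Submodule.mem_iInf]
  intro σ
  have h : (fun k : Fin 0 → Mode => fun i => k (σ i)) = id := by
    funext k i; exact i.elim0
  rw [LinearMap.mem_eqLocus]
  refine Lp.ext ?_
  refine (Lp.coeFn_compMeasurePreserving oneZero (measurePreserving_permute σ)).trans ?_
  rw [h]
  rfl

/-- The vacuum vector `Ω = (1, 0, 0, …)`. -/
def vacuum : Fock := lp.single 2 0 ⟨oneZero, oneZero_mem⟩

theorem memLp_tensorCons {n : ℕ} (h : PhotonSpace) (Ψ : TensorPower n) :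
    MemLp (fun k : Fin (n + 1) → Mode => h (k 0) * Ψ (Fin.tail k)) 2 (modeMeasures (n + 1)) := by
  have h1 : MemLp (fun p : Mode × (Fin n → Mode) => h p.1 * Ψ p.2) 2
      (modeMeasure.prod (modeMeasures n)) := by
    have hs : SigmaFinite (modeMeasures n) := by unfold modeMeasures; infer_instance
    rw [memLp_two_iff_integrable_sq_norm]
    · have := ((memLp_two_iff_integrable_sq_norm (Lp.memLp h).1).1 (Lp.memLp h)).mul_prod
        ((memLp_two_iff_integrable_sq_norm (Lp.memLp Ψ).1).1 (Lp.memLp Ψ))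
      simpa [mul_pow] using this
    · exact ((Lp.memLp h).1.comp_fst).mul ((Lp.memLp Ψ).1.comp_snd)
  exact h1.comp_measurePreserving
    (measurePreserving_piFinSuccAbove (fun _ : Fin (n + 1) => modeMeasure) 0)

/-- `h ⊗ Ψ`, the function `(k_1, …, k_{n+1}) ↦ h(k_1) Ψ(k_2, …, k_{n+1})`. -/
def tensorCons {n : ℕ} (h : PhotonSpace) (Ψ : TensorPower n) : TensorPower (n + 1) :=
  (memLp_tensorCons h Ψ).toLp

theorem quasiMeasurePreserving_tail (n : ℕ) :
    Measure.QuasiMeasurePreserving (fun k : Fin (n + 1) → Mode => Fin.tail k)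
      (modeMeasures (n + 1)) (modeMeasures n) := by
  have hs : SigmaFinite (modeMeasures n) := by unfold modeMeasures; infer_instance
  exact (Measure.quasiMeasurePreserving_snd (μ := modeMeasure) (ν := modeMeasures n)).comp
    (measurePreserving_piFinSuccAbove
      (fun _ : Fin (n + 1) => modeMeasure) 0).quasiMeasurePreserving

theorem tensorCons_add {n : ℕ} (h : PhotonSpace) (Ψ Φ : TensorPower n) :
    tensorCons h (Ψ + Φ) = tensorCons h Ψ + tensorCons h Φ := by
  refine Lp.ext ?_
  filter_upwards [Lp.coeFn_add (tensorCons h Ψ) (tensorCons h Φ),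
    (memLp_tensorCons h Ψ).coeFn_toLp, (memLp_tensorCons h Φ).coeFn_toLp,
    (memLp_tensorCons h (Ψ + Φ)).coeFn_toLp,
    (quasiMeasurePreserving_tail n).ae (Lp.coeFn_add Ψ Φ)] with k h1 h2 h3 h4 h5
  rw [h1, Pi.add_apply, tensorCons, tensorCons, tensorCons, h2, h3, h4, h5, Pi.add_apply, mul_add]

theorem tensorCons_smul {n : ℕ} (h : PhotonSpace) (c : ℂ) (Ψ : TensorPower n) :
    tensorCons h (c • Ψ) = c • tensorCons h Ψ := by
  refine Lp.ext ?_
  filter_upwards [Lp.coeFn_smul c (tensorCons h Ψ),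
    (memLp_tensorCons h Ψ).coeFn_toLp, (memLp_tensorCons h (c • Ψ)).coeFn_toLp,
    (quasiMeasurePreserving_tail n).ae (Lp.coeFn_smul c Ψ)] with k h1 h2 h3 h4
  rw [h1, Pi.smul_apply, tensorCons, tensorCons, h2, h3, h4, Pi.smul_apply]
  simp only [smul_eq_mul]; ring

/-- The graph of the creation operator `a^*(h)`:
`[a^*(h) Ψ]^{(0)} = 0` and `[a^*(h) Ψ]^{(n+1)} = √(n+1) S_{n+1}(h ⊗ Ψ^{(n)})`. -/
def creationGraph (h : PhotonSpace) : Submodule ℂ (Fock × Fock) where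
  carrier := {p | p.2 0 = 0 ∧ ∀ n : ℕ, p.2 (n + 1) =
    ((Real.sqrt ((n : ℝ) + 1) : ℝ) : ℂ) • symmetrizer (n + 1) (tensorCons h (p.1 n : TensorPower n))}
  add_mem' := by
    rintro ⟨a, a'⟩ ⟨b, b'⟩ ⟨ha, ha'⟩ ⟨hb, hb'⟩
    simp only [Prod.mk_add_mk, Set.mem_ofPred_eq, lp.coeFn_add, Pi.add_apply] at *
    refine ⟨by rw [ha, hb, add_zero], fun n => ?_⟩
    rw [ha' n, hb' n, Submodule.coe_add, tensorCons_add, map_add, smul_add]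
  zero_mem' := by
    refine ⟨rfl, fun n => ?_⟩
    have : tensorCons h (0 : TensorPower n) = 0 := by
      have := tensorCons_smul h 0 (0 : TensorPower n)
      simpa using this
    change (0 : symmetricSubspace (n + 1)) = _ • symmetrizer (n + 1) (tensorCons h 0)
    rw [this, map_zero, smul_zero]
  smul_mem' := by
    rintro c ⟨a, a'⟩ ⟨ha, ha'⟩
    simp only [Prod.smul_mk, Set.mem_ofPred_eq, lp.coeFn_smul, Pi.smul_apply] at *
    refine ⟨by rw [ha, smul_zero], fun n => ?_⟩
    rw [ha' n, Submodule.coe_smul, tensorCons_smul, map_smul, smul_comm]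

/-- The creation operator `a^*(h)` on its maximal domain. -/
def creation (h : PhotonSpace) : Fock →ₗ.[ℂ] Fock := (creationGraph h).toLinearPMap

theorem mem_graph_creation (h : PhotonSpace) (Ψ Φ : Fock) :
    (Ψ, Φ) ∈ (creation h).graph ↔ Φ 0 = 0 ∧ ∀ n : ℕ, Φ (n + 1) =
      ((Real.sqrt ((n : ℝ) + 1) : ℝ) : ℂ) •
        symmetrizer (n + 1) (tensorCons h (Ψ n : TensorPower n)) := by
  rw [creation, Submodule.toLinearPMap_graph_eq]
  · rfl
  · rintro ⟨a, b⟩ ⟨h0, h1⟩ (rfl : a = 0)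
    refine lp.ext (funext fun n => ?_)
    cases n with
    | zero => exact h0
    | succ n =>
      have : tensorCons h (0 : TensorPower n) = 0 := by
        have := tensorCons_smul h 0 (0 : TensorPower n)
        simpa using this
      have h2 : b (n + 1) = _ • symmetrizer (n + 1) (tensorCons h 0) := h1 n
      rw [this, map_zero, smul_zero] at h2
      exact h2

/-- The annihilation operator `a(h)`, the adjoint of `a^*(h)`. -/
def annihilation (h : PhotonSpace) : Fock →ₗ.[ℂ] Fock := (creation h).adjoint

/-- The graph of `F(H_f)`, where `H_f = dΓ(ω)`, `ω(k) = |k|`: the `n`-photon component is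
multiplied by `F(ω(k_1) + ⋯ + ω(k_n))`. -/
def fieldEnergyGraph (F : ℝ → ℂ) : Submodule ℂ (Fock × Fock) where
  carrier := {p | ∀ n : ℕ, ((p.1 n : TensorPower n), (p.2 n : TensorPower n)) ∈
    mulGraph (modeMeasures n) fun k => F (∑ i, ‖(k i).1‖)}
  add_mem' := fun ha hb n => Submodule.add_mem _ (ha n) (hb n)
  zero_mem' := fun _ => Submodule.zero_mem _
  smul_mem' := fun c _ ha n => Submodule.smul_mem _ c (ha n)

/-- The operator `F(H_f)`, where `H_f = dΓ(ω)` is the field energy, `ω(k) = |k|`. -/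
def fieldEnergyFun (F : ℝ → ℂ) : Fock →ₗ.[ℂ] Fock := (fieldEnergyGraph F).toLinearPMap

theorem mem_graph_fieldEnergyFun (F : ℝ → ℂ) (Ψ Φ : Fock) :
    (Ψ, Φ) ∈ (fieldEnergyFun F).graph ↔ ∀ n : ℕ, (Φ n : TensorPower n) =ᵐ[modeMeasures n]
      fun k => F (∑ i, ‖(k i).1‖) * (Ψ n : TensorPower n) k := by
  rw [fieldEnergyFun, Submodule.toLinearPMap_graph_eq]
  · rfl
  · rintro ⟨a, b⟩ hab (rfl : a = 0)
    refine lp.ext (funext fun n => Subtype.ext ?_)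
    have h := (mem_graph_mulOp (modeMeasures n) _ _ _).2 (hab n)
    exact LinearPMap.graph_fst_eq_zero_snd _ h rfl

/-- The field Hamiltonian `H_f = dΓ(ω)`. -/
def Hf : Fock →ₗ.[ℂ] Fock := fieldEnergyFun fun x => (x : ℂ)

/-- The unitary operator `e^{-i s H_f}`. -/
def expHf (s : ℝ) : Fock →ₗ.[ℂ] Fock :=
  fieldEnergyFun fun x => Complex.exp (-(Complex.I * s * x))

/-! ### The quantized field in dipole approximation -/

/-- Two real polarization vectors `ε(k, λ)`, orthonormal and perpendicular to `k`. -/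
structure Polarization where
  vec : R3 → Fin 2 → R3
  measurable_vec : ∀ l, Measurable fun k => vec k l
  orthonormal_vec : ∀ k, k ≠ 0 → Orthonormal ℝ (vec k)
  transverse : ∀ k, k ≠ 0 → ∀ l, inner ℝ k (vec k l) = 0

/-- The coupling function
`G_{0,j}(k, λ) = κ(k) (2|k|)^{-1/2} ε_j(k, λ)`. -/
def couplingFun (κ : 𝓢(R3, ℂ)) (ε : Polarization) (j : Fin 3) (k : Mode) : ℂ :=
  κ k.1 / ((Real.sqrt (2 * ‖k.1‖) : ℝ) : ℂ) * ((ε.vec k.1 k.2 j : ℝ) : ℂ)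

theorem integrable_inv_norm_mul :
    Integrable (fun x : R3 => ‖x‖⁻¹ * (1 + ‖x‖) ^ (-4 : ℝ)) volume := by
  have key := (integrable_fun_norm_addHaar (volume : Measure R3)
    (f := fun r : ℝ => r⁻¹ * (1 + r) ^ (-4 : ℝ))).2
  refine key ?_
  have hint : IntegrableOn (fun r : ℝ => (1 + ‖r‖) ^ (-3 : ℝ)) (Set.Ioi 0) :=
    (integrable_one_add_norm (E := ℝ) (μ := volume) (by norm_num)).integrableOn
  refine hint.mono' (Measurable.aestronglyMeasurable (by fun_prop)) ?_
  refine (ae_restrict_iff' measurableSet_Ioi).2 (Eventually.of_forall fun r hr => ?_)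
  have hr0 : (0 : ℝ) < r := hr
  have hd : Module.finrank ℝ R3 - 1 = 2 := by simp
  rw [hd, smul_eq_mul, Real.norm_of_nonneg (by positivity), Real.norm_of_nonneg hr0.le]
  have h1 : r ^ 2 * (r⁻¹ * (1 + r) ^ (-4 : ℝ)) = r * (1 + r) ^ (-4 : ℝ) := by
    field_simp
  have h2 : (1 + r) ^ (-3 : ℝ) = (1 + r) * (1 + r) ^ (-4 : ℝ) := by
    rw [← Real.rpow_one_add' (by positivity) (by norm_num)]; norm_num
  rw [h1, h2]
  gcongr
  linarith

theorem memLp_radial (κ : 𝓢(R3, ℂ)) :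
    MemLp (fun k : R3 => ‖κ k‖ / Real.sqrt (2 * ‖k‖)) 2 volume := by
  have hm : AEStronglyMeasurable (fun k : R3 => ‖κ k‖ / Real.sqrt (2 * ‖k‖)) volume := by
    have := κ.continuous
    exact Measurable.aestronglyMeasurable (by fun_prop)
  rw [memLp_two_iff_integrable_sq_norm hm]
  obtain ⟨C, hC⟩ : ∃ C : ℝ, ∀ x, (1 + ‖x‖) ^ 2 * ‖κ x‖ ≤ C := by
    refine ⟨2 ^ 2 * (Finset.Iic ((2, 0) : ℕ × ℕ)).sup
      (fun m => SchwartzMap.seminorm ℝ m.1 m.2) κ, fun x => ?_⟩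
    have := SchwartzMap.one_add_le_sup_seminorm_apply (𝕜 := ℝ) (m := (2, 0)) (k := 2) (n := 0)
      le_rfl le_rfl κ x
    rw [norm_iteratedFDeriv_zero] at this
    exact this
  refine (integrable_inv_norm_mul.const_mul (C ^ 2)).mono' (hm.norm.pow 2) ?_
  refine Eventually.of_forall fun x => ?_
  have h1 : ‖κ x‖ ≤ C * ((1 + ‖x‖) ^ 2)⁻¹ := by
    rw [← div_eq_mul_inv, le_div_iff₀ (by positivity), mul_comm]; exact hC x
  have h2 : (1 + ‖x‖) ^ (-4 : ℝ) = ((1 + ‖x‖) ^ 4)⁻¹ := by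
    rw [Real.rpow_neg (by positivity)]; norm_cast
  rw [h2, Real.norm_of_nonneg (by positivity), norm_div, norm_norm,
    Real.norm_of_nonneg (Real.sqrt_nonneg _), div_pow, Real.sq_sqrt (by positivity),
    div_eq_mul_inv, mul_inv]
  have h3 : ‖κ x‖ ^ 2 ≤ (C * ((1 + ‖x‖) ^ 2)⁻¹) ^ 2 := by gcongr
  have h4 : (0 : ℝ) ≤ ‖x‖⁻¹ := by positivity
  calc ‖κ x‖ ^ 2 * (2⁻¹ * ‖x‖⁻¹) ≤ (C * ((1 + ‖x‖) ^ 2)⁻¹) ^ 2 * (1 * ‖x‖⁻¹) := by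
        gcongr; norm_num
    _ = C ^ 2 * (‖x‖⁻¹ * ((1 + ‖x‖) ^ 4)⁻¹) := by
        rw [mul_pow, inv_pow, ← pow_mul]; ring

theorem memLp_couplingFun (κ : 𝓢(R3, ℂ)) (ε : Polarization) (j : Fin 3) :
    MemLp (couplingFun κ ε j) 2 modeMeasure := by
  have hb : MemLp (fun p : Mode => ‖κ p.1‖ / Real.sqrt (2 * ‖p.1‖)) 2 modeMeasure :=
    (memLp_radial κ).comp_fst (Measure.count : Measure (Fin 2))
  have hε : Measurable fun p : Mode => ε.vec p.1 p.2 :=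
    measurable_from_prod_countable_left fun l => ε.measurable_vec l
  have hm : AEStronglyMeasurable (couplingFun κ ε j) modeMeasure := by
    have := κ.continuous
    have h1 : Measurable fun p : Mode => ε.vec p.1 p.2 j := by fun_prop
    refine Measurable.aestronglyMeasurable ?_
    unfold couplingFun
    fun_prop
  refine hb.mono hm ?_
  have hne : ∀ᵐ p : Mode ∂modeMeasure, p.1 ≠ 0 := by
    have h0 : ∀ᵐ x : R3, x ≠ 0 := by simp [ae_iff]
    exact (Measure.quasiMeasurePreserving_fst
      (μ := (volume : Measure R3)) (ν := (Measure.count : Measure (Fin 2)))).ae h0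
  filter_upwards [hne] with p hp
  have h1 : |ε.vec p.1 p.2 j| ≤ 1 := by
    have h := EuclideanSpace.norm_eq (ε.vec p.1 p.2)
    have h' := (PiLp.norm_apply_le (ε.vec p.1 p.2) j)
    rwa [(ε.orthonormal_vec p.1 hp).1 p.2] at h'
  rw [couplingFun, norm_mul, norm_div, Complex.norm_real, Complex.norm_real, norm_div, norm_norm,
    Real.norm_eq_abs (ε.vec p.1 p.2 j)]
  exact mul_le_of_le_one_right (by positivity) h1

/-- The coupling function `G_{0,j}` as an element of `L²(ℝ³ × {1,2})`. -/
def coupling (κ : 𝓢(R3, ℂ)) (ε : Polarization) (j : Fin 3) : PhotonSpace :=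
  (memLp_couplingFun κ ε j).toLp

/-- The `j`-th component of `A(0) = a(G_0) + a^*(G_0)`. -/
def vectorPotential (κ : 𝓢(R3, ℂ)) (ε : Polarization) (j : Fin 3) : Fock →ₗ.[ℂ] Fock :=
  annihilation (coupling κ ε j) + creation (coupling κ ε j)

/-- The `j`-th component of `A(0, s) = e^{i s H_f} A(0) e^{-i s H_f}`. -/
def vectorPotentialAt (κ : 𝓢(R3, ℂ)) (ε : Polarization) (j : Fin 3) (s : ℝ) :
    Fock →ₗ.[ℂ] Fock :=
  opMul (expHf (-s)) (opMul (vectorPotential κ ε j) (expHf s))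

/-- The `j`-th component of the electric field `E(0, s) = -i [H_f, A(0, s)]`. -/
def electricFieldAt (κ : 𝓢(R3, ℂ)) (ε : Polarization) (j : Fin 3) (s : ℝ) :
    Fock →ₗ.[ℂ] Fock :=
  -Complex.I • opComm Hf (vectorPotentialAt κ ε j s)

/-- For photon wave functions `f_1, …, f_n` with occupation numbers `m_1, …, m_n`, the operator
`a^*(f) = ∏_k (m_k!)^{-1/2} a^*(f_k)^{m_k}`. -/
def creationOcc {n : ℕ} (f : Fin n → PhotonSpace) (m : Fin n → ℕ) : Fock →ₗ.[ℂ] Fock :=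
  opProd (List.ofFn fun k =>
    (((Real.sqrt ((m k).factorial : ℝ) : ℝ) : ℂ)⁻¹) • opPow (creation (f k)) (m k))

/-- `∑_λ ε(·, λ) f(·, λ)` belongs to `C_0^2(ℝ³ ∖ {0}, ℂ³)` (as an a.e. equivalence class). -/
def IsRegularPhoton (ε : Polarization) (f : PhotonSpace) : Prop :=
  ∃ g : R3 → EuclideanSpace ℂ (Fin 3), ContDiff ℝ 2 g ∧ HasCompactSupport g ∧
    (0 : R3) ∉ tsupport g ∧
    ∀ᵐ k : R3, ∀ j : Fin 3, g k j = ∑ l : Fin 2, ((ε.vec k l j : ℝ) : ℂ) * f (k, l)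

/-! ### The leading coefficient of the ionization probability -/

/-- The Hilbert space `L²(ℝ³) ⊗ 𝓕` of electron and photons (completed tensor product). -/
abbrev TotalSpace : Type := UniformSpace.Completion (ElectronSpace ⊗[ℂ] Fock)

/-- `φ ⊗ Ψ`. -/
def tens (φ : ElectronSpace) (Ψ : Fock) : TotalSpace := ((φ ⊗ₜ[ℂ] Ψ : ElectronSpace ⊗[ℂ] Fock))

/-- `B ⊗ 1` for a bounded operator `B` of the electron. -/
def tensorId (B : ElectronSpace →L[ℂ] ElectronSpace) : TotalSpace →L[ℂ] TotalSpace :=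
  (TensorProduct.mapL B (ContinuousLinearMap.id ℂ Fock)).completion

/-- `p_j(s) = e^{i s H_el} p_j e^{-i s H_el}`. -/
def momentumAt (V : R3 → ℝ) (j : Fin 3) (s : ℝ) : ElectronSpace →ₗ.[ℂ] ElectronSpace :=
  heisenberg (Hel V) (momentum j) s

/-- `x_j(s) = e^{i s H_el} x_j e^{-i s H_el}`. -/
def positionAt (V : R3 → ℝ) (j : Fin 3) (s : ℝ) : ElectronSpace →ₗ.[ℂ] ElectronSpace :=
  heisenberg (Hel V) (position j) s

/-- The integrand `2 p(s) φ ⊗ [A(0, s), a^*(f)] Ω`, the dot product of the two vector operators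
being understood. -/
def ionizationIntegrand (V : R3 → ℝ) (φ : ElectronSpace) (κ : 𝓢(R3, ℂ)) (ε : Polarization)
    {n : ℕ} (f : Fin n → PhotonSpace) (m : Fin n → ℕ) (s : ℝ) : TotalSpace :=
  ∑ j : Fin 3, tens ((2 : ℂ) • opVal (momentumAt V j s) φ)
    (opVal (opComm (vectorPotentialAt κ ε j s) (creationOcc f m)) vacuum)

/-- The coefficient
`P⁽³⁾(f) = ‖1_ac(H_el) ∫ 2 p(s) φ ⊗ [A(0, s), a^*(f)] Ω ds‖²`
for photon wave functions `f_l` with occupation numbers `m_l`. -/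
def P3 (V : R3 → ℝ) (φ : ElectronSpace) (κ : 𝓢(R3, ℂ)) (ε : Polarization)
    {n : ℕ} (f : Fin n → PhotonSpace) (m : Fin n → ℕ) : ℝ :=
  ‖tensorId (acProj (Hel V)) (∫ s : ℝ, ionizationIntegrand V φ κ ε f m s)‖ ^ 2

/-- `P⁽³⁾(f)` for a single photon with wave function `f`. -/
def P3one (V : R3 → ℝ) (φ : ElectronSpace) (κ : 𝓢(R3, ℂ)) (ε : Polarization)
    (f : PhotonSpace) : ℝ :=
  P3 V φ κ ε (fun _ : Fin 1 => f) (fun _ => 1)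

/-- The integrand `2 p(s) φ · ⟨Ω, A(0, s) a^*(f) Ω⟩` in `L²(ℝ³)`. -/
def momentumIntegrand (V : R3 → ℝ) (φ : ElectronSpace) (κ : 𝓢(R3, ℂ)) (ε : Polarization)
    (f : PhotonSpace) (s : ℝ) : ElectronSpace :=
  ∑ j : Fin 3, (inner ℂ vacuum (opVal (opMul (vectorPotentialAt κ ε j s) (creation f)) vacuum)) •
    ((2 : ℂ) • opVal (momentumAt V j s) φ)

/-- The integrand `x(s) φ · ⟨Ω, E(0, s) a^*(f) Ω⟩` in `L²(ℝ³)`. -/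
def positionIntegrand (V : R3 → ℝ) (φ : ElectronSpace) (κ : 𝓢(R3, ℂ)) (ε : Polarization)
    (f : PhotonSpace) (s : ℝ) : ElectronSpace :=
  ∑ j : Fin 3, (inner ℂ vacuum (opVal (opMul (electricFieldAt κ ε j s) (creation f)) vacuum)) •
    opVal (positionAt V j s) φ

end Photoeffect

end

open Photoeffect

/-!
The commutator `[A(0, s), a^*(f)]` removes one photon. By the canonical commutation relations on
product vectors (`annihilate_mul_occOp`),
`[A_j(0, s), a^*(f)] Ω = ∑_l √m_l ⟨G_{s,j}, f_l⟩ a^*(f_1)^{m_1} ⋯ a^*(f_l)^{m_l - 1} ⋯ Ω` up to the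
normalization of the powers, where `G_s = e^{i s |k|} G_0`. Hence the ionization integrand is
`∑_l (∑_j ⟨G_{s,j}, f_l⟩ 2 p_j(s) φ) ⊗ Ψ_l` with photon vectors `Ψ_l` that do not depend on `s`
(`ionizationIntegrand_eq`). For orthonormal `f_l` the `Ψ_l` are orthogonal with `‖Ψ_l‖² = m_l`
(`inner_occVec`), and applying `1_ac(H_el) ⊗ 1` and Pythagoras gives the additivity (`P3_eq_sum`).

The two expressions for one photon differ by an integration by parts in `s`. The matrix elements
`⟨Ω, A_j(0, s) a^*(f) Ω⟩ = ∫ e^{-i s |k|} h_j(k) dk` with `h_j ∈ C_0^2(ℝ³ ∖ {0})` and those of the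
electric field are related by `E = -∂_s A`; two radial integrations by parts in `k` show that both
are `O(s⁻²)` (`IsAway.integrable_amplitude`). On the electron side `∂_s x_j(s) φ = 2 p_j(s) φ`. This
needs `x_j φ ∈ D(H_el)` with `H_el x_j φ = E₀ x_j φ - 2 i p_j φ`
(`exists_position_momentum_of_eigenvector`). Since `V φ` is square integrable and `V` is bounded
near infinity, it is enough that `|x| φ ∈ L²`, which is a quadratic form estimate with a truncated
weight `|x|²` that uses `E₀ < 0` and `V → 0` at infinity (`memLp_norm_mul_of_eigenvector`). The
ground state being an eigenvector, `p_j(s) φ = e^{-i s E₀} e^{i s H_el} p_j φ`, and likewise for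
`x_j(s)`, so that the differentiability of the orbits is that of the unitary group on `D(H_el)`.

All identities between unbounded operators are stated through their graphs, so that membership in
the domains is part of them. By definition `unitaryGroup H` is constantly `1` if `H` generates no
unitary group. The argument does not exclude this for `H_el`, but treats it apart
(`IsGroundState.exists_orbits`): the orbits are then constant, and the amplitudes have integral zero.
-/

noncomputable section

namespace Photoeffect

/-! ### Graphs of partially defined operators -/

section Graphs

variable {E : Type*} [NormedAddCommGroup E] [InnerProductSpace ℂ E]
variable {S T : E →ₗ.[ℂ] E} {ψ χ ξ : E}

theorem mem_domain_of_mem_graph (h : (ψ, χ) ∈ T.graph) : ψ ∈ T.domain :=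
  LinearPMap.mem_domain_of_mem_graph h

theorem mem_graph_iff' : (ψ, χ) ∈ T.graph ↔ ∃ h : ψ ∈ T.domain, T ⟨ψ, h⟩ = χ := by
  rw [LinearPMap.mem_graph_iff]
  constructor
  · rintro ⟨y, rfl, hy⟩
    exact ⟨y.2, hy⟩
  · rintro ⟨h, rfl⟩
    exact ⟨⟨ψ, h⟩, rfl, rfl⟩

theorem opVal_eq_of_mem_graph (h : (ψ, χ) ∈ T.graph) : opVal T ψ = χ := by
  obtain ⟨hd, rfl⟩ := mem_graph_iff'.1 h
  simp [opVal, hd]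

theorem mem_graph_opMul (hT : (ψ, χ) ∈ T.graph) (hS : (χ, ξ) ∈ S.graph) :
    (ψ, ξ) ∈ (opMul S T).graph := by
  obtain ⟨hd, rfl⟩ := mem_graph_iff'.1 hT
  obtain ⟨hd', rfl⟩ := mem_graph_iff'.1 hS
  exact mem_graph_iff'.2 ⟨⟨hd, hd'⟩, rfl⟩

theorem mem_graph_add (hS : (ψ, χ) ∈ S.graph) (hT : (ψ, ξ) ∈ T.graph) :
    (ψ, χ + ξ) ∈ (S + T).graph := by
  obtain ⟨hd, rfl⟩ := mem_graph_iff'.1 hS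
  obtain ⟨hd', rfl⟩ := mem_graph_iff'.1 hT
  exact mem_graph_iff'.2 ⟨⟨hd, hd'⟩, rfl⟩

theorem mem_graph_sub (hS : (ψ, χ) ∈ S.graph) (hT : (ψ, ξ) ∈ T.graph) :
    (ψ, χ - ξ) ∈ (S - T).graph := by
  obtain ⟨hd, rfl⟩ := mem_graph_iff'.1 hS
  obtain ⟨hd', rfl⟩ := mem_graph_iff'.1 hT
  exact mem_graph_iff'.2 ⟨⟨hd, hd'⟩, rfl⟩

theorem mem_graph_smul (c : ℂ) (hT : (ψ, χ) ∈ T.graph) : (ψ, c • χ) ∈ (c • T).graph := by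
  obtain ⟨hd, rfl⟩ := mem_graph_iff'.1 hT
  exact mem_graph_iff'.2 ⟨hd, rfl⟩

theorem mem_graph_opBdd (B : E →L[ℂ] E) (ψ : E) : (ψ, B ψ) ∈ (opBdd B).graph :=
  mem_graph_iff'.2 ⟨trivial, rfl⟩

theorem mem_graph_opOne (ψ : E) : (ψ, ψ) ∈ (opOne : E →ₗ.[ℂ] E).graph :=
  mem_graph_iff'.2 ⟨trivial, rfl⟩

theorem mem_graph_opComm {χ' ξ' : E} (hT : (ψ, χ) ∈ T.graph) (hST : (χ, ξ) ∈ S.graph)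
    (hS : (ψ, χ') ∈ S.graph) (hTS : (χ', ξ') ∈ T.graph) :
    (ψ, ξ - ξ') ∈ (opComm S T).graph :=
  mem_graph_sub (mem_graph_opMul hT hST) (mem_graph_opMul hS hTS)

theorem exists_mem_graph_add (h : (ψ, χ) ∈ (S + T).graph) :
    ∃ a b, (ψ, a) ∈ S.graph ∧ (ψ, b) ∈ T.graph ∧ a + b = χ := by
  obtain ⟨hd, rfl⟩ := mem_graph_iff'.1 h
  exact ⟨S ⟨ψ, hd.1⟩, T ⟨ψ, hd.2⟩, mem_graph_iff'.2 ⟨hd.1, rfl⟩, mem_graph_iff'.2 ⟨hd.2, rfl⟩, rfl⟩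

end Graphs

/-! ### One-parameter unitary groups and eigenvectors -/

section Group

variable {E : Type*} [NormedAddCommGroup E] [InnerProductSpace ℂ E]
variable {H : E →ₗ.[ℂ] E} {U : ℝ → E →L[ℂ] E}

theorem IsUnitaryGroup.hasDerivAt (hU : IsUnitaryGroup H U) {ψ χ : E} (h : (ψ, χ) ∈ H.graph)
    (t : ℝ) : HasDerivAt (fun s => U s ψ) (-Complex.I • U t χ) t := by
  have h0 := (hU.generator ψ χ).1 h
  have h1 : HasDerivAt (fun s => U t (U (s - t) ψ)) (U t (-Complex.I • χ)) t := by
    have h2 : HasDerivAt (fun s => U (s - t) ψ) (-Complex.I • χ) t := by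
      have h3 : HasDerivAt (fun s => U s ψ) (-Complex.I • χ) (t - t) := by rwa [sub_self]
      exact h3.comp_sub_const t t
    exact ((U t).restrictScalars ℝ).hasFDerivAt.comp_hasDerivAt t h2
  rw [map_smul] at h1
  refine h1.congr_of_eventuallyEq (Eventually.of_forall fun s => ?_)
  have : U s = (U t).comp (U (s - t)) := by rw [← hU.add]; congr 1; ring
  simp only [this, ContinuousLinearMap.comp_apply]

/-- The phase `e^{-i E t}` by which the evolution acts on an eigenvector of energy `E`. -/
def phase (E₀ t : ℝ) : ℂ := Complex.exp (-(Complex.I * t * E₀))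

theorem hasDerivAt_phase (E₀ t : ℝ) :
    HasDerivAt (phase E₀) (-Complex.I * E₀ * phase E₀ t) t := by
  have h : HasDerivAt (fun t : ℝ => -(Complex.I * (t : ℂ) * (E₀ : ℂ))) (-(Complex.I * 1 * E₀)) t :=
    (((Complex.ofRealCLM.hasDerivAt (x := t)).const_mul Complex.I).mul_const (E₀ : ℂ)).neg
  refine HasDerivAt.congr_deriv (f := phase E₀) h.cexp ?_
  unfold phase; ring

theorem norm_phase (E₀ t : ℝ) : ‖phase E₀ t‖ = 1 := by
  rw [phase, Complex.norm_exp]; simp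

theorem phase_neg_mul (E₀ t : ℝ) : phase E₀ (-t) * phase E₀ t = 1 := by
  rw [phase, phase, ← Complex.exp_add]; simp

theorem continuous_phase (E₀ : ℝ) : Continuous (phase E₀) := by
  unfold phase; fun_prop

theorem IsUnitaryGroup.apply_eigenvector (hU : IsUnitaryGroup H U) {φ : E} {E₀ : ℝ}
    (h : (φ, (E₀ : ℂ) • φ) ∈ H.graph) (t : ℝ) : U t φ = phase E₀ t • φ := by
  -- `t ↦ e^{i E₀ t} U t φ` has derivative zero
  have hd : ∀ t, HasDerivAt (fun s => phase E₀ (-s) • U s φ) 0 t := fun t => by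
    have h1 := (hasDerivAt_phase E₀ (-t)).scomp t (hasDerivAt_neg t)
    have h2 := h1.smul (hU.hasDerivAt h t)
    refine h2.congr_deriv ?_
    simp only [map_smul, smul_smul, Function.comp]
    rw [← add_smul]
    convert zero_smul ℂ _ using 2
    simp only [neg_smul, one_smul]
    ring
  have hc := is_const_of_deriv_eq_zero (fun t => (hd t).differentiableAt) (fun t => (hd t).deriv) t 0
  have h0 : phase E₀ (-0) • U 0 φ = φ := by simp [hU.zero, phase]
  rw [h0] at hc
  calc U t φ = (phase E₀ t * phase E₀ (-t)) • U t φ := by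
        rw [mul_comm, phase_neg_mul, one_smul]
    _ = phase E₀ t • φ := by rw [mul_smul, hc]

/-- If `φ` is an eigenvector of `H` with `(φ, χ) ∈ B` then `B(s) φ = e^{-i E₀ s} U(-s) χ`. -/
theorem IsUnitaryGroup.mem_graph_heisenberg (hU : IsUnitaryGroup H (unitaryGroup H)) {φ χ : E}
    {E₀ : ℝ} {B : E →ₗ.[ℂ] E} (h : (φ, (E₀ : ℂ) • φ) ∈ H.graph) (hB : (φ, χ) ∈ B.graph) (s : ℝ) :
    (φ, phase E₀ s • unitaryGroup H (-s) χ) ∈ (heisenberg H B s).graph := by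
  have h1 : (φ, phase E₀ s • φ) ∈ (opBdd (unitaryGroup H s)).graph := by
    rw [← hU.apply_eigenvector h s]; exact mem_graph_opBdd _ _
  have h2 : (phase E₀ s • φ, phase E₀ s • χ) ∈ B.graph := B.graph.smul_mem (phase E₀ s) hB
  rw [← map_smul]
  exact mem_graph_opMul (mem_graph_opMul h1 h2) (mem_graph_opBdd _ _)

theorem isUnitaryGroup_unitaryGroup (h : ∃ U, IsUnitaryGroup H U) :
    IsUnitaryGroup H (unitaryGroup H) := by
  rw [unitaryGroup, dif_pos h]; exact h.choose_spec

theorem IsUnitaryGroup.hasDerivAt_phase_smul (hU : IsUnitaryGroup H U) {E₀ : ℝ} {ψ χ : E}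
    (h : (ψ, χ) ∈ H.graph) (s : ℝ) :
    HasDerivAt (fun s => phase E₀ s • U (-s) ψ)
      (phase E₀ s • U (-s) (Complex.I • (χ - (E₀ : ℂ) • ψ))) s := by
  have h1 := (hU.hasDerivAt h (-s)).scomp s (hasDerivAt_neg s)
  refine ((hasDerivAt_phase E₀ s).smul h1).congr_deriv ?_
  simp only [map_smul, map_sub, smul_smul, smul_sub, Function.comp, neg_smul, one_smul, neg_neg,
    neg_mul, smul_neg]
  rw [sub_eq_add_neg]
  congr 3
  ring

end Group

/-! ### Momentum and kinetic energy in Fourier space -/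

section Fourier

open TemperedDistribution FourierTransform

/-- For square integrable functions, multiplication by a function of temperate growth in the sense
of distributions is pointwise multiplication. -/
theorem smulLeftCLM_toTemperedDistribution_iff {g : R3 → ℂ} (hg : g.HasTemperateGrowth)
    (ψ χ : ElectronSpace) :
    smulLeftCLM ℂ g (Lp.toTemperedDistribution ψ) = Lp.toTemperedDistribution χ ↔
      χ =ᵐ[volume] fun x => g x * ψ x := by
  constructor
  · intro h
    have hψ : LocallyIntegrable (ψ : R3 → ℂ) := (Lp.memLp ψ).locallyIntegrable (by norm_num)
    have hχ : LocallyIntegrable (χ : R3 → ℂ) := (Lp.memLp χ).locallyIntegrable (by norm_num)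
    have hgψ : LocallyIntegrable (fun x => g x * ψ x) := by
      have := hψ.locallyIntegrableOn Set.univ
      rw [← locallyIntegrableOn_univ]
      exact this.continuousOn_mul hg.1.continuous.continuousOn isOpen_univ.isLocallyClosed
    refine ae_eq_of_integral_contDiff_smul_eq hχ hgψ fun η hη hc => ?_
    have h1 : HasCompactSupport (Complex.ofRealCLM ∘ η) := hc.comp_left rfl
    have h2 : ContDiff ℝ (⊤ : ℕ∞) (Complex.ofRealCLM ∘ η) := Complex.ofRealCLM.contDiff.comp hη
    have h3 := congrArg (fun T => T (h1.toSchwartzMap h2)) h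
    simp only [smulLeftCLM_apply_apply, Lp.toTemperedDistribution_apply] at h3
    simp only [SchwartzMap.smulLeftCLM_apply_apply hg] at h3
    have e : ∀ x, h1.toSchwartzMap h2 x = (η x : ℂ) := fun x => rfl
    refine (integral_congr_ae (Eventually.of_forall fun x => ?_)).trans
      (h3.symm.trans (integral_congr_ae (Eventually.of_forall fun x => ?_)))
    · simp [e]
    · simp only [e, smul_eq_mul, Complex.real_smul]; ring
  · intro h
    ext η
    simp only [smulLeftCLM_apply_apply, Lp.toTemperedDistribution_apply]
    refine integral_congr_ae ?_
    filter_upwards [h] with x hx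
    rw [hx, SchwartzMap.smulLeftCLM_apply_apply hg]
    simp; ring

theorem hasTemperateGrowth_coord (j : Fin 3) :
    Function.HasTemperateGrowth (fun x : R3 => ((x j : ℝ) : ℂ)) :=
  (Complex.ofRealCLM.comp (EuclideanSpace.proj (𝕜 := ℝ) j)).hasTemperateGrowth

theorem inner_stdVec (x : R3) (j : Fin 3) : inner ℝ x (stdVec j) = x j := by
  simp [stdVec, EuclideanSpace.inner_single_right]

theorem mem_graph_momentum_iff (j : Fin 3) (ψ χ : ElectronSpace) :
    (ψ, χ) ∈ (momentum j).graph ↔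
      (𝓕 χ : ElectronSpace) =ᵐ[volume] fun ξ => ((2 * Real.pi * ξ j : ℝ) : ℂ) * (𝓕 ψ : ElectronSpace) ξ := by
  have hg : Function.HasTemperateGrowth (fun ξ : R3 => ((2 * Real.pi * ξ j : ℝ) : ℂ)) := by
    have h := (Function.HasTemperateGrowth.const (E := R3) ((2 * Real.pi : ℝ) : ℂ)).mul
      (hasTemperateGrowth_coord j)
    have e : (fun ξ : R3 => ((2 * Real.pi * ξ j : ℝ) : ℂ)) =
        (fun _ => ((2 * Real.pi : ℝ) : ℂ)) * fun ξ : R3 => ((ξ j : ℝ) : ℂ) := by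
      ext ξ; simp
    rw [e]; exact h
  rw [← smulLeftCLM_toTemperedDistribution_iff hg, mem_graph_momentum,
    ← Lp.fourier_toTemperedDistribution_eq, ← Lp.fourier_toTemperedDistribution_eq]
  have key : 𝓕 (-Complex.I • ∂_{stdVec j} (Lp.toTemperedDistribution ψ)) =
      smulLeftCLM ℂ (fun ξ : R3 => ((2 * Real.pi * ξ j : ℝ) : ℂ))
        (𝓕 (Lp.toTemperedDistribution ψ)) := by
    rw [FourierTransform.fourier_smul, fourier_lineDerivOp_eq, smul_smul]
    have h1 : (fun ξ : R3 => ((2 * Real.pi * ξ j : ℝ) : ℂ)) =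
        ((2 * Real.pi : ℝ) : ℂ) • fun ξ : R3 => ((ξ j : ℝ) : ℂ) := by
      ext ξ; simp
    rw [h1, smulLeftCLM_smul (hasTemperateGrowth_coord j)]
    simp only [inner_stdVec]
    rw [_root_.smul_apply]
    congr 1
    push_cast
    linear_combination (-2 * Real.pi : ℂ) * Complex.I_mul_I
  rw [← key]
  constructor
  · intro h; rw [h]
  · intro h
    have := congrArg (𝓕⁻) h
    rwa [fourierInv_fourier_eq, fourierInv_fourier_eq] at this

theorem mem_graph_negLaplacian_iff (ψ χ : ElectronSpace) :
    (ψ, χ) ∈ negLaplacian.graph ↔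
      (𝓕 χ : ElectronSpace) =ᵐ[volume]
        fun ξ => (((2 * Real.pi) ^ 2 * ‖ξ‖ ^ 2 : ℝ) : ℂ) * (𝓕 ψ : ElectronSpace) ξ := by
  have hn : Function.HasTemperateGrowth (fun ξ : R3 => ((‖ξ‖ ^ 2 : ℝ) : ℂ)) := by fun_prop
  have h1 : (fun ξ : R3 => (((2 * Real.pi) ^ 2 * ‖ξ‖ ^ 2 : ℝ) : ℂ)) =
        (((2 * Real.pi) ^ 2 : ℝ) : ℂ) • fun ξ : R3 => ((‖ξ‖ ^ 2 : ℝ) : ℂ) := by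
      ext ξ; simp
  have hg : Function.HasTemperateGrowth
      (fun ξ : R3 => (((2 * Real.pi) ^ 2 * ‖ξ‖ ^ 2 : ℝ) : ℂ)) := by
    rw [h1]
    exact (Function.HasTemperateGrowth.const (E := R3) (((2 * Real.pi) ^ 2 : ℝ) : ℂ)).mul hn
  rw [← smulLeftCLM_toTemperedDistribution_iff hg, mem_graph_negLaplacian,
    ← Lp.fourier_toTemperedDistribution_eq, ← Lp.fourier_toTemperedDistribution_eq]
  have key : 𝓕 (-Δ (Lp.toTemperedDistribution ψ)) =
      smulLeftCLM ℂ (fun ξ : R3 => (((2 * Real.pi) ^ 2 * ‖ξ‖ ^ 2 : ℝ) : ℂ))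
        (𝓕 (Lp.toTemperedDistribution ψ)) := by
    rw [h1, smulLeftCLM_smul hn, laplacian_eq_fourierMultiplierCLM, fourierMultiplierCLM_apply,
      ← neg_smul, neg_neg, _root_.smul_apply, ← Complex.coe_smul,
      FourierTransform.fourier_smul, fourier_fourierInv_eq]
  rw [← key]
  constructor
  · intro h; rw [h]
  · intro h
    have := congrArg (𝓕⁻) h
    rwa [fourierInv_fourier_eq, fourierInv_fourier_eq] at this

theorem memLp_mul_of_norm_le {ψ χ : ElectronSpace} {g : R3 → ℂ} (hg : Continuous g)
    (h : ∀ᵐ ξ, ‖g ξ * ψ ξ‖ ≤ ‖ψ ξ‖ + ‖χ ξ‖) : MemLp (fun ξ => g ξ * ψ ξ) 2 volume :=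
  ((Lp.memLp ψ).norm.add (Lp.memLp χ).norm).mono'
    (hg.aestronglyMeasurable.mul (Lp.memLp ψ).1) h

/-- `D(-Δ) ⊆ D(p_j)`. -/
theorem exists_mem_graph_momentum {ψ χ : ElectronSpace} (h : (ψ, χ) ∈ negLaplacian.graph)
    (j : Fin 3) : ∃ π, (ψ, π) ∈ (momentum j).graph := by
  rw [mem_graph_negLaplacian_iff] at h
  have hm : MemLp (fun ξ : R3 => ((2 * Real.pi * ξ j : ℝ) : ℂ) * (𝓕 ψ : ElectronSpace) ξ) 2 volume := by
    refine memLp_mul_of_norm_le (χ := (𝓕 χ : ElectronSpace)) (by fun_prop) ?_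
    filter_upwards [h] with ξ hξ
    rw [hξ, norm_mul, norm_mul, Complex.norm_real, Complex.norm_real, Real.norm_eq_abs,
      Real.norm_eq_abs]
    rw [abs_of_nonneg (a := (2 * Real.pi) ^ 2 * ‖ξ‖ ^ 2) (by positivity), abs_mul,
      abs_of_nonneg (a := 2 * Real.pi) (by positivity)]
    have h1 : |ξ j| ≤ ‖ξ‖ := PiLp.norm_apply_le ξ j
    have h2 : 2 * Real.pi * |ξ j| ≤ 1 + (2 * Real.pi) ^ 2 * ‖ξ‖ ^ 2 := by
      have : 2 * Real.pi * |ξ j| ≤ 2 * Real.pi * ‖ξ‖ := by gcongr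
      nlinarith [sq_nonneg (2 * Real.pi * ‖ξ‖ - 1)]
    calc _ ≤ (1 + (2 * Real.pi) ^ 2 * ‖ξ‖ ^ 2) * ‖(𝓕 ψ : ElectronSpace) ξ‖ := by gcongr
      _ = _ := by ring
  refine ⟨𝓕⁻ (hm.toLp), ?_⟩
  rw [mem_graph_momentum_iff, fourier_fourierInv_eq]
  exact hm.coeFn_toLp

/-- `⟨u, -Δ ψ⟩ = ∑_j ⟨p_j u, p_j ψ⟩`. -/
theorem inner_negLaplacian {u ψ χ : ElectronSpace} {a b : Fin 3 → ElectronSpace}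
    (h : (ψ, χ) ∈ negLaplacian.graph) (ha : ∀ j, (u, a j) ∈ (momentum j).graph)
    (hb : ∀ j, (ψ, b j) ∈ (momentum j).graph) :
    inner ℂ u χ = ∑ j, inner ℂ (a j) (b j) := by
  rw [← Lp.inner_fourier_eq]
  simp_rw [← Lp.inner_fourier_eq (a _)]
  simp only [mem_graph_momentum_iff, mem_graph_negLaplacian_iff] at *
  simp_rw [L2.inner_def]
  rw [← integral_finsetSum _ fun j _ => L2.integrable_inner _ _]
  refine integral_congr_ae ?_
  filter_upwards [h, ae_all_iff.2 ha, ae_all_iff.2 hb] with ξ h1 h2 h3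
  simp only [h1, h2, h3, RCLike.inner_apply, map_mul, Complex.conj_ofReal]
  rw [EuclideanSpace.norm_sq_eq]
  simp only [Fin.sum_univ_three, Real.norm_eq_abs, sq_abs]
  push_cast
  ring

end Fourier

/-! ### Product rules -/

section Product

open TemperedDistribution

/-- The product rule for tempered distributions. -/
theorem lineDerivOp_smulLeftCLM {W W' : R3 → ℂ} (hW : W.HasTemperateGrowth)
    (hW' : W'.HasTemperateGrowth) (v : R3) (hd : ∀ x, fderiv ℝ W x v = W' x) (T : 𝓢'(R3, ℂ)) :
    ∂_{v} (smulLeftCLM ℂ W T) = smulLeftCLM ℂ W (∂_{v} T) + smulLeftCLM ℂ W' T := by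
  ext η
  have h : SchwartzMap.smulLeftCLM ℂ W (∂_{v} η) =
      ∂_{v} (SchwartzMap.smulLeftCLM ℂ W η) - SchwartzMap.smulLeftCLM ℂ W' η := by
    ext x
    have h1 : DifferentiableAt ℝ W x := (hW.1.differentiable (by simp)) x
    have h2 : (⇑(SchwartzMap.smulLeftCLM ℂ W η) : R3 → ℂ) = fun x => W x * η x := by
      ext y; rw [SchwartzMap.smulLeftCLM_apply_apply hW, smul_eq_mul]
    rw [_root_.sub_apply, SchwartzMap.smulLeftCLM_apply_apply hW,
      SchwartzMap.smulLeftCLM_apply_apply hW', SchwartzMap.lineDerivOp_apply_eq_fderiv,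
      SchwartzMap.lineDerivOp_apply_eq_fderiv, h2, fderiv_fun_mul h1 η.differentiableAt, ← hd x]
    simp; ring
  simp only [lineDerivOp_apply_apply, smulLeftCLM_apply_apply, _root_.add_apply]
  simp [h, sub_eq_add_neg, add_comm]

/-- `p_j (W ψ) = W p_j ψ - i (∂_j W) ψ`, on `L²`. -/
theorem mem_graph_momentum_mul {W W' : R3 → ℂ} (hW : W.HasTemperateGrowth)
    (hW' : W'.HasTemperateGrowth) {j : Fin 3} (hd : ∀ x, fderiv ℝ W x (stdVec j) = W' x)
    {ψ π Wψ χ : ElectronSpace} (h : (ψ, π) ∈ (momentum j).graph)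
    (h1 : Wψ =ᵐ[volume] fun x => W x * ψ x)
    (h2 : χ =ᵐ[volume] fun x => W x * π x - Complex.I * (W' x * ψ x)) :
    (Wψ, χ) ∈ (momentum j).graph := by
  rw [mem_graph_momentum] at h ⊢
  rw [← (smulLeftCLM_toTemperedDistribution_iff hW ψ Wψ).2 h1, lineDerivOp_smulLeftCLM hW hW' _ hd,
    smul_add, ← map_smul, h]
  ext η
  simp only [_root_.add_apply, _root_.smul_apply,
    smulLeftCLM_apply_apply, Lp.toTemperedDistribution_apply]
  have e1 : ∀ (ψ : ElectronSpace) (η : 𝓢(R3, ℂ)), Integrable (fun x => η x • ψ x) := fun ψ η =>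
    (η.memLp 2 volume).integrable_mul (Lp.memLp ψ)
  have e2 : Integrable
      (fun x => -Complex.I • (SchwartzMap.smulLeftCLM ℂ W' η) x • ψ x) :=
    (e1 ψ (SchwartzMap.smulLeftCLM ℂ W' η)).smul (-Complex.I)
  rw [← integral_smul, ← integral_add (e1 _ _) e2]
  refine integral_congr_ae ?_
  filter_upwards [h2] with x hx
  rw [hx, SchwartzMap.smulLeftCLM_apply_apply hW, SchwartzMap.smulLeftCLM_apply_apply hW']
  simp; ring

/-- `Δ (x_j T) = x_j Δ T + 2 ∂_j T`. -/
theorem laplacian_smulLeftCLM_coord (j : Fin 3) (T : 𝓢'(R3, ℂ)) :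
    Δ (smulLeftCLM ℂ (fun x : R3 => ((x j : ℝ) : ℂ)) T) =
      smulLeftCLM ℂ (fun x : R3 => ((x j : ℝ) : ℂ)) (Δ T) + (2 : ℂ) • ∂_{stdVec j} T := by
  have hd : ∀ i x, fderiv ℝ (fun x : R3 => ((x j : ℝ) : ℂ)) x (stdVec i) =
      if i = j then 1 else 0 := by
    intro i x
    have : HasFDerivAt (fun x : R3 => ((x j : ℝ) : ℂ))
      (Complex.ofRealCLM.comp (EuclideanSpace.proj (𝕜 := ℝ) j)) x :=
      (Complex.ofRealCLM.comp (EuclideanSpace.proj (𝕜 := ℝ) j)).hasFDerivAt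
    rw [this.fderiv]
    by_cases h : i = j
    · subst h; simp [stdVec]
    · simp [stdVec, h, Ne.symm h]
  have hs : ∀ (i : Fin 3) (T : 𝓢'(R3, ℂ)),
      ∂_{stdVec i} (smulLeftCLM ℂ (fun x : R3 => ((x j : ℝ) : ℂ)) T) =
      smulLeftCLM ℂ (fun x : R3 => ((x j : ℝ) : ℂ)) (∂_{stdVec i} T) +
        (if i = j then (1 : ℂ) else 0) • T := by
    intro i T
    rw [lineDerivOp_smulLeftCLM (hasTemperateGrowth_coord j)
      (Function.HasTemperateGrowth.const (if i = j then (1 : ℂ) else 0)) _ (hd i) T,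
      smulLeftCLM_const]
  have hb : ∀ i, EuclideanSpace.basisFun (Fin 3) ℝ i = stdVec i := fun i => by
    simp [stdVec]
  rw [laplacian_eq_sum (EuclideanSpace.basisFun (Fin 3) ℝ),
    laplacian_eq_sum (EuclideanSpace.basisFun (Fin 3) ℝ)]
  simp only [hb, hs, LineDeriv.lineDerivOp_add, LineDeriv.lineDerivOp_smul, map_sum]
  rw [Finset.sum_add_distrib, Finset.sum_add_distrib]
  have hz : ∀ T : 𝓢'(R3, ℂ), (0 : ℂ) • T = 0 := fun T => zero_smul ℂ T
  have h2 : ∀ T : 𝓢'(R3, ℂ), (2 : ℂ) • T = T + T := fun T => two_smul ℂ T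
  simp only [ite_smul, one_smul, hz, h2, Finset.sum_ite_eq', Finset.mem_univ, if_true]
  rw [add_assoc]

/-- `-Δ (x_j ψ) = x_j (-Δ ψ) - 2 i p_j ψ`, on `L²`. -/
theorem mem_graph_negLaplacian_coord_mul {j : Fin 3} {ψ χ π xψ ξ : ElectronSpace}
    (h : (ψ, χ) ∈ negLaplacian.graph) (hp : (ψ, π) ∈ (momentum j).graph)
    (h1 : xψ =ᵐ[volume] fun x => ((x j : ℝ) : ℂ) * ψ x)
    (h2 : ξ =ᵐ[volume] fun x => ((x j : ℝ) : ℂ) * χ x) :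
    (xψ, ξ - (2 * Complex.I) • π) ∈ negLaplacian.graph := by
  rw [mem_graph_negLaplacian] at h ⊢
  rw [mem_graph_momentum] at hp
  have h3 := (smulLeftCLM_toTemperedDistribution_iff (hasTemperateGrowth_coord j) χ ξ).2 h2
  have h4 : Lp.toTemperedDistribution (ξ - (2 * Complex.I) • π) =
      Lp.toTemperedDistribution ξ - (2 * Complex.I) • Lp.toTemperedDistribution π := by
    simp only [← Lp.toTemperedDistributionCLM_apply, map_sub, map_smul]
  rw [← (smulLeftCLM_toTemperedDistribution_iff (hasTemperateGrowth_coord j) ψ xψ).2 h1,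
    laplacian_smulLeftCLM_coord, h4, ← h3, ← h, ← hp, map_neg, smul_smul]
  have : 2 * Complex.I * -Complex.I = 2 := by linear_combination (-2 : ℂ) * Complex.I_mul_I
  rw [this]
  abel

end Product

/-! ### Decay of the ground state -/

section Decay

/-- The cut-off factor `(1 + c² |x|²)⁻¹`. -/
def cutoff (c : ℝ) (x : R3) : ℝ := (1 + c ^ 2 * ‖x‖ ^ 2)⁻¹

/-- The bounded weight `|x|² / (1 + c² |x|²)`, which increases to `|x|²` as `c → 0`. -/
def weight (c : ℝ) (x : R3) : ℝ := ‖x‖ ^ 2 * cutoff c x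

variable {c : ℝ} {x : R3}

theorem cutoff_pos : 0 < cutoff c x := by unfold cutoff; positivity

theorem cutoff_le_one : cutoff c x ≤ 1 := by
  unfold cutoff
  exact inv_le_one_of_one_le₀ (by nlinarith [sq_nonneg (c * ‖x‖)])

theorem weight_nonneg : 0 ≤ weight c x := mul_nonneg (sq_nonneg _) cutoff_pos.le

theorem weight_le_sq : weight c x ≤ ‖x‖ ^ 2 :=
  mul_le_of_le_one_right (sq_nonneg _) cutoff_le_one

theorem weight_le (hc : 0 < c) : weight c x ≤ (c ^ 2)⁻¹ := by
  rw [weight, cutoff, ← div_eq_mul_inv, div_le_iff₀ (by positivity)]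
  have : (c ^ 2)⁻¹ * (1 + c ^ 2 * ‖x‖ ^ 2) = (c ^ 2)⁻¹ + ‖x‖ ^ 2 := by field_simp
  rw [this]
  have : 0 < (c ^ 2)⁻¹ := by positivity
  linarith

theorem hasTemperateGrowth_cutoff (c : ℝ) :
    Function.HasTemperateGrowth (fun x : R3 => ((cutoff c x : ℝ) : ℂ)) := by
  have h := (Function.hasTemperateGrowth_one_add_norm_sq_rpow R3 (-1)).comp
    (c • ContinuousLinearMap.id ℝ R3).hasTemperateGrowth
  have h2 := Function.Complex.hasTemperateGrowth_ofReal.comp h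
  have e : (fun x : R3 => ((cutoff c x : ℝ) : ℂ)) =
      Complex.ofReal ∘ ((fun x : R3 => (1 + ‖x‖ ^ 2) ^ (-1 : ℝ)) ∘
        (c • ContinuousLinearMap.id ℝ R3)) := by
    ext x
    simp [cutoff, Real.rpow_neg_one, norm_smul, mul_pow]
  rw [e]; exact h2

theorem hasTemperateGrowth_weight (c : ℝ) :
    Function.HasTemperateGrowth (fun x : R3 => ((weight c x : ℝ) : ℂ)) := by
  have hn : Function.HasTemperateGrowth (fun ξ : R3 => ((‖ξ‖ ^ 2 : ℝ) : ℂ)) := by fun_prop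
  have e : (fun x : R3 => ((weight c x : ℝ) : ℂ)) =
      (fun ξ : R3 => ((‖ξ‖ ^ 2 : ℝ) : ℂ)) * fun x : R3 => ((cutoff c x : ℝ) : ℂ) := by
    ext x; simp [weight]
  rw [e]; exact hn.mul (hasTemperateGrowth_cutoff c)

/-- The partial derivative `∂_j` of the weight. -/
def weightDeriv (c : ℝ) (j : Fin 3) (x : R3) : ℝ := 2 * x j * cutoff c x ^ 2

theorem hasTemperateGrowth_weightDeriv (c : ℝ) (j : Fin 3) :
    Function.HasTemperateGrowth (fun x : R3 => ((weightDeriv c j x : ℝ) : ℂ)) := by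
  have e : (fun x : R3 => ((weightDeriv c j x : ℝ) : ℂ)) =
      ((fun _ => (2 : ℂ)) * (fun x : R3 => ((x j : ℝ) : ℂ))) *
        (fun x : R3 => ((cutoff c x : ℝ) : ℂ)) ^ 2 := by
    ext x; simp [weightDeriv]
  rw [e]
  exact ((Function.HasTemperateGrowth.const _).mul (hasTemperateGrowth_coord j)).mul
    ((hasTemperateGrowth_cutoff c).pow 2)

theorem fderiv_weight (c : ℝ) (j : Fin 3) (x : R3) :
    fderiv ℝ (fun x : R3 => ((weight c x : ℝ) : ℂ)) x (stdVec j) = (weightDeriv c j x : ℝ) := by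
  have h1 : HasFDerivAt (fun x : R3 => ‖x‖ ^ 2) (2 • innerSL ℝ x) x :=
    (hasStrictFDerivAt_norm_sq x).hasFDerivAt
  have hne : 1 + c ^ 2 * ‖x‖ ^ 2 ≠ 0 := by positivity
  have h2 := (hasDerivAt_inv hne).comp_hasFDerivAt x ((h1.const_mul (c ^ 2)).const_add 1)
  have h3 : HasFDerivAt (fun x => weight c x) _ x := h1.mul h2
  have h4 := Complex.ofRealCLM.hasFDerivAt.comp x h3
  have h5 : fderiv ℝ (fun x : R3 => ((weight c x : ℝ) : ℂ)) x = _ := h4.fderiv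
  rw [h5]
  simp only [ContinuousLinearMap.comp_apply, Complex.ofRealCLM_apply, weightDeriv, cutoff]
  congr 1
  simp [inner_stdVec]
  field_simp
  ring

theorem abs_weightDeriv_le (j : Fin 3) : |weightDeriv c j x| ≤ 2 * Real.sqrt (weight c x) := by
  rw [← abs_of_nonneg (a := 2 * Real.sqrt (weight c x)) (by positivity), ← sq_le_sq, mul_pow,
    Real.sq_sqrt weight_nonneg, weightDeriv, weight, mul_pow, mul_pow]
  have h1 : (x j) ^ 2 ≤ ‖x‖ ^ 2 := sq_le_sq' (by linarith [abs_le.1 (show |x j| ≤ ‖x‖ from PiLp.norm_apply_le x j)])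
    (abs_le.1 (show |x j| ≤ ‖x‖ from PiLp.norm_apply_le x j)).2
  have h2 : (cutoff c x ^ 2) ^ 2 ≤ cutoff c x := by
    have h0 := (cutoff_pos (c := c) (x := x)).le
    rw [← pow_mul]
    exact pow_le_of_le_one h0 cutoff_le_one (by norm_num)
  have : x j ^ 2 * (cutoff c x ^ 2) ^ 2 ≤ ‖x‖ ^ 2 * cutoff c x := by gcongr
  nlinarith

theorem memLp_weight_mul (hc : 0 < c) (ψ : ElectronSpace) :
    MemLp (fun x => ((weight c x : ℝ) : ℂ) * ψ x) 2 volume := by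
  refine (Lp.memLp ψ).of_le_mul (c := (c ^ 2)⁻¹)
    ((hasTemperateGrowth_weight c).1.continuous.aestronglyMeasurable.mul (Lp.memLp ψ).1)
    (Eventually.of_forall fun x => ?_)
  rw [norm_mul, Complex.norm_real, Real.norm_of_nonneg weight_nonneg]
  gcongr
  exact weight_le hc

theorem memLp_weightDeriv_mul (hc : 0 < c) (j : Fin 3) (ψ : ElectronSpace) :
    MemLp (fun x => ((weightDeriv c j x : ℝ) : ℂ) * ψ x) 2 volume := by
  refine (Lp.memLp ψ).of_le_mul (c := 2 * Real.sqrt (c ^ 2)⁻¹)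
    ((hasTemperateGrowth_weightDeriv c j).1.continuous.aestronglyMeasurable.mul (Lp.memLp ψ).1)
    (Eventually.of_forall fun x => ?_)
  rw [norm_mul, Complex.norm_real, Real.norm_eq_abs]
  gcongr
  refine (abs_weightDeriv_le j).trans ?_
  gcongr
  exact weight_le hc

/-- The kinetic energy is bounded below on weighted functions, uniformly in the cut-off: the
gradient of the weight `w` satisfies `|∂_j w| ≤ 2 √w`, so that the cross term in
`⟨∇(w ψ), ∇ψ⟩` is absorbed by `∫ w |∇ψ|²` up to `∫ |ψ|²`. -/
theorem re_inner_weight_negLaplacian (hc : 0 < c) {ψ χ : ElectronSpace}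
    (h : (ψ, χ) ∈ negLaplacian.graph) :
    -(3 * ‖ψ‖ ^ 2) ≤ RCLike.re (inner ℂ (memLp_weight_mul hc ψ).toLp χ) := by
  choose π hπ using exists_mem_graph_momentum h
  have hm : ∀ j, MemLp (fun x => ((weight c x : ℝ) : ℂ) * π j x -
      Complex.I * (((weightDeriv c j x : ℝ) : ℂ) * ψ x)) 2 volume := fun j =>
    (memLp_weight_mul hc (π j)).sub ((memLp_weightDeriv_mul hc j ψ).const_mul Complex.I)
  have ha : ∀ j, ((memLp_weight_mul hc ψ).toLp, (hm j).toLp) ∈ (momentum j).graph := fun j =>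
    mem_graph_momentum_mul (hasTemperateGrowth_weight c) (hasTemperateGrowth_weightDeriv c j)
      (fderiv_weight c j) (hπ j) (MemLp.coeFn_toLp _) (MemLp.coeFn_toLp _)
  rw [inner_negLaplacian h ha hπ, map_sum]
  have key : ∀ j, -‖ψ‖ ^ 2 ≤ RCLike.re (inner ℂ (hm j).toLp (π j)) := fun j => by
    have e : ‖ψ‖ ^ 2 = RCLike.re (inner ℂ ψ ψ) := (inner_self_eq_norm_sq ψ).symm
    rw [e, L2.inner_def, L2.inner_def, ← integral_re (L2.integrable_inner _ _),
      ← integral_re (L2.integrable_inner _ _), ← integral_neg]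
    refine integral_mono_ae (L2.integrable_inner _ _).re.neg (L2.integrable_inner _ _).re ?_
    filter_upwards [(hm j).coeFn_toLp] with x hx
    rw [hx, inner_self_eq_norm_sq, inner_sub_left, map_sub]
    have h1 : RCLike.re (inner ℂ (((weight c x : ℝ) : ℂ) * π j x) (π j x)) =
        weight c x * ‖π j x‖ ^ 2 := by
      rw [← smul_eq_mul, inner_smul_left, Complex.conj_ofReal, ← inner_self_eq_norm_sq (𝕜 := ℂ)]
      exact Complex.re_ofReal_mul _ _
    have h2 : RCLike.re (inner ℂ (Complex.I * (((weightDeriv c j x : ℝ) : ℂ) * ψ x)) (π j x)) ≤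
        2 * Real.sqrt (weight c x) * ‖ψ x‖ * ‖π j x‖ := by
      refine (RCLike.re_le_norm _).trans ((norm_inner_le_norm _ _).trans ?_)
      rw [norm_mul, norm_mul, Complex.norm_I, one_mul, Complex.norm_real, Real.norm_eq_abs]
      gcongr
      exact abs_weightDeriv_le j
    have h3 := Real.sq_sqrt (weight_nonneg (c := c) (x := x))
    rw [h1]
    nlinarith [sq_nonneg (Real.sqrt (weight c x) * ‖π j x‖ - ‖ψ x‖)]
  calc -(3 * ‖ψ‖ ^ 2) = ∑ _j : Fin 3, -‖ψ‖ ^ 2 := by simp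
    _ ≤ _ := Finset.sum_le_sum fun j _ => key j

theorem exists_abs_lt_of_tendsto {V : R3 → ℝ} (hV : Tendsto V (cocompact R3 ⊓ ae volume) (𝓝 0))
    {e : ℝ} (he : 0 < e) : ∃ R : ℝ, ∀ᵐ x, R < ‖x‖ → |V x| < e := by
  have h := hV.eventually (Metric.ball_mem_nhds 0 he)
  obtain ⟨p, hp, q, hq, hpq⟩ := eventually_inf.1 h
  obtain ⟨K, hK, hKs⟩ := mem_cocompact.1 hp
  obtain ⟨R, hR⟩ := hK.isBounded.subset_closedBall 0
  refine ⟨R, ?_⟩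
  filter_upwards [hq] with x hx hxR
  have hxs : x ∈ p := hKs fun hxK => by
    have := hR hxK
    rw [mem_closedBall_zero_iff] at this
    linarith
  simpa using hpq x ⟨hxs, hx⟩

/-- An eigenfunction of `-Δ + V` to a negative eigenvalue `E₀` satisfies `|x| φ ∈ L²` if `V`
vanishes at infinity. With `-Δ φ = (E₀ - V) φ` and `w` the truncated weight `|x|²`,
`-3 ‖φ‖² ≤ Re ⟨w φ, -Δ φ⟩ = ∫ w (E₀ - V) |φ|²`; since `E₀ - V ≤ E₀ / 2 < 0` outside a ball, this
bounds `∫ w |φ|²` uniformly in the truncation, and Fatou's lemma removes it. -/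
theorem memLp_norm_mul_of_eigenvector {V : R3 → ℝ}
    (hV : Tendsto V (cocompact R3 ⊓ ae volume) (𝓝 0)) {φ : ElectronSpace} {E₀ : ℝ} (hE : E₀ < 0)
    (hφ : (φ, (E₀ : ℂ) • φ) ∈ (Hel V).graph) :
    MemLp (fun x => ((‖x‖ : ℝ) : ℂ) * φ x) 2 volume := by
  obtain ⟨χ, v, hχ, hv, hsum⟩ := exists_mem_graph_add hφ
  rw [mem_graph_mulOp] at hv
  obtain ⟨R, hR⟩ := exists_abs_lt_of_tendsto hV (e := -E₀ / 2) (by linarith)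
  have hχV : ∀ᵐ x, χ x = ((E₀ - V x : ℝ) : ℂ) * φ x := by
    have e : χ = (E₀ : ℂ) • φ - v := by rw [← hsum, add_sub_cancel_right]
    filter_upwards [hv, Lp.coeFn_sub ((E₀ : ℂ) • φ) v, Lp.coeFn_smul (E₀ : ℂ) φ] with x h1 h2 h3
    rw [e, h2, Pi.sub_apply, h3, h1]
    simp; ring
  have hφ2 : Integrable (fun x => ‖φ x‖ ^ 2) := (Lp.memLp φ).integrable_norm_pow (by norm_num)
  have hM : Integrable fun x => R ^ 2 * (‖χ x‖ * ‖φ x‖ + (-E₀ / 2) * ‖φ x‖ ^ 2) := by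
    refine (Integrable.add ?_ (hφ2.const_mul _)).const_mul _
    exact (Lp.memLp χ).norm.integrable_mul (Lp.memLp φ).norm
  set M := ∫ x, R ^ 2 * (‖χ x‖ * ‖φ x‖ + (-E₀ / 2) * ‖φ x‖ ^ 2) with hMdef
  -- the bound on the weighted norm, uniform in the cut-off
  have hint : ∀ c : ℝ, 0 < c → Integrable (fun x => weight c x * ‖φ x‖ ^ 2) := fun c hc => by
    have h := (memLp_weight_mul hc φ).norm.integrable_mul (Lp.memLp φ).norm
    refine h.congr (Eventually.of_forall fun x => ?_)
    simp only [Pi.mul_apply, norm_mul, Complex.norm_real, Real.norm_of_nonneg weight_nonneg]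
    ring
  have hbound : ∀ c : ℝ, 0 < c →
      ∫ x : R3, weight c x * ‖φ x‖ ^ 2 ≤ (-E₀ / 2)⁻¹ * (3 * ‖φ‖ ^ 2 + M) := fun c hc => by
    have h1 := re_inner_weight_negLaplacian hc hχ
    rw [L2.inner_def, ← integral_re (L2.integrable_inner _ _)] at h1
    have h2 : ∫ x : R3, (-E₀ / 2) * (weight c x * ‖φ x‖ ^ 2) ≤
        ∫ x : R3, (-(RCLike.re (inner ℂ (((memLp_weight_mul hc φ).toLp : ElectronSpace) x) (χ x))) +
          R ^ 2 * (‖χ x‖ * ‖φ x‖ + (-E₀ / 2) * ‖φ x‖ ^ 2)) := by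
      refine integral_mono_ae ((hint c hc).const_mul _)
        ((L2.integrable_inner _ _).re.neg.add hM) ?_
      filter_upwards [(memLp_weight_mul hc φ).coeFn_toLp, hχV, hR] with x hx hx' hxR
      have e1 : RCLike.re (inner ℂ (((weight c x : ℝ) : ℂ) * φ x) (χ x)) =
          weight c x * (E₀ - V x) * ‖φ x‖ ^ 2 := by
        rw [hx', ← smul_eq_mul, ← smul_eq_mul, inner_smul_left, inner_smul_right,
          Complex.conj_ofReal, ← mul_assoc, ← Complex.ofReal_mul, ← inner_self_eq_norm_sq (𝕜 := ℂ)]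
        exact Complex.re_ofReal_mul _ _
      have e2 : ‖χ x‖ = |E₀ - V x| * ‖φ x‖ := by
        rw [hx', norm_mul, Complex.norm_real, Real.norm_eq_abs]
      rw [hx, e1, e2]
      have hw := weight_nonneg (c := c) (x := x)
      have hw2 := weight_le_sq (c := c) (x := x)
      have e3 := sq_nonneg ‖φ x‖
      have hab := abs_le.1 (le_refl |E₀ - V x|)
      by_cases hxr : R < ‖x‖
      · have hVx := abs_lt.1 (hxR hxr)
        have : 0 ≤ R ^ 2 * (|E₀ - V x| * ‖φ x‖ * ‖φ x‖ + -E₀ / 2 * ‖φ x‖ ^ 2) := by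
          have : 0 ≤ -E₀ / 2 := by linarith
          positivity
        have h5 : 0 ≤ weight c x * ‖φ x‖ ^ 2 * (V x - E₀ / 2) :=
          mul_nonneg (mul_nonneg hw e3) (by linarith)
        nlinarith
      · have hxr' : ‖x‖ ^ 2 ≤ R ^ 2 := by
          have := norm_nonneg x
          nlinarith
        have h6 : 0 ≤ |E₀ - V x| + -E₀ / 2 := by
          have := abs_nonneg (E₀ - V x)
          linarith
        have h7 : weight c x * (|E₀ - V x| + -E₀ / 2) * ‖φ x‖ ^ 2 ≤
            R ^ 2 * (|E₀ - V x| + -E₀ / 2) * ‖φ x‖ ^ 2 := by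
          have := hw2.trans hxr'
          gcongr
        have h8 : 0 ≤ weight c x * ‖φ x‖ ^ 2 * (|E₀ - V x| - (E₀ - V x)) :=
          mul_nonneg (mul_nonneg hw e3) (by linarith)
        nlinarith
    have hneg : Integrable fun x : R3 =>
        -(RCLike.re (inner ℂ (((memLp_weight_mul hc φ).toLp : ElectronSpace) x) (χ x))) :=
      (L2.integrable_inner ((memLp_weight_mul hc φ).toLp : ElectronSpace) χ).re.neg
    rw [integral_const_mul, integral_add hneg hM, integral_neg] at h2
    rw [← div_eq_inv_mul, le_div_iff₀ (by linarith)]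
    linarith
  -- pass to the limit
  have hlim : ∫⁻ x, ENNReal.ofReal (‖x‖ ^ 2 * ‖φ x‖ ^ 2) ≤
      ENNReal.ofReal ((-E₀ / 2)⁻¹ * (3 * ‖φ‖ ^ 2 + M)) := by
    let c : ℕ → ℝ := fun n => 1 / ((n : ℝ) + 1)
    have hc : ∀ n, 0 < c n := fun n => Nat.one_div_pos_of_nat
    have hc0 : Tendsto c atTop (𝓝 0) := tendsto_one_div_add_atTop_nhds_zero_nat
    have h1 : ∀ x, Tendsto (fun n => ENNReal.ofReal (weight (c n) x * ‖φ x‖ ^ 2)) atTop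
        (𝓝 (ENNReal.ofReal (‖x‖ ^ 2 * ‖φ x‖ ^ 2))) := fun x => by
      refine ENNReal.tendsto_ofReal (Tendsto.mul_const _ ?_)
      have hcont : ContinuousAt (fun c => weight c x) 0 := by
        unfold weight cutoff
        refine ContinuousAt.mul continuousAt_const (ContinuousAt.inv₀ (by fun_prop) (by simp))
      have h0 : weight 0 x = ‖x‖ ^ 2 := by simp [weight, cutoff]
      have := hcont.tendsto.comp hc0
      rwa [h0] at this
    calc ∫⁻ x, ENNReal.ofReal (‖x‖ ^ 2 * ‖φ x‖ ^ 2)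
        = ∫⁻ x, liminf (fun n => ENNReal.ofReal (weight (c n) x * ‖φ x‖ ^ 2)) atTop :=
          lintegral_congr fun x => (h1 x).liminf_eq.symm
      _ ≤ liminf (fun n => ∫⁻ x, ENNReal.ofReal (weight (c n) x * ‖φ x‖ ^ 2)) atTop :=
          lintegral_liminf_le' fun n => (hint _ (hc n)).1.aemeasurable.ennreal_ofReal
      _ ≤ liminf (fun _ : ℕ => ENNReal.ofReal ((-E₀ / 2)⁻¹ * (3 * ‖φ‖ ^ 2 + M))) atTop := by
          refine liminf_le_liminf (Eventually.of_forall fun n => ?_)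
          rw [← ofReal_integral_eq_lintegral_ofReal (hint _ (hc n))
            (Eventually.of_forall fun x => mul_nonneg weight_nonneg (sq_nonneg _))]
          exact ENNReal.ofReal_le_ofReal (hbound _ (hc n))
      _ = _ := liminf_const _
  have hmeas : AEStronglyMeasurable (fun x : R3 => ((‖x‖ : ℝ) : ℂ) * φ x) volume :=
    (Continuous.aestronglyMeasurable (by fun_prop)).mul (Lp.memLp φ).1
  rw [memLp_two_iff_integrable_sq_norm hmeas]
  refine ⟨hmeas.norm.pow 2, ?_⟩
  rw [hasFiniteIntegral_iff_norm]
  refine lt_of_le_of_lt (le_of_eq (lintegral_congr fun x => ?_)) (hlim.trans_lt ENNReal.ofReal_lt_top)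
  rw [Real.norm_of_nonneg (by positivity), norm_mul, Complex.norm_real, norm_norm, mul_pow]

/-- For an eigenfunction `φ` of `H_el` to a negative eigenvalue, `x_j φ` belongs to `D(H_el)` and
`H_el x_j φ = E₀ x_j φ - 2 i p_j φ`. -/
theorem exists_position_momentum_of_eigenvector {V : R3 → ℝ}
    (hV : Tendsto V (cocompact R3 ⊓ ae volume) (𝓝 0)) {φ : ElectronSpace} {E₀ : ℝ} (hE : E₀ < 0)
    (hφ : (φ, (E₀ : ℂ) • φ) ∈ (Hel V).graph) (j : Fin 3) :
    ∃ xφ pφ, (φ, xφ) ∈ (position j).graph ∧ (φ, pφ) ∈ (momentum j).graph ∧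
      (xφ, (E₀ : ℂ) • xφ - (2 * Complex.I) • pφ) ∈ (Hel V).graph := by
  have hx := memLp_norm_mul_of_eigenvector hV hE hφ
  obtain ⟨χ, v, hχ, hv, hsum⟩ := exists_mem_graph_add hφ
  obtain ⟨pφ, hp⟩ := exists_mem_graph_momentum hχ j
  rw [mem_graph_mulOp] at hv
  have hmeas : ∀ ψ : ElectronSpace,
      AEStronglyMeasurable (fun x : R3 => ((x j : ℝ) : ℂ) * ψ x) volume := fun ψ =>
    (Continuous.aestronglyMeasurable (by fun_prop)).mul (Lp.memLp ψ).1
  have hxj : ∀ x : R3, |x j| ≤ ‖x‖ := fun x => PiLp.norm_apply_le x j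
  have hxφ : MemLp (fun x : R3 => ((x j : ℝ) : ℂ) * φ x) 2 volume := by
    refine hx.mono (hmeas φ) (Eventually.of_forall fun x => ?_)
    rw [norm_mul, norm_mul, Complex.norm_real, Complex.norm_real, norm_norm, Real.norm_eq_abs]
    gcongr
    exact hxj x
  obtain ⟨R, hR⟩ := exists_abs_lt_of_tendsto hV one_pos
  have hxv : MemLp (fun x : R3 => ((x j : ℝ) : ℂ) * v x) 2 volume := by
    refine ((hx.norm.add ((Lp.memLp v).norm.const_mul |R|))).mono' (hmeas v) ?_
    filter_upwards [hv, hR] with x h1 h2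
    rw [Pi.add_apply, norm_mul, norm_mul, Complex.norm_real, Complex.norm_real, norm_norm,
      Real.norm_eq_abs]
    by_cases hxr : R < ‖x‖
    · have h3 : ‖v x‖ ≤ ‖φ x‖ := by
        rw [h1, norm_mul, Complex.norm_real, Real.norm_eq_abs]
        exact mul_le_of_le_one_left (norm_nonneg _) (h2 hxr).le
      have : |x j| * ‖v x‖ ≤ ‖x‖ * ‖φ x‖ := by gcongr; exact hxj x
      have : 0 ≤ |R| * ‖v x‖ := by positivity
      linarith
    · have h3 : |x j| ≤ |R| := (hxj x).trans ((not_lt.1 hxr).trans (le_abs_self R))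
      have : |x j| * ‖v x‖ ≤ |R| * ‖v x‖ := by gcongr
      have : 0 ≤ ‖x‖ * ‖φ x‖ := by positivity
      linarith
  have hχe : χ = (E₀ : ℂ) • φ - v := by rw [← hsum, add_sub_cancel_right]
  have h1 : (E₀ : ℂ) • hxφ.toLp - hxv.toLp =ᵐ[volume] fun x : R3 => ((x j : ℝ) : ℂ) * χ x := by
    filter_upwards [Lp.coeFn_sub ((E₀ : ℂ) • hxφ.toLp) hxv.toLp,
      Lp.coeFn_smul (E₀ : ℂ) hxφ.toLp, hxφ.coeFn_toLp, hxv.coeFn_toLp,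
      Lp.coeFn_sub ((E₀ : ℂ) • φ) v, Lp.coeFn_smul (E₀ : ℂ) φ] with x h1 h2 h3 h4 h5 h6
    rw [h1, Pi.sub_apply, h2, Pi.smul_apply, h3, h4, hχe, h5, Pi.sub_apply, h6, Pi.smul_apply]
    simp; ring
  have h2 := mem_graph_negLaplacian_coord_mul hχ hp hxφ.coeFn_toLp h1
  have h3 : (hxφ.toLp, hxv.toLp) ∈ (mulOp volume fun x => ((V x : ℝ) : ℂ)).graph := by
    rw [mem_graph_mulOp]
    filter_upwards [hxφ.coeFn_toLp, hxv.coeFn_toLp, hv] with x h1 h2 h3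
    rw [h1, h2, h3]; ring
  refine ⟨hxφ.toLp, pφ, (mem_graph_mulOp _ _ _ _).2 hxφ.coeFn_toLp, hp, ?_⟩
  have h4 := mem_graph_add h2 h3
  rwa [show (E₀ : ℂ) • hxφ.toLp - hxv.toLp - (2 * Complex.I) • pφ + hxv.toLp =
    (E₀ : ℂ) • hxφ.toLp - (2 * Complex.I) • pφ by abel] at h4

end Decay

/-! ### Dispersive decay of one-photon amplitudes -/

section Amplitude

/-- `h ∈ C_0^n(ℝ³ ∖ {0})`, extended by zero to `ℝ³`. -/
structure IsAway (n : ℕ) (h : R3 → ℂ) : Prop where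
  contDiff : ContDiff ℝ n h
  compact : HasCompactSupport h
  zero_notMem : (0 : R3) ∉ tsupport h

theorem IsAway.mul {n : ℕ} {h : R3 → ℂ} (hh : IsAway n h) {g : R3 → ℂ}
    (hg : ∀ x ≠ 0, ContDiffAt ℝ n g x) : IsAway n (fun x => g x * h x) where
  contDiff := by
    rw [contDiff_iff_contDiffAt]
    intro x
    by_cases hx : x ∈ tsupport h
    · exact (hg x fun h0 => hh.zero_notMem (h0 ▸ hx)).mul hh.contDiff.contDiffAt
    · refine (contDiffAt_const (c := (0 : ℂ))).congr_of_eventuallyEq ?_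
      filter_upwards [notMem_tsupport_iff_eventuallyEq.1 hx] with y hy
      rw [hy]; simp
  compact := hh.compact.mul_left
  zero_notMem h := hh.zero_notMem (tsupport_mul_subset_right h)

theorem IsAway.apply_zero {n : ℕ} {h : R3 → ℂ} (hh : IsAway n h) : h 0 = 0 :=
  image_eq_zero_of_notMem_tsupport hh.zero_notMem

theorem IsAway.integrable {n : ℕ} {h : R3 → ℂ} (hh : IsAway n h) : Integrable h :=
  hh.contDiff.continuous.integrable_of_hasCompactSupport hh.compact

/-- The direction cosine `x_j / |x|`. -/
def unitCoord (j : Fin 3) (x : R3) : ℂ := ((x j / ‖x‖ : ℝ) : ℂ)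

theorem contDiffAt_norm_ofReal {n : ℕ} {x : R3} (hx : x ≠ 0) :
    ContDiffAt ℝ n (fun x : R3 => ((‖x‖ : ℝ) : ℂ)) x :=
  Complex.ofRealCLM.contDiff.contDiffAt.comp x (contDiffAt_norm ℝ hx)

theorem contDiffAt_unitCoord {n : ℕ} (j : Fin 3) {x : R3} (hx : x ≠ 0) :
    ContDiffAt ℝ n (unitCoord j) x := by
  have h1 : ContDiffAt ℝ n (fun x : R3 => x j) x :=
    (EuclideanSpace.proj (𝕜 := ℝ) j).contDiff.contDiffAt
  exact Complex.ofRealCLM.contDiff.contDiffAt.comp x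
    (h1.div (contDiffAt_norm ℝ hx) (norm_ne_zero_iff.2 hx))

/-- The radial divergence `∇ · (x̂ h)`. -/
def radialDiv (h : R3 → ℂ) (x : R3) : ℂ :=
  ∑ j, fderiv ℝ (fun x => unitCoord j x * h x) x (stdVec j)

theorem IsAway.fderiv_apply {n : ℕ} {h : R3 → ℂ} (hh : IsAway (n + 1) h) (v : R3) :
    IsAway n (fun x => fderiv ℝ h x v) where
  contDiff := (hh.contDiff.fderiv_right (m := n) (by norm_cast)).clm_apply contDiff_const
  compact := hh.compact.fderiv_apply ℝ v
  zero_notMem h0 := hh.zero_notMem (tsupport_fderiv_apply_subset ℝ v h0)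

theorem IsAway.sum {n : ℕ} {ι : Type*} {s : Finset ι} {h : ι → R3 → ℂ}
    (hh : ∀ i, IsAway n (h i)) : IsAway n (fun x => ∑ i ∈ s, h i x) := by
  classical
  induction s using Finset.induction_on with
  | empty =>
    simp only [Finset.sum_empty]
    exact ⟨contDiff_const, HasCompactSupport.zero, by simp [tsupport]⟩
  | insert a s ha ih =>
    simp only [Finset.sum_insert ha]
    refine ⟨(hh a).contDiff.add ih.contDiff, (hh a).compact.add ih.compact, fun h0 => ?_⟩
    rcases tsupport_add (h a) (fun x => ∑ i ∈ s, h i x) h0 with h1 | h1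
    · exact (hh a).zero_notMem h1
    · exact ih.zero_notMem h1

theorem IsAway.isAway_radialDiv {n : ℕ} {h : R3 → ℂ} (hh : IsAway (n + 1) h) :
    IsAway n (radialDiv h) :=
  IsAway.sum fun j => (hh.mul fun _ hx => contDiffAt_unitCoord j hx).fderiv_apply (stdVec j)

/-- The one-photon time evolution `e^{-i s |k|}`. -/
def photonPhase (s : ℝ) (x : R3) : ℂ := Complex.exp (-(Complex.I * s * ‖x‖))

theorem norm_photonPhase (s : ℝ) (x : R3) : ‖photonPhase s x‖ = 1 := by
  rw [photonPhase, Complex.norm_exp]; simp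

theorem continuous_photonPhase (s : ℝ) : Continuous (photonPhase s) := by
  unfold photonPhase; fun_prop

/-- The amplitude `∫ e^{-i s |k|} h(k) dk`. -/
def amplitude (h : R3 → ℂ) (s : ℝ) : ℂ := ∫ x, photonPhase s x * h x

theorem norm_amplitude_le (h : R3 → ℂ) (s : ℝ) : ‖amplitude h s‖ ≤ ∫ x, ‖h x‖ := by
  refine (norm_integral_le_integral_norm _).trans (le_of_eq ?_)
  simp [norm_photonPhase]

theorem integrable_photonPhase_mul {h : R3 → ℂ} (hh : Integrable h) (s : ℝ) :
    Integrable fun x => photonPhase s x * h x :=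
  hh.bdd_mul (c := 1) (continuous_photonPhase s).aestronglyMeasurable
    (Eventually.of_forall fun x => (norm_photonPhase s x).le)

theorem hasDerivAt_amplitude {h : R3 → ℂ} (hh : Integrable h)
    (hh' : Integrable fun x => ((‖x‖ : ℝ) : ℂ) * h x) (s : ℝ) :
    HasDerivAt (amplitude h) (-Complex.I * amplitude (fun x => ((‖x‖ : ℝ) : ℂ) * h x) s) s := by
  have key := hasDerivAt_integral_of_dominated_loc_of_deriv_le (μ := (volume : Measure R3))
    (F := fun s x => photonPhase s x * h x)
    (F' := fun s x => -Complex.I * (photonPhase s x * (((‖x‖ : ℝ) : ℂ) * h x)))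
    (bound := fun x => ‖((‖x‖ : ℝ) : ℂ) * h x‖) (x₀ := s) (s := Set.univ) univ_mem
    (Eventually.of_forall fun s => (integrable_photonPhase_mul hh s).1)
    (integrable_photonPhase_mul hh s)
    ((integrable_photonPhase_mul hh' s).const_mul _).1
    (Eventually.of_forall fun x s _ => by
      rw [norm_mul, norm_neg, Complex.norm_I, one_mul, norm_mul, norm_photonPhase, one_mul])
    hh'.norm
    (Eventually.of_forall fun x s _ => by
      have h1 : HasDerivAt (fun s : ℝ => photonPhase s x)
          (-Complex.I * ‖x‖ * photonPhase s x) s := by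
        have := hasDerivAt_phase ‖x‖ s
        exact this
      exact (h1.mul_const (h x)).congr_deriv (by ring))
  rw [amplitude, ← integral_const_mul]
  exact key.2

theorem differentiableAt_photonPhase (s : ℝ) {x : R3} (hx : x ≠ 0) :
    DifferentiableAt ℝ (photonPhase s) x := by
  have h1 : ContDiffAt ℝ (1 : ℕ) (fun x : R3 => ((‖x‖ : ℝ) : ℂ)) x := contDiffAt_norm_ofReal hx
  have h2 := h1.differentiableAt (by norm_num)
  exact ((h2.const_mul (Complex.I * s)).neg).cexp

theorem fderiv_photonPhase (s : ℝ) {x : R3} (hx : x ≠ 0) (j : Fin 3) :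
    fderiv ℝ (photonPhase s) x (stdVec j) = -(Complex.I * s) * (unitCoord j x * photonPhase s x) := by
  have hn : ‖x‖ ^ 2 ≠ 0 := by simpa using hx
  have h1 : HasFDerivAt (fun x : R3 => ‖x‖) ((1 / (2 * Real.sqrt (‖x‖ ^ 2))) • (2 • innerSL ℝ x)) x := by
    have := (hasStrictFDerivAt_norm_sq x).hasFDerivAt.sqrt hn
    refine this.congr_of_eventuallyEq (Eventually.of_forall fun y => ?_)
    simp [Real.sqrt_sq (norm_nonneg y)]
  have h2 := Complex.ofRealCLM.hasFDerivAt.comp x h1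
  have h3 := ((h2.const_mul (Complex.I * s)).neg).cexp
  have h4 : fderiv ℝ (photonPhase s) x = _ := h3.fderiv
  rw [h4]
  simp [photonPhase, unitCoord, inner_stdVec, Real.sqrt_sq (norm_nonneg x)]
  have : (‖x‖ : ℂ) ≠ 0 := by simpa using hx
  field_simp

theorem sum_unitCoord_sq {x : R3} (hx : x ≠ 0) : ∑ j, unitCoord j x ^ 2 = 1 := by
  have h1 : ‖x‖ ^ 2 = ∑ j, (x j) ^ 2 := by
    rw [EuclideanSpace.norm_sq_eq]; simp
  have h2 : ‖x‖ ^ 2 ≠ 0 := by simpa using hx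
  simp only [unitCoord]
  rw [← Complex.ofReal_one, ← div_self h2]
  nth_rewrite 1 [h1]
  rw [Finset.sum_div]
  push_cast
  exact Finset.sum_congr rfl fun j _ => by ring

/-- Integration by parts in the radial direction: `x̂ · ∇ e^{-i s |x|} = -i s e^{-i s |x|}`, and the
origin, where `|x|` is not smooth, is outside the support of `h`. -/
theorem mul_amplitude {n : ℕ} {h : R3 → ℂ} (hh : IsAway (n + 1) h) (s : ℝ) :
    Complex.I * s * amplitude h s = amplitude (radialDiv h) s := by
  have hg : ∀ j, IsAway (n + 1) (fun x => unitCoord j x * h x) := fun j =>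
    hh.mul fun _ hx => contDiffAt_unitCoord j hx
  have hg' := fun j => (hg j).fderiv_apply (stdVec j)
  have e : ∀ j x, fderiv ℝ (photonPhase s) x (stdVec j) * (unitCoord j x * h x) =
      -(Complex.I * s) * (photonPhase s x * (unitCoord j x * (unitCoord j x * h x))) := fun j x => by
    by_cases hx : x = 0
    · rw [hx, hh.apply_zero]; simp
    · rw [fderiv_photonPhase s hx]; ring
  have hi : ∀ j, Integrable fun x =>
      -(Complex.I * s) * (photonPhase s x * (unitCoord j x * (unitCoord j x * h x))) := fun j =>
    (integrable_photonPhase_mul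
      ((hg j).mul fun _ hx => contDiffAt_unitCoord j hx).integrable s).const_mul _
  have key : ∀ j, ∫ x, photonPhase s x * fderiv ℝ (fun x => unitCoord j x * h x) x (stdVec j) =
      ∫ x, (Complex.I * s) * (photonPhase s x * (unitCoord j x * (unitCoord j x * h x))) := fun j => by
    rw [integral_mul_fderiv_eq_neg_fderiv_mul_of_integrable (f := photonPhase s)
      (g := fun x => unitCoord j x * h x) (by simp only [e]; exact hi j)
      (integrable_photonPhase_mul (hg' j).integrable s)
      (integrable_photonPhase_mul (hg j).integrable s)
      (fun x hx => differentiableAt_photonPhase s fun h0 => (hg j).zero_notMem (h0 ▸ hx))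
      (fun x _ => ((hg j).contDiff.differentiable (by simp)) x)]
    simp only [e]
    rw [← integral_neg]
    simp
  simp only [amplitude, radialDiv, Finset.mul_sum]
  rw [integral_finsetSum _ fun j _ => integrable_photonPhase_mul (hg' j).integrable s]
  simp only [key]
  rw [← integral_const_mul, ← integral_finsetSum _ fun j _ => by simpa using (hi j).neg]
  refine integral_congr_ae (Eventually.of_forall fun x => ?_)
  by_cases hx : x = 0
  · simp [hx, hh.apply_zero]
  · have := sum_unitCoord_sq hx
    calc _ = Complex.I * s * (photonPhase s x * ((∑ j, unitCoord j x ^ 2) * h x)) := by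
            rw [this, one_mul]
      _ = _ := by
        rw [Finset.sum_mul, Finset.mul_sum, Finset.mul_sum]
        exact Finset.sum_congr rfl fun j _ => by ring

theorem IsAway.norm_mul {n : ℕ} {h : R3 → ℂ} (hh : IsAway n h) :
    IsAway n fun x => ((‖x‖ : ℝ) : ℂ) * h x :=
  hh.mul fun _ hx => contDiffAt_norm_ofReal hx

theorem IsAway.hasDerivAt_amplitude {n : ℕ} {h : R3 → ℂ} (hh : IsAway n h) (s : ℝ) :
    HasDerivAt (amplitude h) (-Complex.I * amplitude (fun x => ((‖x‖ : ℝ) : ℂ) * h x) s) s :=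
  Photoeffect.hasDerivAt_amplitude hh.integrable hh.norm_mul.integrable s

theorem IsAway.continuous_amplitude {n : ℕ} {h : R3 → ℂ} (hh : IsAway n h) :
    Continuous (amplitude h) :=
  continuous_iff_continuousAt.2 fun s => (hh.hasDerivAt_amplitude s).continuousAt

/-- The amplitudes decay like `s⁻²`: two radial integrations by parts. -/
theorem IsAway.integrable_amplitude {h : R3 → ℂ} (hh : IsAway 2 h) : Integrable (amplitude h) := by
  have hb : ∀ s : ℝ, ‖amplitude h s‖ ≤
      ((∫ x, ‖h x‖) + ∫ x, ‖radialDiv (radialDiv h) x‖) * (1 + s ^ 2)⁻¹ := fun s => by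
    have h1 := mul_amplitude (n := 1) hh s
    have h2 := mul_amplitude (n := 0) (h := radialDiv h) (IsAway.isAway_radialDiv (n := 1) hh) s
    rw [← h1] at h2
    have h3 := norm_amplitude_le (radialDiv (radialDiv h)) s
    rw [← h2] at h3
    simp only [_root_.norm_mul, Complex.norm_I, one_mul, Complex.norm_real] at h3
    have h4 := norm_amplitude_le h s
    rw [← div_eq_mul_inv, le_div_iff₀ (by positivity)]
    have h5 : ‖s‖ * ‖s‖ = s ^ 2 := by rw [Real.norm_eq_abs, abs_mul_abs_self, sq]
    rw [← mul_assoc, h5] at h3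
    linarith
  exact (integrable_inv_one_add_sq.const_mul _).mono'
    hh.continuous_amplitude.aestronglyMeasurable (Eventually.of_forall hb)

/-- The amplitude of `h` is the derivative of the integrable amplitude of `i |x|⁻¹ h`. -/
theorem IsAway.integral_amplitude {h : R3 → ℂ} (hh : IsAway 2 h) : ∫ s, amplitude h s = 0 := by
  have hg : IsAway 2 fun x => ((‖x‖ : ℝ) : ℂ)⁻¹ * h x :=
    hh.mul fun x hx => (contDiffAt_norm_ofReal hx).inv (by simpa using hx)
  have e : (fun x : R3 => ((‖x‖ : ℝ) : ℂ) * (((‖x‖ : ℝ) : ℂ)⁻¹ * h x)) = h := by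
    ext x
    by_cases hx : x = 0
    · simp [hx, hh.apply_zero]
    · rw [mul_inv_cancel_left₀ (by simpa using hx)]
  have hd := fun s => hg.hasDerivAt_amplitude s
  simp only [e] at hd
  have := integral_eq_zero_of_hasDerivAt_of_integrable hd (hh.integrable_amplitude.const_mul _)
    hg.integrable_amplitude
  rw [integral_const_mul] at this
  simpa using this

end Amplitude

/-! ### Symmetrized product vectors -/

section ProductVectors

instance (n : ℕ) : SigmaFinite (modeMeasures n) := by unfold modeMeasures; infer_instance

/-- The tensor product `g_1 ⊗ ⋯ ⊗ g_n` of one-photon wave functions. -/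
def tensorProd : {n : ℕ} → (Fin n → PhotonSpace) → TensorPower n
  | 0, _ => oneZero
  | _ + 1, g => tensorCons (g 0) (tensorProd (Fin.tail g))

theorem coeFn_tensorCons {n : ℕ} (h : PhotonSpace) (Ψ : TensorPower n) :
    tensorCons h Ψ =ᵐ[modeMeasures (n + 1)] fun k => h (k 0) * Ψ (Fin.tail k) :=
  (memLp_tensorCons h Ψ).coeFn_toLp

theorem coeFn_tensorProd {n : ℕ} (g : Fin n → PhotonSpace) :
    tensorProd g =ᵐ[modeMeasures n] fun k => ∏ i, g i (k i) := by
  induction n with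
  | zero =>
    have h : oneZero =ᵐ[modeMeasures 0] _ := indicatorConstLp_coeFn
    refine h.trans (Eventually.of_forall fun k => ?_)
    simp
  | succ n ih =>
    filter_upwards [coeFn_tensorCons (g 0) (tensorProd (Fin.tail g)),
      (quasiMeasurePreserving_tail n).ae (ih (Fin.tail g))] with k h1 h2
    rw [Fin.prod_univ_succ, tensorProd, h1, h2]
    rfl

theorem coeFn_permute {n : ℕ} (σ : Equiv.Perm (Fin n)) (Ψ : TensorPower n) :
    permute σ Ψ =ᵐ[modeMeasures n] fun k => Ψ fun i => k (σ i) :=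
  Lp.coeFn_compMeasurePreserving Ψ (measurePreserving_permute σ)

theorem permute_permute {n : ℕ} (σ τ : Equiv.Perm (Fin n)) (Ψ : TensorPower n) :
    permute σ (permute τ Ψ) = permute (σ * τ) Ψ := by
  refine Lp.ext ?_
  filter_upwards [coeFn_permute σ (permute τ Ψ), coeFn_permute (σ * τ) Ψ,
    (measurePreserving_permute σ).quasiMeasurePreserving.ae (coeFn_permute τ Ψ)] with k h1 h2 h3
  rw [h1, h2, h3]
  rfl

theorem permute_tensorProd {n : ℕ} (σ : Equiv.Perm (Fin n)) (g : Fin n → PhotonSpace) :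
    permute σ (tensorProd g) = tensorProd fun i => g (σ.symm i) := by
  refine Lp.ext ?_
  filter_upwards [coeFn_permute σ (tensorProd g), coeFn_tensorProd fun i => g (σ.symm i),
    (measurePreserving_permute σ).quasiMeasurePreserving.ae (coeFn_tensorProd g)] with k h1 h2 h3
  rw [h1, h2, h3, ← Equiv.prod_comp σ fun i => (g (σ.symm i) : Mode → ℂ) (k i)]
  simp only [Equiv.symm_apply_apply]

/-- Prepending a factor commutes with permutations, once these are extended so as to fix the new
first variable. -/
theorem permute_tensorCons {n : ℕ} (σ : Equiv.Perm (Fin n)) (h : PhotonSpace)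
    (Ψ : TensorPower n) :
    tensorCons h (permute σ Ψ) = permute (Equiv.Perm.decomposeFin.symm (0, σ)) (tensorCons h Ψ) := by
  refine Lp.ext ?_
  set τ : Equiv.Perm (Fin (n + 1)) := Equiv.Perm.decomposeFin.symm (0, σ) with hτ
  filter_upwards [coeFn_permute τ (tensorCons h Ψ), coeFn_tensorCons h (permute σ Ψ),
    (measurePreserving_permute τ).quasiMeasurePreserving.ae (coeFn_tensorCons h Ψ),
    (quasiMeasurePreserving_tail n).ae (coeFn_permute σ Ψ)] with k h1 h2 h3 h4
  rw [h1, h2, h3, h4]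
  have e0 : τ 0 = 0 := Equiv.Perm.decomposeFin_symm_apply_zero _ _
  have e1 : ∀ i : Fin n, τ i.succ = (σ i).succ := fun i => by
    rw [hτ, Equiv.Perm.decomposeFin_symm_apply_succ]; simp
  simp only [e0]
  congr 2

theorem mem_symmetricSubspace {n : ℕ} {Ψ : TensorPower n} :
    Ψ ∈ symmetricSubspace n ↔ ∀ σ, permute σ Ψ = Ψ := by
  rw [symmetricSubspace, Submodule.mem_iInf]
  rfl

/-- The symmetrizer is the average over all permutations of the variables. -/
theorem coe_symmetrizer {n : ℕ} (Ψ : TensorPower n) :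
    (symmetrizer n Ψ : TensorPower n) = ((n.factorial : ℕ) : ℂ)⁻¹ • ∑ σ, permute σ Ψ := by
  have hn : ((n.factorial : ℕ) : ℂ) ≠ 0 := by exact_mod_cast n.factorial_ne_zero
  rw [symmetrizer, Submodule.coe_orthogonalProjectionOnto_apply]
  refine Submodule.eq_starProjection_of_mem_of_inner_eq_zero ?_ fun w hw => ?_
  · rw [mem_symmetricSubspace]
    intro τ
    rw [map_smul, map_sum]
    simp only [permute_permute]
    congr 1
    exact Equiv.sum_comp (Equiv.mulLeft τ) fun σ => permute σ Ψ
  · rw [mem_symmetricSubspace] at hw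
    have h1 : ∀ σ : Equiv.Perm (Fin n), inner ℂ (permute σ Ψ) w = inner ℂ Ψ w := fun σ => by
      nth_rewrite 1 [← hw σ]
      exact (permute σ).inner_map_map Ψ w
    rw [inner_sub_left, inner_smul_left, sum_inner]
    simp only [h1, Finset.sum_const, Finset.card_univ, Fintype.card_perm, Fintype.card_fin,
      nsmul_eq_mul, map_inv₀, map_natCast]
    rw [inv_mul_cancel_left₀ hn, sub_self]

theorem symmetrizer_permute {n : ℕ} (τ : Equiv.Perm (Fin n)) (Ψ : TensorPower n) :
    symmetrizer n (permute τ Ψ) = symmetrizer n Ψ := by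
  refine Subtype.ext ?_
  rw [coe_symmetrizer, coe_symmetrizer]
  simp only [permute_permute]
  congr 1
  exact Equiv.sum_comp (Equiv.mulRight τ) fun σ => permute σ Ψ

/-- `Ψ ↦ h ⊗ Ψ` as a linear map. -/
def tensorConsL {n : ℕ} (h : PhotonSpace) : TensorPower n →ₗ[ℂ] TensorPower (n + 1) where
  toFun := tensorCons h
  map_add' := tensorCons_add h
  map_smul' c Ψ := tensorCons_smul h c Ψ

theorem symmetrizer_tensorCons_symmetrizer {n : ℕ} (h : PhotonSpace) (Ψ : TensorPower n) :
    symmetrizer (n + 1) (tensorCons h (symmetrizer n Ψ : TensorPower n)) =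
      symmetrizer (n + 1) (tensorCons h Ψ) := by
  have hn : ((n.factorial : ℕ) : ℂ) ≠ 0 := by exact_mod_cast n.factorial_ne_zero
  change symmetrizer (n + 1) (tensorConsL h (symmetrizer n Ψ : TensorPower n)) = _
  rw [coe_symmetrizer, map_smul, map_sum, map_smul, map_sum]
  have h1 : ∀ σ : Equiv.Perm (Fin n), symmetrizer (n + 1) (tensorConsL h (permute σ Ψ)) =
      symmetrizer (n + 1) (tensorCons h Ψ) := fun σ => by
    change symmetrizer (n + 1) (tensorCons h (permute σ Ψ)) = _
    rw [permute_tensorCons, symmetrizer_permute]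
  simp only [h1, Finset.sum_const, Finset.card_univ, Fintype.card_perm, Fintype.card_fin]
  rw [← Nat.cast_smul_eq_nsmul ℂ, smul_smul, inv_mul_cancel₀ hn, one_smul]

theorem inner_tensorCons {n : ℕ} (h f : PhotonSpace) (Ψ Φ : TensorPower n) :
    inner ℂ (tensorCons h Ψ) (tensorCons f Φ) = inner ℂ h f * inner ℂ Ψ Φ := by
  simp_rw [L2.inner_def]
  have hmp := measurePreserving_piFinSuccAbove (fun _ : Fin (n + 1) => modeMeasure) 0
  rw [← integral_prod_mul (μ := modeMeasure) (ν := modeMeasures n)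
    (fun x => inner ℂ (h x) (f x)) (fun k => inner ℂ (Ψ k) (Φ k))]
  have h2 := hmp.integral_comp (MeasurableEquiv.measurableEmbedding _)
    (fun z : Mode × (Fin n → Mode) => inner ℂ (h z.1) (f z.1) * inner ℂ (Ψ z.2) (Φ z.2))
  refine Eq.trans ?_ h2
  refine integral_congr_ae ?_
  filter_upwards [coeFn_tensorCons h Ψ, coeFn_tensorCons f Φ] with k h3 h4
  rw [h3, h4]
  change _ = inner ℂ (h (k 0)) (f (k 0)) * inner ℂ (Ψ (Fin.tail k)) (Φ (Fin.tail k))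
  simp only [RCLike.inner_apply, map_mul]
  ring

/-- The symmetrized product `√(n!) S_n (g_1 ⊗ ⋯ ⊗ g_n)`; the normalization is that of
`a^*(g_1) ⋯ a^*(g_n) Ω`. -/
def symProd {n : ℕ} (g : Fin n → PhotonSpace) : symmetricSubspace n :=
  ((Real.sqrt (n.factorial : ℝ) : ℝ) : ℂ) • symmetrizer n (tensorProd g)

theorem symProd_comp_perm {n : ℕ} (g : Fin n → PhotonSpace) (σ : Equiv.Perm (Fin n)) :
    symProd (fun i => g (σ i)) = symProd g := by
  have := permute_tensorProd σ.symm g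
  rw [Equiv.symm_symm] at this
  rw [symProd, symProd, ← this, symmetrizer_permute]

theorem symmetrizer_tensorCons_symProd {n : ℕ} (h : PhotonSpace) (g : Fin n → PhotonSpace) :
    ((Real.sqrt ((n : ℝ) + 1) : ℝ) : ℂ) •
      symmetrizer (n + 1) (tensorCons h (symProd g : TensorPower n)) = symProd (Fin.cons h g) := by
  have e : tensorCons h (symProd g : TensorPower n) = ((Real.sqrt (n.factorial : ℝ) : ℝ) : ℂ) •
      tensorCons h (symmetrizer n (tensorProd g) : TensorPower n) := by
    rw [← tensorCons_smul]; rfl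
  rw [e, map_smul, symmetrizer_tensorCons_symmetrizer, smul_smul, symProd, ← Complex.ofReal_mul,
    ← Real.sqrt_mul (by positivity), Nat.factorial_succ]
  push_cast
  congr 1

theorem coe_symProd {n : ℕ} (g : Fin n → PhotonSpace) :
    (symProd g : TensorPower n) = (((Real.sqrt (n.factorial : ℝ) : ℝ) : ℂ) *
      ((n.factorial : ℕ) : ℂ)⁻¹) • ∑ σ : Equiv.Perm (Fin n), tensorProd fun i => g (σ i) := by
  rw [symProd, Submodule.coe_smul, coe_symmetrizer, smul_smul]
  congr 1
  rw [← Equiv.sum_comp (Equiv.inv (Equiv.Perm (Fin n)))]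
  refine Finset.sum_congr rfl fun σ _ => ?_
  rw [permute_tensorProd]
  rfl

theorem inner_symmetrizer_left {n : ℕ} (Ψ : TensorPower n) (χ : symmetricSubspace n) :
    inner ℂ (symmetrizer n Ψ : TensorPower n) (χ : TensorPower n) = inner ℂ Ψ (χ : TensorPower n) := by
  rw [symmetrizer, ← Submodule.coe_inner, Submodule.inner_orthogonalProjectionOnto_eq_of_mem_right]

/-- The adjoint of creation, evaluated on product vectors: each of the factors is removed in turn,
where `swap 0 p` moves the first factor into the place of the removed one. -/
theorem inner_symmetrizer_tensorCons_symProd {n : ℕ} (h : PhotonSpace) (ψ : symmetricSubspace n)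
    (g : Fin (n + 1) → PhotonSpace) :
    inner ℂ (((Real.sqrt ((n : ℝ) + 1) : ℝ) : ℂ) •
      symmetrizer (n + 1) (tensorCons h (ψ : TensorPower n))) (symProd g) =
    inner ℂ ψ (∑ p, inner ℂ h (g p) • symProd fun j => g (Equiv.swap 0 p j.succ)) := by
  rw [Submodule.coe_inner, Submodule.coe_inner, Submodule.coe_smul, inner_smul_left,
    inner_symmetrizer_left, Submodule.coe_sum, inner_sum]
  simp only [Submodule.coe_smul, coe_symProd, inner_smul_right, inner_sum, Complex.conj_ofReal]
  have h1 : ∀ σ : Equiv.Perm (Fin (n + 1)),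
      inner ℂ (tensorCons h (ψ : TensorPower n)) (tensorProd fun i => g (σ i)) =
      inner ℂ h (g (σ 0)) * inner ℂ (ψ : TensorPower n) (tensorProd fun i => g (σ i.succ)) :=
    fun σ => inner_tensorCons _ _ _ _
  simp only [h1]
  rw [← Equiv.sum_comp Equiv.Perm.decomposeFin.symm, Fintype.sum_prod_type, Finset.mul_sum,
    Finset.mul_sum]
  refine Finset.sum_congr rfl fun p _ => ?_
  simp only [Equiv.Perm.decomposeFin_symm_apply_zero, Equiv.Perm.decomposeFin_symm_apply_succ]
  rw [← Finset.mul_sum]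
  have hc : ((Real.sqrt ((n : ℝ) + 1) : ℝ) : ℂ) * (((Real.sqrt ((n + 1).factorial : ℝ) : ℝ) : ℂ) *
      (((n + 1).factorial : ℕ) : ℂ)⁻¹) = ((Real.sqrt (n.factorial : ℝ) : ℝ) : ℂ) *
      ((n.factorial : ℕ) : ℂ)⁻¹ := by
    have h3 : Real.sqrt ((n : ℝ) + 1) * Real.sqrt ((n : ℝ) + 1) = n + 1 :=
      Real.mul_self_sqrt (by positivity)
    have h4 : Real.sqrt ((n + 1).factorial : ℝ) =
        Real.sqrt ((n : ℝ) + 1) * Real.sqrt (n.factorial : ℝ) := by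
      rw [← Real.sqrt_mul (by positivity), Nat.factorial_succ]; push_cast; rfl
    have h5 : ((n.factorial : ℕ) : ℝ) ≠ 0 := by exact_mod_cast n.factorial_ne_zero
    have h6 : (n : ℝ) + 1 ≠ 0 := by positivity
    have : Real.sqrt ((n : ℝ) + 1) * (Real.sqrt ((n + 1).factorial : ℝ) *
      (((n + 1).factorial : ℕ) : ℝ)⁻¹) = Real.sqrt (n.factorial : ℝ) * ((n.factorial : ℕ) : ℝ)⁻¹ := by
      rw [h4, Nat.factorial_succ]
      push_cast
      rw [mul_assoc, ← mul_assoc (Real.sqrt ((n : ℝ) + 1)), h3]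
      field_simp
    simpa only [Complex.ofReal_mul, Complex.ofReal_inv, Complex.ofReal_natCast] using
      congrArg Complex.ofReal this
  rw [← mul_assoc, hc]
  ring

end ProductVectors

/-! ### Field operators on product vectors -/

section FieldOperators

/-- The vector `a^*(g_1) ⋯ a^*(g_n) Ω` of the Fock space. -/
def fockProd {n : ℕ} (g : Fin n → PhotonSpace) : Fock := lp.single 2 n (symProd g)

theorem fockProd_comp_perm {n : ℕ} (g : Fin n → PhotonSpace) (σ : Equiv.Perm (Fin n)) :
    fockProd (fun i => g (σ i)) = fockProd g := by
  rw [fockProd, fockProd, symProd_comp_perm]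

theorem fockProd_zero (g : Fin 0 → PhotonSpace) : fockProd g = vacuum := by
  rw [fockProd, vacuum]
  congr 1
  refine Subtype.ext ?_
  rw [coe_symProd]
  simp [tensorProd]

/-- Creation on the vectors with a fixed number of photons. -/
theorem single_mem_graph_creation {n : ℕ} (h : PhotonSpace) (ψ : symmetricSubspace n) :
    (lp.single 2 n ψ, lp.single 2 (n + 1) (((Real.sqrt ((n : ℝ) + 1) : ℝ) : ℂ) •
      symmetrizer (n + 1) (tensorCons h (ψ : TensorPower n)))) ∈ (creation h).graph := by
  rw [mem_graph_creation]
  refine ⟨by rw [lp.single_apply, Pi.single_eq_of_ne (by omega)], fun m => ?_⟩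
  by_cases hm : m = n
  · subst hm
    rw [lp.single_apply, lp.single_apply, Pi.single_eq_same, Pi.single_eq_same]
  · rw [lp.single_apply, lp.single_apply, Pi.single_eq_of_ne (by omega), Pi.single_eq_of_ne hm]
    have : tensorCons h ((0 : symmetricSubspace m) : TensorPower m) = 0 :=
      (tensorConsL (n := m) h).map_zero
    rw [this, map_zero, smul_zero]

theorem fockProd_mem_graph_creation {n : ℕ} (h : PhotonSpace) (g : Fin n → PhotonSpace) :
    (fockProd g, fockProd (Fin.cons h g : Fin (n + 1) → PhotonSpace)) ∈ (creation h).graph := by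
  have := single_mem_graph_creation h (symProd g)
  rwa [symmetrizer_tensorCons_symProd] at this

theorem dense_domain_creation (h : PhotonSpace) : Dense ((creation h).domain : Set Fock) := by
  intro Ψ
  have h1 := lp.hasSum_single (E := fun n => symmetricSubspace n) (p := 2) (by norm_num) Ψ
  refine mem_closure_of_tendsto h1 (Eventually.of_forall fun s => ?_)
  exact Submodule.sum_mem _ fun n _ =>
    mem_domain_of_mem_graph (single_mem_graph_creation h (Ψ n))

/-- `(Ψ, Φ)` lies in the graph of `a(h)` if `⟨a^*(h) Ξ, Ψ⟩ = ⟨Ξ, Φ⟩` for all `Ξ` in the domain of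
`a^*(h)`. -/
theorem mem_graph_annihilation {h : PhotonSpace} {Ψ Φ : Fock}
    (hΨ : ∀ Ξ Υ : Fock, (Ξ, Υ) ∈ (creation h).graph → inner ℂ Υ Ψ = inner ℂ Ξ Φ) :
    (Ψ, Φ) ∈ (annihilation h).graph := by
  have h1 : ∀ x : (creation h).domain, inner ℂ Φ (x : Fock) = inner ℂ Ψ (creation h x) := fun x => by
    rw [← inner_conj_symm, ← hΨ x (creation h x) (LinearPMap.mem_graph _ x), inner_conj_symm]
  have hd : Ψ ∈ (annihilation h).domain :=
    LinearPMap.mem_adjoint_domain_of_exists (T := creation h) Ψ ⟨Φ, h1⟩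
  exact mem_graph_iff'.2 ⟨hd, LinearPMap.adjoint_apply_eq (dense_domain_creation h) ⟨Ψ, hd⟩ h1⟩

theorem inner_creation_eq_inner_annihilation {h : PhotonSpace} {Ψ Φ Ξ Υ : Fock}
    (h1 : (Ξ, Υ) ∈ (creation h).graph) (h2 : (Ψ, Φ) ∈ (annihilation h).graph) :
    inner ℂ Υ Ψ = inner ℂ Ξ Φ := by
  obtain ⟨hd, rfl⟩ := mem_graph_iff'.1 h1
  obtain ⟨hd', rfl⟩ := mem_graph_iff'.1 h2
  have := LinearPMap.adjoint_isFormalAdjoint (dense_domain_creation h) ⟨Ψ, hd'⟩ ⟨Ξ, hd⟩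
  rw [← inner_conj_symm, ← this, inner_conj_symm]
  rfl

theorem fockProd_zero_mem_graph_annihilation (h : PhotonSpace) (g : Fin 0 → PhotonSpace) :
    (fockProd g, (0 : Fock)) ∈ (annihilation h).graph := by
  refine mem_graph_annihilation fun Ξ Υ hΥ => ?_
  rw [mem_graph_creation] at hΥ
  rw [fockProd, lp.inner_single_right, hΥ.1, inner_zero_left, inner_zero_right]

theorem fockProd_succ_mem_graph_annihilation {n : ℕ} (h : PhotonSpace)
    (g : Fin (n + 1) → PhotonSpace) :
    (fockProd g, ∑ p, inner ℂ h (g p) • fockProd fun j => g (Equiv.swap 0 p j.succ)) ∈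
      (annihilation h).graph := by
  refine mem_graph_annihilation fun Ξ Υ hΥ => ?_
  rw [mem_graph_creation] at hΥ
  rw [fockProd, lp.inner_single_right, hΥ.2, inner_symmetrizer_tensorCons_symProd, inner_sum,
    inner_sum]
  refine Finset.sum_congr rfl fun p _ => ?_
  refine (inner_smul_right (E := symmetricSubspace n) _ _ _).trans ?_
  rw [inner_smul_right, fockProd, lp.inner_single_right]

/-- Symmetrization preserves multiplication by functions of the total energy. -/
theorem symmetrizer_mem_mulGraph {n : ℕ} {F : ℝ → ℂ} {Ψ Φ : TensorPower n}
    (h : (Ψ, Φ) ∈ mulGraph (modeMeasures n) fun k => F (∑ i, ‖(k i).1‖)) :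
    ((symmetrizer n Ψ : TensorPower n), (symmetrizer n Φ : TensorPower n)) ∈
      mulGraph (modeMeasures n) fun k => F (∑ i, ‖(k i).1‖) := by
  have h1 : ∀ σ : Equiv.Perm (Fin n), (permute σ Ψ, permute σ Φ) ∈
      mulGraph (modeMeasures n) fun k => F (∑ i, ‖(k i).1‖) := fun σ => by
    change Φ =ᵐ[modeMeasures n] fun k => F (∑ i, ‖(k i).1‖) * Ψ k at h
    change permute σ Φ =ᵐ[modeMeasures n] fun k => F (∑ i, ‖(k i).1‖) * permute σ Ψ k
    filter_upwards [coeFn_permute σ Ψ, coeFn_permute σ Φ,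
      (measurePreserving_permute σ).quasiMeasurePreserving.ae h] with k h1 h2 h3
    rw [h1, h2, h3, Equiv.sum_comp σ fun i => ‖(k i).1‖]
  have h2 := Submodule.smul_mem _ (((n.factorial : ℕ) : ℂ)⁻¹)
    (Submodule.sum_mem _ fun (σ : Equiv.Perm (Fin n)) (_ : σ ∈ Finset.univ) => h1 σ)
  rw [coe_symmetrizer, coe_symmetrizer]
  convert h2 using 1
  exact Prod.ext (by simp [Prod.fst_sum]) (by simp [Prod.snd_sum])

theorem single_mem_graph_fieldEnergyFun {n : ℕ} {F : ℝ → ℂ} {ψ χ : symmetricSubspace n}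
    (h : ((ψ : TensorPower n), (χ : TensorPower n)) ∈
      mulGraph (modeMeasures n) fun k => F (∑ i, ‖(k i).1‖)) :
    (lp.single 2 n ψ, lp.single 2 n χ) ∈ (fieldEnergyFun F).graph := by
  rw [mem_graph_fieldEnergyFun]
  intro m
  by_cases hm : m = n
  · subst hm
    rw [lp.single_apply, lp.single_apply, Pi.single_eq_same, Pi.single_eq_same]
    exact h
  · rw [lp.single_apply, lp.single_apply, Pi.single_eq_of_ne hm, Pi.single_eq_of_ne hm]
    exact (mulGraph (modeMeasures m) fun k => F (∑ i, ‖(k i).1‖)).zero_mem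

theorem smul_symmetrizer_mem_graph_fieldEnergyFun {n : ℕ} {F : ℝ → ℂ} {Ψ Φ : TensorPower n} (c : ℂ)
    (h : Φ =ᵐ[modeMeasures n] fun k => F (∑ i, ‖(k i).1‖) * Ψ k) :
    (lp.single 2 n (c • symmetrizer n Ψ), lp.single 2 n (c • symmetrizer n Φ)) ∈
      (fieldEnergyFun F).graph :=
  single_mem_graph_fieldEnergyFun (Submodule.smul_mem _ c (symmetrizer_mem_mulGraph h))

theorem memLp_evolve (s : ℝ) (f : PhotonSpace) :
    MemLp (fun k : Mode => photonPhase s k.1 * f k) 2 modeMeasure := by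
  refine (Lp.memLp f).mono (((continuous_photonPhase s).comp
    continuous_fst).aestronglyMeasurable.mul (Lp.memLp f).1) (Eventually.of_forall fun k => ?_)
  rw [norm_mul]
  simp [norm_photonPhase]

/-- The one-photon evolution `e^{-i s |k|} f`. -/
def evolve (s : ℝ) (f : PhotonSpace) : PhotonSpace := (memLp_evolve s f).toLp

theorem coeFn_evolve (s : ℝ) (f : PhotonSpace) :
    evolve s f =ᵐ[modeMeasure] fun k => photonPhase s k.1 * f k :=
  (memLp_evolve s f).coeFn_toLp

theorem photonPhase_neg_mul (s : ℝ) (x : R3) : photonPhase (-s) x * photonPhase s x = 1 := by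
  rw [photonPhase, photonPhase, ← Complex.exp_add]
  simp

theorem evolve_neg_evolve (s : ℝ) (f : PhotonSpace) : evolve (-s) (evolve s f) = f := by
  refine Lp.ext ?_
  filter_upwards [coeFn_evolve (-s) (evolve s f), coeFn_evolve s f] with k h1 h2
  rw [h1, h2, ← mul_assoc, photonPhase_neg_mul, one_mul]

theorem inner_evolve (s : ℝ) (h f : PhotonSpace) :
    inner ℂ h (evolve s f) = inner ℂ (evolve (-s) h) f := by
  rw [L2.inner_def, L2.inner_def]
  refine integral_congr_ae ?_
  filter_upwards [coeFn_evolve s f, coeFn_evolve (-s) h] with k h1 h2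
  rw [h1, h2]
  simp only [RCLike.inner_apply, map_mul]
  have : (starRingEnd ℂ) (photonPhase (-s) k.1) = photonPhase s k.1 := by
    rw [photonPhase, photonPhase, ← Complex.exp_conj]
    simp
  rw [this]; ring

theorem fockProd_mem_graph_expHf {n : ℕ} (s : ℝ) (g : Fin n → PhotonSpace) :
    (fockProd g, fockProd fun i => evolve s (g i)) ∈ (expHf s).graph := by
  refine smul_symmetrizer_mem_graph_fieldEnergyFun _ ?_
  have h1 : ∀ᵐ k ∂modeMeasures n, ∀ i, evolve s (g i) (k i) = photonPhase s (k i).1 * g i (k i) :=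
    ae_all_iff.2 fun i => (Measure.quasiMeasurePreserving_eval (fun _ : Fin n => modeMeasure) i).ae
      (coeFn_evolve s (g i))
  filter_upwards [coeFn_tensorProd g, coeFn_tensorProd fun i => evolve s (g i), h1] with k h2 h3 h4
  rw [h2, h3]
  simp only [h4, Finset.prod_mul_distrib]
  congr 1
  rw [Complex.ofReal_sum, Finset.mul_sum, ← Finset.sum_neg_distrib, Complex.exp_sum]
  rfl

end FieldOperators

/-! ### The algebra of field operators -/

section FieldAlgebra

/-- The span of the product vectors `a^*(g_1) ⋯ a^*(g_n) Ω`, a common invariant domain of all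
creation and annihilation operators and of the free evolution. -/
def productSpan : Submodule ℂ Fock :=
  Submodule.span ℂ {Ψ | ∃ (n : ℕ) (g : Fin n → PhotonSpace), fockProd g = Ψ}

/-- The product vector `a^*(g_1) ⋯ a^*(g_n) Ω` as an element of `productSpan`. -/
def prodVec {n : ℕ} (g : Fin n → PhotonSpace) : productSpan :=
  ⟨fockProd g, Submodule.subset_span ⟨n, g, rfl⟩⟩

theorem productSpan_induction {p : productSpan → Prop}
    (mem : ∀ {n : ℕ} (g : Fin n → PhotonSpace), p (prodVec g))
    (zero : p 0) (add : ∀ x y, p x → p y → p (x + y)) (smul : ∀ (c : ℂ) x, p x → p (c • x))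
    (x : productSpan) : p x := by
  obtain ⟨x, hx⟩ := x
  induction hx using Submodule.span_induction with
  | mem y hy => obtain ⟨n, g, rfl⟩ := hy; exact mem g
  | zero => exact zero
  | add y z hy hz h1 h2 => exact add ⟨y, hy⟩ ⟨z, hz⟩ h1 h2
  | smul c y hy h => exact smul c ⟨y, hy⟩ h

theorem end_ext {s t : Module.End ℂ productSpan}
    (h : ∀ {n : ℕ} (g : Fin n → PhotonSpace), s (prodVec g) = t (prodVec g)) : s = t :=
  LinearMap.ext fun x => productSpan_induction (p := fun x => s x = t x) h (by simp)
    (fun x y hx hy => by rw [map_add, map_add, hx, hy])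
    (fun c x hx => by rw [map_smul, map_smul, hx]) x

/-- The operator `T` leaves `productSpan` invariant and restricts to `t` there. -/
def RestrictsTo (T : Fock →ₗ.[ℂ] Fock) (t : Module.End ℂ productSpan) : Prop :=
  ∀ x : productSpan, ((x : Fock), (t x : Fock)) ∈ T.graph

variable {S T : Fock →ₗ.[ℂ] Fock} {s t : Module.End ℂ productSpan}

theorem RestrictsTo.opMul (hS : RestrictsTo S s) (hT : RestrictsTo T t) :
    RestrictsTo (opMul S T) (s * t) := fun x => mem_graph_opMul (hT x) (hS (t x))

theorem RestrictsTo.add (hS : RestrictsTo S s) (hT : RestrictsTo T t) :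
    RestrictsTo (S + T) (s + t) := fun x => mem_graph_add (hS x) (hT x)

theorem RestrictsTo.smul (c : ℂ) (hT : RestrictsTo T t) : RestrictsTo (c • T) (c • t) :=
  fun x => mem_graph_smul c (hT x)

theorem RestrictsTo.opOne : RestrictsTo opOne 1 := fun _ => mem_graph_opOne _

theorem RestrictsTo.opPow (hT : RestrictsTo T t) (m : ℕ) : RestrictsTo (opPow T m) (t ^ m) := by
  induction m with
  | zero => rw [pow_zero]; exact RestrictsTo.opOne
  | succ m ih => rw [pow_succ']; exact hT.opMul ih

theorem RestrictsTo.opComm (hS : RestrictsTo S s) (hT : RestrictsTo T t) :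
    RestrictsTo (opComm S T) (s * t - t * s) := fun x =>
  mem_graph_sub (hS.opMul hT x) (hT.opMul hS x)

theorem RestrictsTo.opProd_ofFn {n : ℕ} {T : Fin n → Fock →ₗ.[ℂ] Fock}
    {t : Fin n → Module.End ℂ productSpan} (h : ∀ i, RestrictsTo (T i) (t i)) :
    RestrictsTo (opProd (List.ofFn T)) (List.ofFn t).prod := by
  induction n with
  | zero => rw [List.ofFn_zero, List.ofFn_zero, List.prod_nil]; exact RestrictsTo.opOne
  | succ n ih =>
    rw [List.ofFn_succ, List.ofFn_succ, List.prod_cons]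
    exact (h 0).opMul (ih fun i => h i.succ)

/-- An operator that maps product vectors into their span restricts to an endomorphism of it. -/
theorem exists_restrictsTo (T : Fock →ₗ.[ℂ] Fock)
    (h : ∀ {n : ℕ} (g : Fin n → PhotonSpace), ∃ y : productSpan, (fockProd g, (y : Fock)) ∈ T.graph) :
    ∃ t, RestrictsTo T t := by
  have key : ∀ x : productSpan, ∃ y : productSpan, ((x : Fock), (y : Fock)) ∈ T.graph := fun x =>
    productSpan_induction (p := fun x => ∃ y : productSpan, ((x : Fock), (y : Fock)) ∈ T.graph)
      h ⟨0, T.graph.zero_mem⟩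
      (fun x y ⟨a, ha⟩ ⟨b, hb⟩ => ⟨a + b, T.graph.add_mem ha hb⟩)
      (fun c x ⟨a, ha⟩ => ⟨c • a, T.graph.smul_mem c ha⟩) x
  choose t ht using key
  have huniq : ∀ {x : Fock} {y z : productSpan}, (x, (y : Fock)) ∈ T.graph →
      (x, (z : Fock)) ∈ T.graph → y = z := fun h1 h2 =>
    Subtype.ext ((opVal_eq_of_mem_graph h1).symm.trans (opVal_eq_of_mem_graph h2))
  exact ⟨{ toFun := t
           map_add' := fun x y => huniq (ht (x + y)) (T.graph.add_mem (ht x) (ht y))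
           map_smul' := fun c x => huniq (ht (c • x)) (T.graph.smul_mem c (ht x)) }, ht⟩

theorem exists_restrictsTo_creation (h : PhotonSpace) : ∃ t, RestrictsTo (creation h) t :=
  exists_restrictsTo _ fun g => ⟨prodVec (Fin.cons h g), fockProd_mem_graph_creation h g⟩

theorem exists_restrictsTo_annihilation (h : PhotonSpace) : ∃ t, RestrictsTo (annihilation h) t :=
  exists_restrictsTo _ fun {n} g => by
    cases n with
    | zero => exact ⟨0, fockProd_zero_mem_graph_annihilation h g⟩
    | succ n =>
      refine ⟨∑ p, inner ℂ h (g p) • prodVec fun j => g (Equiv.swap 0 p j.succ), ?_⟩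
      have := fockProd_succ_mem_graph_annihilation h g
      rw [Submodule.coe_sum]
      exact this

theorem exists_restrictsTo_expHf (s : ℝ) : ∃ t, RestrictsTo (expHf s) t :=
  exists_restrictsTo _ fun g => ⟨prodVec fun i => evolve s (g i), fockProd_mem_graph_expHf s g⟩

/-- `a^*(h)` on the span of the product vectors. -/
def create (h : PhotonSpace) : Module.End ℂ productSpan := (exists_restrictsTo_creation h).choose

/-- `a(h)` on the span of the product vectors. -/
def annihilate (h : PhotonSpace) : Module.End ℂ productSpan :=
  (exists_restrictsTo_annihilation h).choose

/-- `e^{-i s H_f}` on the span of the product vectors. -/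
def freeEvolve (s : ℝ) : Module.End ℂ productSpan := (exists_restrictsTo_expHf s).choose

theorem restrictsTo_create (h : PhotonSpace) : RestrictsTo (creation h) (create h) :=
  (exists_restrictsTo_creation h).choose_spec

theorem restrictsTo_annihilate (h : PhotonSpace) : RestrictsTo (annihilation h) (annihilate h) :=
  (exists_restrictsTo_annihilation h).choose_spec

theorem restrictsTo_freeEvolve (s : ℝ) : RestrictsTo (expHf s) (freeEvolve s) :=
  (exists_restrictsTo_expHf s).choose_spec

theorem RestrictsTo.apply_eq (hT : RestrictsTo T t) {x y : productSpan}
    (h : ((x : Fock), (y : Fock)) ∈ T.graph) : t x = y :=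
  Subtype.ext ((opVal_eq_of_mem_graph (hT x)).symm.trans (opVal_eq_of_mem_graph h))

theorem create_prodVec {n : ℕ} (h : PhotonSpace) (g : Fin n → PhotonSpace) :
    create h (prodVec g) = prodVec (Fin.cons h g : Fin (n + 1) → PhotonSpace) :=
  (restrictsTo_create h).apply_eq (fockProd_mem_graph_creation h g)

theorem annihilate_prodVec_zero (h : PhotonSpace) (g : Fin 0 → PhotonSpace) :
    annihilate h (prodVec g) = 0 :=
  (restrictsTo_annihilate h).apply_eq (fockProd_zero_mem_graph_annihilation h g)

theorem annihilate_prodVec_succ {n : ℕ} (h : PhotonSpace) (g : Fin (n + 1) → PhotonSpace) :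
    annihilate h (prodVec g) =
      ∑ p, inner ℂ h (g p) • prodVec fun j => g (Equiv.swap 0 p j.succ) := by
  refine (restrictsTo_annihilate h).apply_eq ?_
  have := fockProd_succ_mem_graph_annihilation h g
  rw [Submodule.coe_sum]
  exact this

theorem freeEvolve_prodVec {n : ℕ} (s : ℝ) (g : Fin n → PhotonSpace) :
    freeEvolve s (prodVec g) = prodVec fun i => evolve s (g i) :=
  (restrictsTo_freeEvolve s).apply_eq (fockProd_mem_graph_expHf s g)

theorem prodVec_comp_perm {n : ℕ} (g : Fin n → PhotonSpace) (σ : Equiv.Perm (Fin n)) :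
    prodVec (fun i => g (σ i)) = prodVec g :=
  Subtype.ext (fockProd_comp_perm g σ)

/-- The canonical commutation relation `[a(h), a^*(f)] = ⟨h, f⟩`. -/
theorem annihilate_mul_create (h f : PhotonSpace) :
    annihilate h * create f = create f * annihilate h + inner ℂ h f • 1 := by
  refine end_ext fun {n} g => ?_
  rw [Module.End.mul_apply, create_prodVec, annihilate_prodVec_succ, Fin.sum_univ_succ,
    LinearMap.add_apply, Module.End.mul_apply, add_comm]
  congr 1
  · cases n with
    | zero => rw [annihilate_prodVec_zero]; simp
    | succ n =>
      rw [annihilate_prodVec_succ, map_sum]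
      refine Finset.sum_congr rfl fun i _ => ?_
      rw [map_smul, create_prodVec, Fin.cons_succ]
      congr 1
      -- both sides replace the factor `g i` by `f`
      have e1 : (fun j : Fin (n + 1) => (Fin.cons f g : Fin (n + 2) → PhotonSpace)
          (Equiv.swap 0 i.succ j.succ)) = Function.update g i f := by
        funext j
        by_cases hj : j = i
        · subst hj; simp
        · rw [Equiv.swap_apply_of_ne_of_ne (Fin.succ_ne_zero j) (by simpa using hj),
            Fin.cons_succ, Function.update_of_ne hj]
      have e2 : (Fin.cons f (fun j : Fin n => g (Equiv.swap 0 i j.succ)) :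
          Fin (n + 1) → PhotonSpace) = fun j => Function.update g i f (Equiv.swap 0 i j) := by
        funext j
        refine Fin.cases ?_ (fun j => ?_) j
        · simp
        · rw [Fin.cons_succ, Function.update_of_ne]
          intro hj
          rw [Equiv.swap_apply_eq_iff, Equiv.swap_apply_right] at hj
          exact Fin.succ_ne_zero j hj
      rw [e1, e2, prodVec_comp_perm]

theorem create_mul_create (h f : PhotonSpace) : create h * create f = create f * create h := by
  refine end_ext fun {n} g => ?_
  rw [Module.End.mul_apply, Module.End.mul_apply, create_prodVec, create_prodVec, create_prodVec,
    create_prodVec, ← prodVec_comp_perm _ (Equiv.swap 0 1)]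
  congr 1
  funext j
  refine Fin.cases ?_ (fun j => Fin.cases ?_ (fun j => ?_) j) j
  · rw [Equiv.swap_apply_left]; rfl
  · have : (Fin.succ (0 : Fin (n + 1))) = 1 := rfl
    rw [this, Equiv.swap_apply_right]; rfl
  · have : j.succ.succ ≠ (1 : Fin (n + 2)) := by
      intro h
      have := congrArg Fin.val h
      simp at this
    rw [Equiv.swap_apply_of_ne_of_ne (Fin.succ_ne_zero _) this]
    rfl

theorem freeEvolve_conj_create (s : ℝ) (h : PhotonSpace) :
    freeEvolve (-s) * (create h * freeEvolve s) = create (evolve (-s) h) := by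
  refine end_ext fun {n} g => ?_
  rw [Module.End.mul_apply, Module.End.mul_apply, freeEvolve_prodVec, create_prodVec,
    freeEvolve_prodVec, create_prodVec]
  congr 1
  funext j
  refine Fin.cases ?_ (fun j => ?_) j
  · simp
  · simp [evolve_neg_evolve]

theorem freeEvolve_conj_annihilate (s : ℝ) (h : PhotonSpace) :
    freeEvolve (-s) * (annihilate h * freeEvolve s) = annihilate (evolve (-s) h) := by
  refine end_ext fun {n} g => ?_
  rw [Module.End.mul_apply, Module.End.mul_apply, freeEvolve_prodVec]
  cases n with
  | zero => rw [annihilate_prodVec_zero, annihilate_prodVec_zero, map_zero]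
  | succ n =>
    rw [annihilate_prodVec_succ, annihilate_prodVec_succ, map_sum]
    refine Finset.sum_congr rfl fun p _ => ?_
    rw [map_smul, freeEvolve_prodVec, inner_evolve]
    simp only [evolve_neg_evolve]

/-- `A_j(0, s) = a(G_s) + a^*(G_s)` with `G_s = e^{i s |k|} G_{0,j}`. -/
theorem restrictsTo_vectorPotentialAt (κ : 𝓢(R3, ℂ)) (ε : Polarization) (j : Fin 3) (s : ℝ) :
    RestrictsTo (vectorPotentialAt κ ε j s)
      (annihilate (evolve (-s) (coupling κ ε j)) + create (evolve (-s) (coupling κ ε j))) := by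
  rw [← freeEvolve_conj_annihilate, ← freeEvolve_conj_create, ← mul_add, ← add_mul]
  exact (restrictsTo_freeEvolve (-s)).opMul
    (((restrictsTo_annihilate _).add (restrictsTo_create _)).opMul (restrictsTo_freeEvolve s))

end FieldAlgebra

/-! ### Occupation number vectors -/

section Occupation

/-- The vacuum as an element of `productSpan`. -/
def vac : productSpan := prodVec (Fin.elim0 : Fin 0 → PhotonSpace)

theorem coe_vac : (vac : Fock) = vacuum := fockProd_zero _

theorem annihilate_vac (h : PhotonSpace) : annihilate h vac = 0 := annihilate_prodVec_zero h _

/-- The normalized power `(m!)^{-1/2} a^*(f)^m`. -/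
def createPow (f : PhotonSpace) (m : ℕ) : Module.End ℂ productSpan :=
  (((Real.sqrt (m.factorial : ℝ) : ℝ) : ℂ)⁻¹) • create f ^ m

theorem annihilate_mul_create_pow (h f : PhotonSpace) (m : ℕ) :
    annihilate h * create f ^ m =
      create f ^ m * annihilate h + ((m : ℂ) * inner ℂ h f) • create f ^ (m - 1) := by
  induction m with
  | zero => simp
  | succ m ih =>
    rw [pow_succ', ← mul_assoc, annihilate_mul_create, add_mul, mul_assoc, ih, mul_add, ← mul_assoc,
      smul_mul_assoc, one_mul, add_assoc, mul_smul_comm]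
    congr 1
    cases m with
    | zero => simp
    | succ m =>
      rw [Nat.add_sub_cancel, Nat.add_sub_cancel, ← pow_succ', ← add_smul]
      congr 1
      push_cast
      ring

theorem sqrt_factorial_succ (m : ℕ) : ((Real.sqrt ((m + 1).factorial : ℝ) : ℝ) : ℂ) =
    ((Real.sqrt ((m + 1 : ℕ) : ℝ) : ℝ) : ℂ) * ((Real.sqrt (m.factorial : ℝ) : ℝ) : ℂ) := by
  rw [← Complex.ofReal_mul, ← Real.sqrt_mul (by positivity), Nat.factorial_succ, Nat.cast_mul]

theorem sqrt_natCast_mul_self (m : ℕ) :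
    ((Real.sqrt (m : ℝ) : ℝ) : ℂ) * ((Real.sqrt (m : ℝ) : ℝ) : ℂ) = m := by
  rw [← Complex.ofReal_mul, Real.mul_self_sqrt (by positivity), Complex.ofReal_natCast]

theorem sqrt_ne_zero' {x : ℝ} (hx : 0 < x) : ((Real.sqrt x : ℝ) : ℂ) ≠ 0 := by
  rw [Ne, Complex.ofReal_eq_zero, Real.sqrt_eq_zero']; exact not_le.2 hx

theorem annihilate_mul_createPow (h f : PhotonSpace) (m : ℕ) :
    annihilate h * createPow f m = createPow f m * annihilate h +
      (((Real.sqrt (m : ℝ) : ℝ) : ℂ) * inner ℂ h f) • createPow f (m - 1) := by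
  rw [createPow, mul_smul_comm, annihilate_mul_create_pow, smul_add, smul_mul_assoc]
  congr 1
  cases m with
  | zero => simp
  | succ m =>
    rw [Nat.add_sub_cancel, createPow, smul_smul, smul_smul, sqrt_factorial_succ]
    congr 1
    have h1 : ((Real.sqrt ((m + 1 : ℕ) : ℝ) : ℝ) : ℂ) ≠ 0 := sqrt_ne_zero' (by positivity)
    have h2 := sqrt_natCast_mul_self (m + 1)
    rw [← h2]
    field_simp

theorem create_mul_createPow (f : PhotonSpace) (m : ℕ) :
    create f * createPow f m = ((Real.sqrt ((m + 1 : ℕ) : ℝ) : ℝ) : ℂ) • createPow f (m + 1) := by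
  rw [createPow, createPow, mul_smul_comm, smul_smul, pow_succ', sqrt_factorial_succ]
  congr 1
  have h1 : ((Real.sqrt ((m + 1 : ℕ) : ℝ) : ℝ) : ℂ) ≠ 0 := sqrt_ne_zero' (by positivity)
  rw [mul_inv, mul_inv_cancel_left₀ h1]

theorem commute_create_createPow (h f : PhotonSpace) (m : ℕ) :
    Commute (create h) (createPow f m) :=
  (Commute.pow_right (create_mul_create h f) m).smul_right _

/-- `a^*(f) = ∏_k (m_k!)^{-1/2} a^*(f_k)^{m_k}` on the span of the product vectors. -/
def occOp {n : ℕ} (f : Fin n → PhotonSpace) (m : Fin n → ℕ) : Module.End ℂ productSpan :=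
  (List.ofFn fun k => createPow (f k) (m k)).prod

theorem restrictsTo_creationOcc {n : ℕ} (f : Fin n → PhotonSpace) (m : Fin n → ℕ) :
    RestrictsTo (creationOcc f m) (occOp f m) :=
  RestrictsTo.opProd_ofFn fun k => ((restrictsTo_create (f k)).opPow (m k)).smul _

theorem occOp_succ {n : ℕ} (f : Fin (n + 1) → PhotonSpace) (m : Fin (n + 1) → ℕ) :
    occOp f m = createPow (f 0) (m 0) * occOp (Fin.tail f) (Fin.tail m) := by
  rw [occOp, List.ofFn_succ, List.prod_cons]
  rfl

theorem commute_create_occOp {n : ℕ} (h : PhotonSpace) (f : Fin n → PhotonSpace)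
    (m : Fin n → ℕ) : Commute (create h) (occOp f m) := by
  induction n with
  | zero => rw [occOp, List.ofFn_zero, List.prod_nil]; exact Commute.one_right _
  | succ n ih =>
    rw [occOp_succ]
    exact (commute_create_createPow h _ _).mul_right (ih _ _)

/-- Lowering the `l`-th occupation number; an occupation number `0` is kept. -/
def lower {n : ℕ} (m : Fin n → ℕ) (l : Fin n) : Fin n → ℕ := Function.update m l (m l - 1)

/-- `[a(h), a^*(f)] = ∑_l √m_l ⟨h, f_l⟩ a^*(f)` with `m_l` lowered by one. If `m_l = 0`, the factor
`√m_l` removes the term. -/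
theorem annihilate_mul_occOp {n : ℕ} (h : PhotonSpace) (f : Fin n → PhotonSpace)
    (m : Fin n → ℕ) :
    annihilate h * occOp f m = occOp f m * annihilate h +
      ∑ l, (((Real.sqrt (m l : ℝ) : ℝ) : ℂ) * inner ℂ h (f l)) • occOp f (lower m l) := by
  induction n with
  | zero => simp [occOp]
  | succ n ih =>
    rw [Fin.sum_univ_succ]
    simp only [occOp_succ]
    have h0 : Fin.tail (lower m 0) = Fin.tail m := Fin.tail_update_zero _ _
    have h1 : ∀ l : Fin n, Fin.tail (lower m l.succ) = lower (Fin.tail m) l := fun l =>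
      Fin.tail_update_succ _ _ _
    have h2 : ∀ l : Fin n, lower m l.succ 0 = m 0 := fun l =>
      Function.update_of_ne (Fin.succ_ne_zero l).symm _ _
    have h3 : lower m 0 0 = m 0 - 1 := Function.update_self _ _ _
    simp only [h0, h1, h2, h3]
    rw [← mul_assoc, annihilate_mul_createPow, add_mul, mul_assoc, ih, mul_add, ← mul_assoc,
      Finset.mul_sum, smul_mul_assoc]
    simp only [mul_smul_comm, Fin.tail]
    abel

theorem create_mul_occOp {n : ℕ} (f : Fin n → PhotonSpace) (m : Fin n → ℕ) (l : Fin n)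
    (hl : m l ≠ 0) :
    create (f l) * occOp f (lower m l) = ((Real.sqrt (m l : ℝ) : ℝ) : ℂ) • occOp f m := by
  induction n with
  | zero => exact l.elim0
  | succ n ih =>
    rw [occOp_succ, occOp_succ f m]
    refine Fin.cases (fun h => ?_) (fun l h => ?_) l hl
    · rw [← mul_assoc, show Fin.tail (lower m 0) = Fin.tail m from Fin.tail_update_zero _ _,
        show lower m 0 0 = m 0 - 1 from Function.update_self _ _ _, create_mul_createPow,
        Nat.sub_add_cancel (Nat.one_le_iff_ne_zero.2 h), smul_mul_assoc]
    · rw [show Fin.tail (lower m l.succ) = lower (Fin.tail m) l from Fin.tail_update_succ _ _ _,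
        show lower m l.succ 0 = m 0 from Function.update_of_ne (Fin.succ_ne_zero l).symm _ _,
        ← mul_assoc, (commute_create_createPow _ _ _).eq, mul_assoc]
      have := ih (Fin.tail f) (Fin.tail m) l h
      rw [show Fin.tail f l = f l.succ from rfl] at this
      rw [this, mul_smul_comm]
      rfl

/-- The occupation number vector `a^*(f) Ω`. -/
def occVec {n : ℕ} (f : Fin n → PhotonSpace) (m : Fin n → ℕ) : productSpan := occOp f m vac

theorem annihilate_occVec {n : ℕ} (h : PhotonSpace) (f : Fin n → PhotonSpace) (m : Fin n → ℕ) :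
    annihilate h (occVec f m) =
      ∑ l, (((Real.sqrt (m l : ℝ) : ℝ) : ℂ) * inner ℂ h (f l)) • occVec f (lower m l) := by
  have := congrArg (fun t : Module.End ℂ productSpan => t vac) (annihilate_mul_occOp h f m)
  simpa [annihilate_vac, LinearMap.sum_apply, occVec] using this

theorem inner_create (h : PhotonSpace) (x y : productSpan) :
    inner ℂ (create h x : Fock) (y : Fock) = inner ℂ (x : Fock) (annihilate h y : Fock) :=
  inner_creation_eq_inner_annihilation (restrictsTo_create h x) (restrictsTo_annihilate h y)

theorem norm_vacuum : ‖vacuum‖ = 1 := by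
  have h1 : ‖vacuum‖ = ‖oneZero‖ := by
    have h : ‖(lp.single 2 0 ⟨oneZero, oneZero_mem⟩ : Fock)‖ = ‖oneZero‖ :=
      lp.norm_single (by norm_num) 0 _
    exact h
  rw [h1, oneZero, norm_indicatorConstLp (by norm_num) (by norm_num)]
  simp [modeMeasures, Measure.real]

/-- The occupation number vectors of an orthonormal family are orthonormal; the proof is an
induction on the number of photons of the left vector. -/
theorem inner_occVec {n : ℕ} {f : Fin n → PhotonSpace} (hf : Orthonormal ℂ f) (m m' : Fin n → ℕ) :
    inner ℂ (occVec f m : Fock) (occVec f m' : Fock) = if m = m' then 1 else 0 := by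
  have hann : ∀ (l : Fin n) (m : Fin n → ℕ), annihilate (f l) (occVec f m) =
      ((Real.sqrt (m l : ℝ) : ℝ) : ℂ) • occVec f (lower m l) := fun l m => by
    rw [annihilate_occVec, Finset.sum_eq_single l]
    · rw [orthonormal_iff_ite.1 hf]; simp
    · intro k _ hk
      rw [orthonormal_iff_ite.1 hf, if_neg hk.symm]; simp
    · simp
  have hcre : ∀ (l : Fin n) (m : Fin n → ℕ), m l ≠ 0 →
      ((Real.sqrt (m l : ℝ) : ℝ) : ℂ) • occVec f m = create (f l) (occVec f (lower m l)) :=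
    fun l m h => by
      have := congrArg (fun t : Module.End ℂ productSpan => t vac) (create_mul_occOp f m l h)
      exact this.symm
  -- raise on one side, lower on the other
  have step : ∀ (l : Fin n) (m m' : Fin n → ℕ), m l ≠ 0 →
      ((Real.sqrt (m l : ℝ) : ℝ) : ℂ) * inner ℂ (occVec f m : Fock) (occVec f m' : Fock) =
      ((Real.sqrt (m' l : ℝ) : ℝ) : ℂ) *
        inner ℂ (occVec f (lower m l) : Fock) (occVec f (lower m' l) : Fock) := fun l m m' h => by
    have h1 := inner_create (f l) (occVec f (lower m l)) (occVec f m')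
    rw [← hcre l m h, hann, Submodule.coe_smul, Submodule.coe_smul, inner_smul_left,
      inner_smul_right, Complex.conj_ofReal] at h1
    exact h1
  induction hN : ∑ l, m l using Nat.strong_induction_on generalizing m m' with
  | _ N ih =>
  by_cases hm : ∃ l, m l ≠ 0
  · obtain ⟨l, hl⟩ := hm
    have hne : ((Real.sqrt (m l : ℝ) : ℝ) : ℂ) ≠ 0 :=
      sqrt_ne_zero' (by exact_mod_cast Nat.pos_of_ne_zero hl)
    have h1 := step l m m' hl
    refine mul_left_cancel₀ hne (h1.trans ?_)
    by_cases hl' : m' l = 0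
    · have : m ≠ m' := fun h => hl (by rw [h, hl'])
      rw [if_neg this, hl']; simp
    · have hlt : ∑ k, lower m l k < N := by
        rw [← hN]
        refine Finset.sum_lt_sum (fun k _ => ?_) ⟨l, Finset.mem_univ l, ?_⟩
        · by_cases hk : k = l
          · subst hk; simp [lower]
          · simp [lower, hk]
        · simp only [lower, Function.update_self]; omega
      rw [ih _ hlt (lower m l) (lower m' l) rfl]
      by_cases hmm : m = m'
      · subst hmm; simp
      · have : lower m l ≠ lower m' l := fun h => hmm (by
          funext k
          have hk := congrFun h k
          by_cases hkl : k = l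
          · subst hkl
            simp only [lower, Function.update_self] at hk
            omega
          · simpa [lower, hkl] using hk)
        rw [if_neg hmm, if_neg this, mul_zero, mul_zero]
  · push Not at hm
    have hm0 : m = 0 := funext hm
    subst hm0
    have hv : occVec f 0 = vac := by
      have : occOp f 0 = 1 := by
        rw [occOp]
        refine List.prod_eq_one fun x hx => ?_
        rw [List.mem_ofFn] at hx
        obtain ⟨k, rfl⟩ := hx
        simp [createPow]
      rw [occVec, this]; rfl
    by_cases hm' : ∃ l, m' l ≠ 0
    · obtain ⟨l, hl⟩ := hm'
      have hne : ((Real.sqrt (m' l : ℝ) : ℝ) : ℂ) ≠ 0 :=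
        sqrt_ne_zero' (by exact_mod_cast Nat.pos_of_ne_zero hl)
      have h1 := inner_create (f l) (occVec f (lower m' l)) vac
      rw [← hcre l m' hl, annihilate_vac, Submodule.coe_zero, inner_zero_right, Submodule.coe_smul,
        inner_smul_left, Complex.conj_ofReal] at h1
      have h2 := (mul_eq_zero.1 h1).resolve_left hne
      have : (0 : Fin n → ℕ) ≠ m' := fun h => hl (by rw [← h]; rfl)
      rw [if_neg this, hv, ← inner_conj_symm, h2, map_zero]
    · push Not at hm'
      have hm0' : m' = 0 := funext hm'
      rw [hm0', if_pos rfl, hv, coe_vac, inner_self_eq_norm_sq_to_K, norm_vacuum]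
      simp

/-- `[A_j(0, s), a^*(f)] Ω = ∑_l √m_l ⟨G_s, f_l⟩ a^*(f) Ω` with `m_l` lowered by one. -/
theorem vacuum_mem_graph_opComm (κ : 𝓢(R3, ℂ)) (ε : Polarization) (j : Fin 3) (s : ℝ) {n : ℕ}
    (f : Fin n → PhotonSpace) (m : Fin n → ℕ) :
    (vacuum, ∑ l, (((Real.sqrt (m l : ℝ) : ℝ) : ℂ) * inner ℂ (evolve (-s) (coupling κ ε j)) (f l)) •
      (occVec f (lower m l) : Fock)) ∈
      (opComm (vectorPotentialAt κ ε j s) (creationOcc f m)).graph := by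
  have h := (restrictsTo_vectorPotentialAt κ ε j s).opComm (restrictsTo_creationOcc f m) vac
  rw [coe_vac] at h
  set G := evolve (-s) (coupling κ ε j)
  have e : ((annihilate G + create G) * occOp f m - occOp f m * (annihilate G + create G)) vac =
      ∑ l, (((Real.sqrt (m l : ℝ) : ℝ) : ℂ) * inner ℂ G (f l)) • occVec f (lower m l) := by
    have h1 : (annihilate G + create G) * occOp f m - occOp f m * (annihilate G + create G) =
        ∑ l, (((Real.sqrt (m l : ℝ) : ℝ) : ℂ) * inner ℂ G (f l)) • occOp f (lower m l) := by
      rw [add_mul, annihilate_mul_occOp, mul_add, (commute_create_occOp G f m).eq]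
      abel
    rw [h1, LinearMap.sum_apply]
    rfl
  rw [e, Submodule.coe_sum] at h
  exact h

end Occupation

/-! ### One-photon matrix elements of the field -/

section OnePhoton

theorem inner_vacuum_fockProd_succ {n : ℕ} (g : Fin (n + 1) → PhotonSpace) :
    inner ℂ vacuum (fockProd g) = 0 := by
  rw [vacuum, lp.inner_single_left, fockProd, lp.single_apply, Pi.single_eq_of_ne (by omega)]
  exact inner_zero_right _

theorem vacuum_mem_graph_creation (f : PhotonSpace) :
    (vacuum, fockProd ![f]) ∈ (creation f).graph := by
  have := fockProd_mem_graph_creation f (Fin.elim0 : Fin 0 → PhotonSpace)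
  rw [fockProd_zero] at this
  convert this using 3
  ext i
  fin_cases i
  rfl

theorem fockProd_one_mem_graph_vectorPotentialAt (κ : 𝓢(R3, ℂ)) (ε : Polarization) (j : Fin 3)
    (s : ℝ) (f : PhotonSpace) :
    (fockProd ![f], inner ℂ (evolve (-s) (coupling κ ε j)) f • vacuum +
      fockProd ![evolve (-s) (coupling κ ε j), f]) ∈ (vectorPotentialAt κ ε j s).graph := by
  have h := restrictsTo_vectorPotentialAt κ ε j s (prodVec ![f])
  rw [LinearMap.add_apply, create_prodVec, annihilate_prodVec_succ, Fin.sum_univ_one,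
    Submodule.coe_add, Submodule.coe_smul] at h
  change (fockProd ![f], _ • fockProd _ + fockProd _) ∈ _ at h
  rw [fockProd_zero] at h
  exact h

theorem ae_modeMeasure_eval {n : ℕ} (i : Fin n) {p : Mode → Prop} (h : ∀ᵐ k ∂modeMeasure, p k) :
    ∀ᵐ k ∂modeMeasures n, p (k i) :=
  (Measure.quasiMeasurePreserving_eval (fun _ : Fin n => modeMeasure) i).ae h

theorem vacuum_mem_graph_Hf : (vacuum, (0 : Fock)) ∈ Hf.graph := by
  have h := smul_symmetrizer_mem_graph_fieldEnergyFun (n := 0) (F := fun x => (x : ℂ))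
    (Ψ := oneZero) (Φ := 0) 1 (by
      filter_upwards [Lp.coeFn_zero ℂ 2 (modeMeasures 0)] with k hk
      rw [hk]; simp)
  rw [map_zero, smul_zero, lp.single_zero, one_smul] at h
  have e : symmetrizer 0 oneZero = ⟨oneZero, oneZero_mem⟩ := by
    refine Subtype.ext ?_
    rw [symmetrizer, Submodule.coe_orthogonalProjectionOnto_apply]
    exact Submodule.starProjection_eq_self_iff.2 oneZero_mem
  rw [e] at h
  exact h

theorem fockProd_one_mem_graph_Hf {f ωf : PhotonSpace}
    (h : ωf =ᵐ[modeMeasure] fun k => ((‖k.1‖ : ℝ) : ℂ) * f k) :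
    (fockProd ![f], fockProd ![ωf]) ∈ Hf.graph := by
  refine smul_symmetrizer_mem_graph_fieldEnergyFun _ ?_
  filter_upwards [coeFn_tensorProd ![f], coeFn_tensorProd ![ωf], ae_modeMeasure_eval 0 h]
    with k h1 h2 h3
  rw [h1, h2]
  simpa using h3

theorem fockProd_two_mem_graph_Hf {f ωf g ωg : PhotonSpace}
    (hf : ωf =ᵐ[modeMeasure] fun k => ((‖k.1‖ : ℝ) : ℂ) * f k)
    (hg : ωg =ᵐ[modeMeasure] fun k => ((‖k.1‖ : ℝ) : ℂ) * g k) :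
    (fockProd ![f, g], fockProd ![ωf, g] + fockProd ![f, ωg]) ∈ Hf.graph := by
  have h := smul_symmetrizer_mem_graph_fieldEnergyFun (n := 2) (F := fun x => (x : ℂ))
    (Ψ := tensorProd ![f, g]) (Φ := tensorProd ![ωf, g] + tensorProd ![f, ωg])
    ((Real.sqrt (Nat.factorial 2 : ℝ) : ℝ) : ℂ) (by
      filter_upwards [coeFn_tensorProd ![f, g], coeFn_tensorProd ![ωf, g],
        coeFn_tensorProd ![f, ωg], ae_modeMeasure_eval 0 hf, ae_modeMeasure_eval 1 hg,
        Lp.coeFn_add (tensorProd ![ωf, g]) (tensorProd ![f, ωg])] with k h1 h2 h3 h4 h5 h6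
      rw [h6, Pi.add_apply, h1, h2, h3]
      simp only [Fin.prod_univ_two, Fin.sum_univ_two, Matrix.cons_val_zero, Matrix.cons_val_one,
        h4, h5, Complex.ofReal_add]
      ring)
  rw [map_add, smul_add, lp.single_add] at h
  exact h

/-- The one-photon matrix element of the field `A_j(0, s)`. -/
theorem vacuum_mem_graph_vectorPotentialAt_mul_creation (κ : 𝓢(R3, ℂ)) (ε : Polarization)
    (j : Fin 3) (s : ℝ) (f : PhotonSpace) :
    ∃ Φ, (vacuum, Φ) ∈ (opMul (vectorPotentialAt κ ε j s) (creation f)).graph ∧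
      inner ℂ vacuum Φ = inner ℂ (coupling κ ε j) (evolve s f) := by
  refine ⟨_, mem_graph_opMul (vacuum_mem_graph_creation f)
    (fockProd_one_mem_graph_vectorPotentialAt κ ε j s f), ?_⟩
  rw [inner_add_right, inner_smul_right, inner_vacuum_fockProd_succ, inner_self_eq_norm_sq_to_K,
    norm_vacuum, inner_evolve]
  simp

/-- The one-photon matrix element of the electric field: as the vacuum has energy zero,
`⟨Ω, -i [H_f, A] a^*(f) Ω⟩ = i ⟨Ω, A a^*(|k| f) Ω⟩`. -/
theorem vacuum_mem_graph_electricFieldAt_mul_creation {κ : 𝓢(R3, ℂ)} {ε : Polarization}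
    {j : Fin 3} (s : ℝ) {f ωf : PhotonSpace}
    (hG : MemLp (fun k : Mode => ((‖k.1‖ : ℝ) : ℂ) * coupling κ ε j k) 2 modeMeasure)
    (hf : ωf =ᵐ[modeMeasure] fun k => ((‖k.1‖ : ℝ) : ℂ) * f k) :
    ∃ Φ, (vacuum, Φ) ∈ (opMul (electricFieldAt κ ε j s) (creation f)).graph ∧
      inner ℂ vacuum Φ = Complex.I * inner ℂ (coupling κ ε j) (evolve s ωf) := by
  let G := coupling κ ε j
  have hωG : evolve (-s) hG.toLp =ᵐ[modeMeasure]
      fun k => ((‖k.1‖ : ℝ) : ℂ) * evolve (-s) G k := by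
    filter_upwards [coeFn_evolve (-s) hG.toLp, coeFn_evolve (-s) G, hG.coeFn_toLp] with k h1 h2 h3
    rw [h1, h2, h3]; ring
  have h1 := fockProd_one_mem_graph_vectorPotentialAt κ ε j s f
  have h2 := Hf.graph.add_mem (Hf.graph.smul_mem (inner ℂ (evolve (-s) G) f) vacuum_mem_graph_Hf)
    (fockProd_two_mem_graph_Hf hωG hf)
  have h3 := fockProd_one_mem_graph_Hf hf
  have h4 := fockProd_one_mem_graph_vectorPotentialAt κ ε j s ωf
  refine ⟨_, mem_graph_opMul (vacuum_mem_graph_creation f)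
    (mem_graph_smul (-Complex.I) (mem_graph_opComm h1 h2 h3 h4)), ?_⟩
  simp only [inner_smul_right, inner_sub_right, inner_add_right, inner_vacuum_fockProd_succ]
  rw [inner_self_eq_norm_sq_to_K, norm_vacuum, inner_evolve]
  simp

theorem memLp_norm_mul_coupling (κ : 𝓢(R3, ℂ)) (ε : Polarization) (j : Fin 3) :
    MemLp (fun k : Mode => ((‖k.1‖ : ℝ) : ℂ) * coupling κ ε j k) 2 modeMeasure := by
  have hw : Function.HasTemperateGrowth (fun k : R3 => ((1 + ‖k‖ ^ 2 : ℝ) : ℂ)) := by fun_prop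
  refine (memLp_couplingFun (SchwartzMap.smulLeftCLM ℂ (fun k : R3 => ((1 + ‖k‖ ^ 2 : ℝ) : ℂ)) κ)
    ε j).mono ((Continuous.aestronglyMeasurable (by fun_prop)).mul (Lp.memLp _).1) ?_
  filter_upwards [(memLp_couplingFun κ ε j).coeFn_toLp] with k hk
  rw [coupling, hk, couplingFun, couplingFun, SchwartzMap.smulLeftCLM_apply_apply hw]
  simp only [norm_mul, norm_div, smul_eq_mul, Complex.norm_real, norm_norm]
  rw [mul_div_assoc, mul_assoc, ← mul_assoc]
  have h1 : ‖k.1‖ ≤ ‖1 + ‖k.1‖ ^ 2‖ := by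
    rw [Real.norm_of_nonneg (by positivity)]
    nlinarith [sq_nonneg (‖k.1‖ - 1)]
  calc _ = ‖k.1‖ * (‖κ k.1‖ / ‖Real.sqrt (2 * ‖k.1‖)‖ * ‖ε.vec k.1 k.2 j‖) := by ring
    _ ≤ ‖1 + ‖k.1‖ ^ 2‖ * (‖κ k.1‖ / ‖Real.sqrt (2 * ‖k.1‖)‖ * ‖ε.vec k.1 k.2 j‖) := by gcongr
    _ = _ := by ring

theorem ae_modeMeasure_iff {p : Mode → Prop} (h : ∀ᵐ k : R3, ∀ l : Fin 2, p (k, l)) :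
    ∀ᵐ k ∂modeMeasure, p k := by
  have h1 := (Measure.quasiMeasurePreserving_fst
    (μ := (volume : Measure R3)) (ν := (Measure.count : Measure (Fin 2)))).ae h
  exact h1.mono fun k hk => hk k.2

/-- If the transverse vector field `∑_λ ε f` has compact support, so does `f`, because the
polarization vectors are orthonormal. Hence `|k| f ∈ L²`. -/
theorem memLp_norm_mul_photon {ε : Polarization} {f : PhotonSpace}
    {g : R3 → EuclideanSpace ℂ (Fin 3)} (hg : HasCompactSupport g)
    (hfg : ∀ᵐ k : R3, ∀ j : Fin 3, g k j = ∑ l : Fin 2, ((ε.vec k l j : ℝ) : ℂ) * f (k, l)) :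
    MemLp (fun k : Mode => ((‖k.1‖ : ℝ) : ℂ) * f k) 2 modeMeasure := by
  obtain ⟨R, hR⟩ := hg.isCompact.isBounded.subset_closedBall (0 : R3)
  have hne : ∀ᵐ x : R3, x ≠ 0 := by simp [ae_iff]
  have key : ∀ᵐ k ∂modeMeasure, R < ‖k.1‖ → f k = 0 := by
    refine ae_modeMeasure_iff ?_
    filter_upwards [hfg, hne] with k hk hk0 l hkR
    have hgk : g k = 0 := by
      refine image_eq_zero_of_notMem_tsupport fun h => ?_
      have := hR h
      rw [mem_closedBall_zero_iff] at this
      exact absurd hkR (not_lt.2 this)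
    have horth := orthonormal_iff_ite.1 (ε.orthonormal_vec k hk0) l
    have h0 : ∀ j, (0 : ℂ) = ∑ l : Fin 2, ((ε.vec k l j : ℝ) : ℂ) * f (k, l) := fun j => by
      rw [← hk j, hgk]; rfl
    have h1 : ∑ j, ((ε.vec k l j : ℝ) : ℂ) * ∑ l' : Fin 2, ((ε.vec k l' j : ℝ) : ℂ) * f (k, l') =
        f (k, l) := by
      simp_rw [Finset.mul_sum]
      rw [Finset.sum_comm]
      have h2 : ∀ l' : Fin 2, ∑ j, ((ε.vec k l j : ℝ) : ℂ) * (((ε.vec k l' j : ℝ) : ℂ) * f (k, l')) =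
          (if l = l' then 1 else 0) * f (k, l') := fun l' => by
        have h3 := horth l'
        rw [PiLp.inner_apply] at h3
        simp only [RCLike.inner_apply, conj_trivial] at h3
        have h4 := congrArg (fun x : ℝ => (x : ℂ)) h3
        simp only [Complex.ofReal_sum, Complex.ofReal_mul] at h4
        rw [apply_ite (fun x : ℝ => (x : ℂ)), Complex.ofReal_one, Complex.ofReal_zero] at h4
        rw [← h4, Finset.sum_mul]
        exact Finset.sum_congr rfl fun j _ => by ring
      simp only [h2]
      simp
    rw [← h1]
    exact Finset.sum_eq_zero fun j _ => by rw [← h0 j, mul_zero]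
  refine (Lp.memLp f).of_le_mul (c := R)
    ((Continuous.aestronglyMeasurable (by fun_prop)).mul (Lp.memLp f).1) ?_
  filter_upwards [key] with k hk
  rw [norm_mul, Complex.norm_real, norm_norm]
  by_cases hkR : R < ‖k.1‖
  · rw [hk hkR]; simp
  · gcongr
    exact not_lt.1 hkR

/-- The coefficient `\bar κ(k) (2|k|)^{-1/2}` of the transverse vector field of a photon in its
matrix elements. -/
def formFactor (κ : 𝓢(R3, ℂ)) (k : R3) : ℂ :=
  (starRingEnd ℂ) (κ k) / ((Real.sqrt (2 * ‖k‖) : ℝ) : ℂ)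

/-- Matrix elements of the evolved field as amplitudes. -/
theorem inner_coupling_evolve (κ : 𝓢(R3, ℂ)) (ε : Polarization) (j : Fin 3) (s : ℝ)
    {f : PhotonSpace} {g : R3 → ℂ}
    (hfg : ∀ᵐ k : R3, g k = ∑ l : Fin 2, ((ε.vec k l j : ℝ) : ℂ) * f (k, l)) :
    inner ℂ (coupling κ ε j) (evolve s f) = amplitude (fun k => formFactor κ k * g k) s := by
  have hi := L2.integrable_inner (𝕜 := ℂ) (coupling κ ε j) (evolve s f)
  have he : (fun k => inner ℂ (coupling κ ε j k) (evolve s f k)) =ᵐ[modeMeasure] fun k =>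
      photonPhase s k.1 * (formFactor κ k.1 * (((ε.vec k.1 k.2 j : ℝ) : ℂ) * f k)) := by
    filter_upwards [(memLp_couplingFun κ ε j).coeFn_toLp, coeFn_evolve s f] with k h1 h2
    rw [coupling, h1, h2]
    simp only [RCLike.inner_apply, couplingFun, formFactor, map_mul, map_div₀, Complex.conj_ofReal]
    ring
  rw [L2.inner_def, integral_congr_ae he]
  have hi' := hi.congr he
  refine (integral_prod (μ := (volume : Measure R3)) (ν := (Measure.count : Measure (Fin 2)))
    _ hi').trans (integral_congr_ae ?_)
  filter_upwards [hfg] with k hk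
  rw [hk, integral_count]
  simp only [Finset.mul_sum]

theorem contDiffAt_formFactor (κ : 𝓢(R3, ℂ)) {n : ℕ} {k : R3} (hk : k ≠ 0) :
    ContDiffAt ℝ n (formFactor κ) k := by
  have h1 : ContDiffAt ℝ n (fun k => (starRingEnd ℂ) (κ k)) k :=
    (Complex.conjCLE.contDiff.comp (κ.smooth n)).contDiffAt
  have hk' : 2 * ‖k‖ ≠ 0 := by simpa using hk
  have h2 : ContDiffAt ℝ n (fun k : R3 => Real.sqrt (2 * ‖k‖)) k :=
    (contDiffAt_const.mul (contDiffAt_norm ℝ hk)).sqrt hk'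
  have h3 : ContDiffAt ℝ n (fun k : R3 => ((Real.sqrt (2 * ‖k‖) : ℝ) : ℂ)) k :=
    Complex.ofRealCLM.contDiff.contDiffAt.comp k h2
  have h4 := h1.mul (h3.inv ?_)
  · exact h4.congr_of_eventuallyEq (Eventually.of_forall fun x => div_eq_mul_inv _ _)
  rw [Ne, Complex.ofReal_eq_zero, Real.sqrt_eq_zero']
  have : 0 < ‖k‖ := norm_pos_iff.2 hk
  linarith

/-- For a regular photon the matrix elements of `A_j(0, s)` and `E_j(0, s)` are
`a_h(s)` and `i a_{|k| h}(s)` with `h ∈ C_0^2(ℝ³ ∖ {0})`. -/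
theorem IsRegularPhoton.exists_amplitude {ε : Polarization} {f : PhotonSpace}
    (hf : IsRegularPhoton ε f) (κ : 𝓢(R3, ℂ)) :
    ∃ h : Fin 3 → R3 → ℂ, (∀ j, IsAway 2 (h j)) ∧ ∀ j s,
      inner ℂ (coupling κ ε j) (evolve s f) = amplitude (h j) s ∧
      (∃ Φ, (vacuum, Φ) ∈ (opMul (vectorPotentialAt κ ε j s) (creation f)).graph ∧
        inner ℂ vacuum Φ = amplitude (h j) s) ∧
      (∃ Φ, (vacuum, Φ) ∈ (opMul (electricFieldAt κ ε j s) (creation f)).graph ∧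
        inner ℂ vacuum Φ = Complex.I * amplitude (fun k => ((‖k‖ : ℝ) : ℂ) * h j k) s) := by
  obtain ⟨g, hg2, hgc, hg0, hfg⟩ := hf
  have hω := memLp_norm_mul_photon hgc hfg
  refine ⟨fun j k => formFactor κ k * g k j, fun j => ?_, fun j s => ?_⟩
  · refine IsAway.mul ⟨?_, ?_, ?_⟩ fun k hk => contDiffAt_formFactor κ hk
    · exact (EuclideanSpace.proj (𝕜 := ℂ) j).restrictScalars ℝ |>.contDiff.comp hg2
    · exact hgc.comp_left (g := fun v : EuclideanSpace ℂ (Fin 3) => v j) rfl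
    · exact fun h => hg0 (tsupport_comp_subset (g := fun v : EuclideanSpace ℂ (Fin 3) => v j) rfl g h)
  · have h1 := inner_coupling_evolve κ ε j s (hfg.mono fun k hk => hk j)
    refine ⟨h1, ?_, ?_⟩
    · obtain ⟨Φ, h2, h3⟩ := vacuum_mem_graph_vectorPotentialAt_mul_creation κ ε j s f
      exact ⟨Φ, h2, h3.trans h1⟩
    · obtain ⟨Φ, h2, h3⟩ := vacuum_mem_graph_electricFieldAt_mul_creation s
        (memLp_norm_mul_coupling κ ε j) hω.coeFn_toLp
      refine ⟨Φ, h2, h3.trans ?_⟩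
      have h4 : ∀ᵐ k : R3, ((‖k‖ : ℝ) : ℂ) * g k j =
          ∑ l : Fin 2, ((ε.vec k l j : ℝ) : ℂ) * (hω.toLp : PhotonSpace) (k, l) := by
        have h5 : ∀ᵐ k : R3, ∀ l : Fin 2, (hω.toLp : PhotonSpace) (k, l) =
            ((‖k‖ : ℝ) : ℂ) * f (k, l) :=
          (Measure.ae_ae_of_ae_prod (μ := (volume : Measure R3))
            (ν := (Measure.count : Measure (Fin 2))) hω.coeFn_toLp).mono
            fun k hk => Measure.ae_count_iff.1 hk
        filter_upwards [hfg, h5] with k h6 h7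
        simp only [h6 j, h7, Finset.mul_sum]
        exact Finset.sum_congr rfl fun l _ => by ring
      rw [inner_coupling_evolve κ ε j s h4]
      congr 2
      ext k
      ring

end OnePhoton

/-! ### The orbits of the electron observables -/

section Orbits

/-- The ground state lies in the domains of `p_j(s)` and `x_j(s)`, and
`d/ds x_j(s) φ = 2 p_j(s) φ`. The second alternative in the last clause concerns the convention
`unitaryGroup H = 1` for an operator `H` that generates no unitary group. -/
theorem IsGroundState.exists_orbits {V : R3 → ℝ} (hV : AdmissiblePotential V) {φ : ElectronSpace}
    (hφ : IsGroundState V φ) (j : Fin 3) :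
    ∃ p x : ℝ → ElectronSpace, Continuous p ∧ Continuous x ∧ (∃ C, ∀ s, ‖p s‖ ≤ C) ∧
      (∃ C, ∀ s, ‖x s‖ ≤ C) ∧ (∀ s, (φ, p s) ∈ (momentumAt V j s).graph) ∧
      (∀ s, (φ, x s) ∈ (positionAt V j s).graph) ∧
      ((∀ s, HasDerivAt x ((2 : ℂ) • p s) s) ∨
        ∃ p₀ x₀, (p = fun _ => p₀) ∧ x = fun _ => x₀) := by
  obtain ⟨xφ, pφ, hx, hp, hd⟩ :=
    exists_position_momentum_of_eigenvector hV.tendsto_zero hV.groundEnergy_neg hφ.2 j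
  by_cases h : ∃ U, IsUnitaryGroup (Hel V) U
  · have hU := isUnitaryGroup_unitaryGroup h
    have hc : ∀ ψ, Continuous fun s =>
        phase (groundEnergy V) s • unitaryGroup (Hel V) (-s) ψ := fun ψ =>
      (continuous_phase _).smul ((hU.continuous ψ).comp continuous_neg)
    have hb : ∀ ψ s, ‖phase (groundEnergy V) s • unitaryGroup (Hel V) (-s) ψ‖ ≤ ‖ψ‖ :=
      fun ψ s => by rw [norm_smul, norm_phase, one_mul, hU.norm_map]
    refine ⟨_, _, hc pφ, hc xφ, ⟨_, hb pφ⟩, ⟨_, hb xφ⟩,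
      hU.mem_graph_heisenberg hφ.2 hp, hU.mem_graph_heisenberg hφ.2 hx, Or.inl fun s => ?_⟩
    refine (hU.hasDerivAt_phase_smul hd s).congr_deriv ?_
    have e : Complex.I • ((groundEnergy V : ℂ) • xφ - (2 * Complex.I) • pφ -
        (groundEnergy V : ℂ) • xφ) = (2 : ℂ) • pφ := by
      rw [sub_sub_cancel_left, smul_neg, smul_smul, ← neg_smul]
      congr 1
      linear_combination (-2) * Complex.I_mul_I
    rw [e, map_smul, smul_comm]
  · have e : ∀ s, unitaryGroup (Hel V) s = ContinuousLinearMap.id ℂ ElectronSpace := fun s => by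
      rw [unitaryGroup, dif_neg h]
    have hg : ∀ {B : ElectronSpace →ₗ.[ℂ] ElectronSpace} {χ : ElectronSpace} (s : ℝ),
        (φ, χ) ∈ B.graph → (φ, χ) ∈ (heisenberg (Hel V) B s).graph := fun s hB => by
      rw [heisenberg, e, e]
      exact mem_graph_opMul (mem_graph_opMul (mem_graph_opBdd _ _) hB) (mem_graph_opBdd _ _)
    exact ⟨_, _, continuous_const, continuous_const, ⟨_, fun _ => le_rfl⟩, ⟨_, fun _ => le_rfl⟩,
      fun s => hg s hp, fun s => hg s hx, Or.inr ⟨pφ, xφ, rfl, rfl⟩⟩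

theorem IsAway.integrable_amplitude_smul {h : R3 → ℂ} (hh : IsAway 2 h) {p : ℝ → ElectronSpace}
    (hp : Continuous p) {C : ℝ} (hC : ∀ s, ‖p s‖ ≤ C) :
    Integrable fun s => amplitude h s • p s :=
  hh.integrable_amplitude.smul_bdd C hp.aestronglyMeasurable (Eventually.of_forall hC)

/-- Integration by parts in time: `-i a_{|k| h}` is the derivative of the amplitude `a_h`. -/
theorem IsAway.integral_amplitude_smul {h : R3 → ℂ} (hh : IsAway 2 h) {p x : ℝ → ElectronSpace}
    (hp : Continuous p) (hx : Continuous x) {C D : ℝ} (hC : ∀ s, ‖p s‖ ≤ C) (hD : ∀ s, ‖x s‖ ≤ D)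
    (hd : ∀ s, HasDerivAt x ((2 : ℂ) • p s) s) :
    ∫ s, amplitude h s • (2 : ℂ) • p s =
      ∫ s, (Complex.I * amplitude (fun k => ((‖k‖ : ℝ) : ℂ) * h k) s) • x s := by
  have h1 := hh.integrable_amplitude_smul (p := fun s => (2 : ℂ) • p s) (hp.const_smul (2 : ℂ))
    (C := 2 * C) fun s => by
      rw [norm_smul, Complex.norm_ofNat]; exact mul_le_mul_of_nonneg_left (hC s) zero_le_two
  have h2 := hh.integrable_amplitude_smul hx hD
  have h3 := (hh.norm_mul.integrable_amplitude_smul hx hD).smul (-Complex.I)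
  simp only [Pi.smul_def, smul_smul] at h3
  have key := integral_bilinear_hasDerivAt_right_eq_neg_left_of_integrable
    (L := (ContinuousLinearMap.lsmul ℝ ℂ : ℂ →L[ℝ] ElectronSpace →L[ℝ] ElectronSpace))
    (u := amplitude h) (v := x) (fun s _ => hh.hasDerivAt_amplitude s) (fun s _ => hd s) h1 h3 h2
  simp only [ContinuousLinearMap.lsmul_apply] at key
  rw [key, ← integral_neg]
  simp only [neg_mul, neg_smul, neg_neg]

/-- The momentum and position forms of the contribution of one component of the field. -/
theorem IsGroundState.integral_momentum_eq_integral_position {V : R3 → ℝ}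
    (hV : AdmissiblePotential V) {φ : ElectronSpace} (hφ : IsGroundState V φ) (j : Fin 3) :
    (∀ s, φ ∈ (momentumAt V j s).domain ∧ φ ∈ (positionAt V j s).domain) ∧
    ∀ h, IsAway 2 h →
      Integrable (fun s => amplitude h s • (2 : ℂ) • opVal (momentumAt V j s) φ) ∧
      Integrable (fun s => (Complex.I * amplitude (fun k => ((‖k‖ : ℝ) : ℂ) * h k) s) •
        opVal (positionAt V j s) φ) ∧
      ∫ s, amplitude h s • (2 : ℂ) • opVal (momentumAt V j s) φ =
        ∫ s, (Complex.I * amplitude (fun k => ((‖k‖ : ℝ) : ℂ) * h k) s) •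
          opVal (positionAt V j s) φ := by
  obtain ⟨p, x, hp, hx, ⟨C, hC⟩, ⟨D, hD⟩, hpg, hxg, hd⟩ := hφ.exists_orbits hV j
  refine ⟨fun s => ⟨mem_domain_of_mem_graph (hpg s), mem_domain_of_mem_graph (hxg s)⟩,
    fun h hh => ?_⟩
  simp only [opVal_eq_of_mem_graph (hpg _), opVal_eq_of_mem_graph (hxg _)]
  refine ⟨?_, ?_, ?_⟩
  · have := (hh.integrable_amplitude_smul hp hC).smul (2 : ℂ)
    refine this.congr (Eventually.of_forall fun s => ?_)
    exact smul_comm (2 : ℂ) (amplitude h s) (p s)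
  · have := (hh.norm_mul.integrable_amplitude_smul hx hD).smul Complex.I
    simpa only [Pi.smul_def, smul_smul] using this
  · rcases hd with hd | ⟨p₀, x₀, rfl, rfl⟩
    · exact hh.integral_amplitude_smul hp hx hC hD hd
    · -- constant orbits: both amplitudes have integral zero
      rw [integral_smul_const, integral_smul_const, integral_const_mul, hh.integral_amplitude,
        hh.norm_mul.integral_amplitude, mul_zero, zero_smul, zero_smul]

end Orbits

/-! ### Electron and photons -/

section Total

/-- The continuous bilinear map `(φ, Ψ) ↦ φ ⊗ Ψ`. -/
def tensL : ElectronSpace →L[ℂ] Fock →L[ℂ] TotalSpace :=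
  (ContinuousLinearMap.compL ℂ Fock (ElectronSpace ⊗[ℂ] Fock) TotalSpace
    UniformSpace.Completion.toComplL).comp (TensorProduct.mkL ℂ _ _)

theorem tensL_apply (a : ElectronSpace) (Ψ : Fock) : tensL a Ψ = tens a Ψ := rfl

theorem tensorId_tens (B : ElectronSpace →L[ℂ] ElectronSpace) (a : ElectronSpace) (Ψ : Fock) :
    tensorId B (tens a Ψ) = tens (B a) Ψ := by
  rw [tensorId, tens, ContinuousLinearMap.completion_apply_coe, TensorProduct.mapL_tmul]
  rfl

/-- Pythagoras for a sum of pure tensors with orthogonal second factors. -/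
theorem norm_sq_sum_tmul {ι E F : Type*} [Fintype ι] [NormedAddCommGroup E]
    [InnerProductSpace ℂ E] [NormedAddCommGroup F] [InnerProductSpace ℂ F] {a : ι → E} {Ψ : ι → F}
    (h : ∀ i j, i ≠ j → inner ℂ (Ψ i) (Ψ j) = 0) :
    ‖∑ i, ((a i ⊗ₜ[ℂ] Ψ i : E ⊗[ℂ] F) : UniformSpace.Completion (E ⊗[ℂ] F))‖ ^ 2 =
      ∑ i, ‖Ψ i‖ ^ 2 * ‖a i‖ ^ 2 := by
  have e : ∑ i, ((a i ⊗ₜ[ℂ] Ψ i : E ⊗[ℂ] F) : UniformSpace.Completion (E ⊗[ℂ] F)) =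
      ((∑ i, a i ⊗ₜ[ℂ] Ψ i : E ⊗[ℂ] F) : UniformSpace.Completion (E ⊗[ℂ] F)) :=
    (map_sum (UniformSpace.Completion.toComplL (𝕜 := ℂ) (E := E ⊗[ℂ] F)) _ _).symm
  have key : inner ℂ (∑ i, a i ⊗ₜ[ℂ] Ψ i) (∑ i, a i ⊗ₜ[ℂ] Ψ i) =
      ∑ i, (((‖Ψ i‖ ^ 2 * ‖a i‖ ^ 2 : ℝ)) : ℂ) := by
    simp_rw [sum_inner, inner_sum, TensorProduct.inner_tmul]
    refine Finset.sum_congr rfl fun i _ => ?_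
    rw [Finset.sum_eq_single i (fun j _ hj => by rw [h i j hj.symm, mul_zero]) (by simp),
      inner_self_eq_norm_sq_to_K, inner_self_eq_norm_sq_to_K]
    push_cast
    exact mul_comm _ _
  have h1 := inner_self_eq_norm_sq_to_K (𝕜 := ℂ) (∑ i, a i ⊗ₜ[ℂ] Ψ i)
  rw [e, UniformSpace.Completion.norm_coe]
  refine Complex.ofReal_injective ?_
  rw [Complex.ofReal_pow, Complex.ofReal_sum]
  exact h1.symm.trans key

theorem norm_sq_sum_tens {ι : Type*} [Fintype ι] {a : ι → ElectronSpace} {Ψ : ι → Fock}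
    (h : ∀ i j, i ≠ j → inner ℂ (Ψ i) (Ψ j) = 0) :
    ‖∑ i, tens (a i) (Ψ i)‖ ^ 2 = ∑ i, ‖Ψ i‖ ^ 2 * ‖a i‖ ^ 2 :=
  norm_sq_sum_tmul h

/-- The photon vector `√m_l |…, m_l - 1, …⟩` that is left when `A(0, s)` absorbs a photon in the
state `f_l`. -/
def absorbed {n : ℕ} (f : Fin n → PhotonSpace) (m : Fin n → ℕ) (l : Fin n) : Fock :=
  ((Real.sqrt (m l) : ℝ) : ℂ) • (occVec f (lower m l) : Fock)

theorem inner_absorbed {n : ℕ} {f : Fin n → PhotonSpace} (hf : Orthonormal ℂ f) (m : Fin n → ℕ)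
    {l l' : Fin n} (h : l ≠ l') : inner ℂ (absorbed f m l) (absorbed f m l') = 0 := by
  rw [absorbed, absorbed, inner_smul_left, inner_smul_right, inner_occVec hf]
  split_ifs with e
  · -- lowering two different modes gives the same occupation numbers only if both are empty
    have h1 := congrFun e l
    rw [lower, lower, Function.update_self, Function.update_of_ne h] at h1
    have h2 : m l = 0 := by omega
    simp [h2]
  · simp

theorem norm_absorbed_sq {n : ℕ} {f : Fin n → PhotonSpace} (hf : Orthonormal ℂ f)
    (m : Fin n → ℕ) (l : Fin n) : ‖absorbed f m l‖ ^ 2 = m l := by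
  have h := inner_self_eq_norm_sq_to_K (𝕜 := ℂ) (absorbed f m l)
  nth_rewrite 1 2 [absorbed] at h
  rw [inner_smul_left, inner_smul_right, inner_occVec hf, if_pos rfl, mul_one,
    Complex.conj_ofReal, ← Complex.ofReal_mul,
    Real.mul_self_sqrt (Nat.cast_nonneg _)] at h
  exact (Complex.ofReal_injective (h.trans (Complex.ofReal_pow _ _).symm)).symm

theorem inner_opVal_vectorPotentialAt_mul_creation (κ : 𝓢(R3, ℂ)) (ε : Polarization) (j : Fin 3)
    (s : ℝ) (f : PhotonSpace) :
    inner ℂ vacuum (opVal (opMul (vectorPotentialAt κ ε j s) (creation f)) vacuum) =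
      inner ℂ (coupling κ ε j) (evolve s f) := by
  obtain ⟨Φ, h1, h2⟩ := vacuum_mem_graph_vectorPotentialAt_mul_creation κ ε j s f
  rw [opVal_eq_of_mem_graph h1, h2]

/-- By the commutation relations the integrand separates: the electron vector that goes with the
absorption of a photon in the state `f_l` is the one-photon integrand for `f_l`. -/
theorem ionizationIntegrand_eq (V : R3 → ℝ) (φ : ElectronSpace) (κ : 𝓢(R3, ℂ)) (ε : Polarization)
    {n : ℕ} (f : Fin n → PhotonSpace) (m : Fin n → ℕ) (s : ℝ) :
    ionizationIntegrand V φ κ ε f m s =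
      ∑ l, tens (momentumIntegrand V φ κ ε (f l) s) (absorbed f m l) := by
  simp only [ionizationIntegrand, momentumIntegrand, inner_opVal_vectorPotentialAt_mul_creation,
    opVal_eq_of_mem_graph (vacuum_mem_graph_opComm κ ε _ s f m), ← tensL_apply, absorbed, map_sum,
    _root_.sum_apply, inner_evolve]
  rw [Finset.sum_comm]
  refine Finset.sum_congr rfl fun l _ => Finset.sum_congr rfl fun j _ => ?_
  simp only [map_smul, _root_.smul_apply]
  module

theorem integrable_tens {a : ℝ → ElectronSpace} (ha : Integrable a) (Ψ : Fock) :
    Integrable fun s => tens (a s) Ψ :=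
  (tensL.flip Ψ).integrable_comp ha

theorem integral_tens {a : ℝ → ElectronSpace} (ha : Integrable a) (Ψ : Fock) :
    ∫ s, tens (a s) Ψ = tens (∫ s, a s) Ψ :=
  (tensL.flip Ψ).integral_comp_comm ha

theorem integrable_ionizationIntegrand {V : R3 → ℝ} {φ : ElectronSpace} {κ : 𝓢(R3, ℂ)}
    {ε : Polarization} {n : ℕ} {f : Fin n → PhotonSpace}
    (hi : ∀ l, Integrable (momentumIntegrand V φ κ ε (f l))) (m : Fin n → ℕ) :
    Integrable (ionizationIntegrand V φ κ ε f m) := by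
  rw [funext (ionizationIntegrand_eq V φ κ ε f m)]
  exact integrable_finsetSum _ fun l _ => integrable_tens (hi l) _

/-- The vectors left by the absorption of photons from different modes are orthogonal, so that the
modes contribute independently. -/
theorem P3_eq_sum {V : R3 → ℝ} {φ : ElectronSpace} {κ : 𝓢(R3, ℂ)} {ε : Polarization} {n : ℕ}
    {f : Fin n → PhotonSpace} (hf : Orthonormal ℂ f)
    (hi : ∀ l, Integrable (momentumIntegrand V φ κ ε (f l))) (m : Fin n → ℕ) :
    P3 V φ κ ε f m =
      ∑ l, (m l : ℝ) * ‖acProj (Hel V) (∫ s, momentumIntegrand V φ κ ε (f l) s)‖ ^ 2 := by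
  rw [P3, funext (ionizationIntegrand_eq V φ κ ε f m),
    integral_finsetSum _ fun l _ => integrable_tens (hi l) _, map_sum]
  simp only [integral_tens (hi _), tensorId_tens]
  rw [norm_sq_sum_tens fun l l' h => inner_absorbed hf m h]
  simp only [norm_absorbed_sq hf]

theorem P3one_eq {V : R3 → ℝ} {φ : ElectronSpace} {κ : 𝓢(R3, ℂ)} {ε : Polarization}
    {f : PhotonSpace} (hf : ‖f‖ = 1) (hi : Integrable (momentumIntegrand V φ κ ε f)) :
    P3one V φ κ ε f = ‖acProj (Hel V) (∫ s, momentumIntegrand V φ κ ε f s)‖ ^ 2 := by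
  have ho : Orthonormal ℂ fun _ : Fin 1 => f :=
    ⟨fun _ => hf, fun i j hij => absurd (Subsingleton.elim i j) hij⟩
  rw [P3one, P3_eq_sum ho (fun _ => hi)]
  simp

/-- For a regular photon both integrands are integrable, with the same integral. -/
theorem IsRegularPhoton.integral_momentumIntegrand {V : R3 → ℝ} (hV : AdmissiblePotential V)
    {φ : ElectronSpace} (hφ : IsGroundState V φ) (κ : 𝓢(R3, ℂ)) {ε : Polarization}
    {f : PhotonSpace} (hf : IsRegularPhoton ε f) :
    Integrable (momentumIntegrand V φ κ ε f) ∧ Integrable (positionIntegrand V φ κ ε f) ∧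
      ∫ s, momentumIntegrand V φ κ ε f s = ∫ s, positionIntegrand V φ κ ε f s := by
  obtain ⟨h, hh, hs⟩ := hf.exists_amplitude κ
  have e1 : ∀ j s, inner ℂ vacuum (opVal (opMul (vectorPotentialAt κ ε j s) (creation f)) vacuum) =
      amplitude (h j) s := fun j s => by
    obtain ⟨Φ, hg, hΦ⟩ := (hs j s).2.1
    rw [opVal_eq_of_mem_graph hg, hΦ]
  have e2 : ∀ j s, inner ℂ vacuum (opVal (opMul (electricFieldAt κ ε j s) (creation f)) vacuum) =
      Complex.I * amplitude (fun k => ((‖k‖ : ℝ) : ℂ) * h j k) s := fun j s => by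
    obtain ⟨Φ, hg, hΦ⟩ := (hs j s).2.2
    rw [opVal_eq_of_mem_graph hg, hΦ]
  have key := fun j => (hφ.integral_momentum_eq_integral_position hV j).2 (h j) (hh j)
  unfold momentumIntegrand positionIntegrand
  simp only [e1, e2]
  refine ⟨integrable_finsetSum _ fun j _ => (key j).1,
    integrable_finsetSum _ fun j _ => (key j).2.1, ?_⟩
  rw [integral_finsetSum _ fun j _ => (key j).1, integral_finsetSum _ fun j _ => (key j).2.1]
  exact Finset.sum_congr rfl fun j _ => (key j).2.2

end Total

end Photoeffect

end

theorem propositionl3p3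
    (V : R3 → ℝ) (hV : AdmissiblePotential V)
    (φ : ElectronSpace) (hφ : IsGroundState V φ)
    (κ : 𝓢(R3, ℂ)) (ε : Polarization)
    (n : ℕ) (f : Fin n → PhotonSpace) (m : Fin n → ℕ)
    (hf : Orthonormal ℂ f) (hreg : ∀ l, IsRegularPhoton ε (f l)) :
    -- all expressions are well defined: the vectors lie in the domains of the operators
    (∀ (s : ℝ) (j : Fin 3),
      φ ∈ (momentumAt V j s).domain ∧ φ ∈ (positionAt V j s).domain ∧
      vacuum ∈ (opComm (vectorPotentialAt κ ε j s) (creationOcc f m)).domain ∧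
      ∀ l, vacuum ∈ (opMul (vectorPotentialAt κ ε j s) (creation (f l))).domain ∧
        vacuum ∈ (opMul (electricFieldAt κ ε j s) (creation (f l))).domain) ∧
    -- and the integrals over `s` converge absolutely
    Integrable (ionizationIntegrand V φ κ ε f m) ∧
    (∀ l, Integrable (momentumIntegrand V φ κ ε (f l)) ∧
      Integrable (positionIntegrand V φ κ ε (f l))) ∧
    -- additivity
    P3 V φ κ ε f m = ∑ l, (m l : ℝ) * P3one V φ κ ε (f l) ∧
    -- the two expressions for the one-photon contributions
    (∀ l, P3one V φ κ ε (f l) =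
        ‖acProj (Hel V) (∫ s : ℝ, momentumIntegrand V φ κ ε (f l) s)‖ ^ 2 ∧
      P3one V φ κ ε (f l) =
        ‖acProj (Hel V) (∫ s : ℝ, positionIntegrand V φ κ ε (f l) s)‖ ^ 2) := by
  have hi := fun l => (hreg l).integral_momentumIntegrand hV hφ κ
  refine ⟨fun s j => ?_, integrable_ionizationIntegrand (fun l => (hi l).1) m,
    fun l => ⟨(hi l).1, (hi l).2.1⟩, ?_, fun l => ⟨P3one_eq (hf.1 l) (hi l).1, ?_⟩⟩
  · have hd := (hφ.integral_momentum_eq_integral_position hV j).1 s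
    refine ⟨hd.1, hd.2, mem_domain_of_mem_graph (vacuum_mem_graph_opComm κ ε j s f m), fun l => ?_⟩
    obtain ⟨h, -, hs⟩ := (hreg l).exists_amplitude κ
    obtain ⟨-, ⟨Φ, hΦ, -⟩, ⟨Ψ, hΨ, -⟩⟩ := hs j s
    exact ⟨mem_domain_of_mem_graph hΦ, mem_domain_of_mem_graph hΨ⟩
  · rw [P3_eq_sum hf (fun l => (hi l).1) m]
    exact Finset.sum_congr rfl fun l _ => by rw [P3one_eq (hf.1 l) (hi l).1]
  · rw [P3one_eq (hf.1 l) (hi l).1, (hi l).2.2]
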